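/- Let $p,q\ge 2$ be integers with $p\equiv q \pmod 2$ and $(p,q)\neq(2,2)$, and put $n=p+q-2$ (so $n\ge 4$ is even). Put $\epsilon=(-1)^{(p-q)/2}$, and let $\delta=1$ if $p-q\equiv 0,2 \pmod 8$ and $\delta=-1$ if $p-q\equiv 4,6\pmod 8$. Write $z=(z',z'')\in\mathbb R^n=\mathbb R^{p-1}\times\mathbb R^{q-1}$ and $P(z)=|z'|^2-|z''|^2$. Let $(P+i0)^{1-\frac n2}$ be the limit of the distributions $(P+iR)^{1-\frac n2}$ (principal branch) as the positive definite quadratic form $R$ tends to $0$, and set $$E=-\frac{\Gamma(\frac n2-1)\,e^{i\pi(q-1)/2}}{4\pi^{n/2}}\,(P+i0)^{1-\frac n2},\qquad E_0=\frac1{2\pi i}\bigl(-E+\overline E\bigr),\qquad S\varphi=E_0*\varphi\quad(\varphi\in C_0^\infty(\mathbb R^n)).$$ For $\operatorname{Re}\nu>0$ and $y\in\mathbb R$ let $\psi_{\nu,\epsilon}(y)=\Gamma\bigl(\tfrac{2\nu+3-\epsilon}4\bigr)^{-1}|y|^\nu\chi_\epsilon(\operatorname{sgn}y)$, where $\chi_1\equiv1$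 and $\chi_{-1}=\operatorname{sgn}$; let $\psi_{\nu,\epsilon}(P(z))$, $\operatorname{Re}\nu>-\frac n2$, be the distribution on $\mathbb R^n$ obtained by analytic continuation in $\nu$. The Knapp–Stein operator in the flat picture is $A^{\mathbb R^n}_{\lambda,\epsilon}\varphi=2\,\psi_{\lambda-\frac n2,\epsilon}(P(z))*\varphi$ for $\varphi\in C_0^\infty(\mathbb R^n)$. Let $M=S^{p-1}\times S^{q-1}\subset\mathbb R^p\times\mathbb R^q$ and $$V^{p,q}=\Bigl\{F\in C^\infty(M):\ \bigl(\Delta_{S^{p-1}}-\Delta_{S^{q-1}}-(\tfrac{p-2}2)^2+(\tfrac{q-2}2)^2\bigr)F=0\Bigr\}.$$ With $\iota(z)=\bigl(1-\tfrac{P(z)}4,\,z',\,z'',\,1+\tfrac{P(z)}4\bigr)$, let $\tau(z)>0$ be the common Euclidean length of its components $(1-\tfrac{P(z)}4,z')\in\mathbb R^p$ and $(z'',1+\tfrac{P(z)}4)\in\mathbb R^q$, let $\Psi(z)=\tau(z)^{-1}\iota(z)\in M$, and let $(\Psi^*_{\lambda}F)(z)=\tau(z)^{-\lambda}F(\Psi(z))$.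 Proposition 4.6. The distributions $(P+i0)^{1-\frac n2}$ and $\psi_{1-\frac n2,\epsilon}(P(z))$ exist, and with $$c_2=\frac{4\,\delta\,\pi^{n/2}\,\Gamma\bigl(\frac{-1+n+\epsilon}4\bigr)}{\Gamma(\frac n2-1)}$$ one has $$\psi_{1-\frac n2,\epsilon}(P(z))=c_2E_0,\qquad A^{\mathbb R^n}_{1,\epsilon}\varphi=2c_2\,S\varphi\quad\text{for all }\varphi\in C_0^\infty(\mathbb R^n).$$ In particular, $S(C_0^\infty(\mathbb R^n))\subset\Psi^*_{\frac{n-2}2}(V^{p,q})$. -/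

import Mathlib

open scoped Distributions ContDiff Manifold EuclideanSpace InnerProductSpace Topology

noncomputable section

namespace UltraHyperbolic

/-! ### The flat space `ℝⁿ = ℝ^{p-1} × ℝ^{q-1}`, `n = p + q - 2` -/

/-- `ℝⁿ = ℝ^{p-1} × ℝ^{q-1}` with coordinates `z = (z', z'')`, where `z' = (z (inl i))_i` and
`z'' = (z (inr j))_j`. -/
abbrev Flat (p q : ℕ) : Type := EuclideanSpace ℝ (Fin (p - 1) ⊕ Fin (q - 1))

/-- The number `n = p + q - 2`, as a real number. -/
def dimN (p q : ℕ) : ℝ := (p : ℝ) + (q : ℝ) - 2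

/-- The quadratic form `P(z) = |z'|² - |z''|²` of signature `(p-1, q-1)`. -/
def quadP {p q : ℕ} (z : Flat p q) : ℝ :=
  ∑ i, z (Sum.inl i) ^ 2 - ∑ j, z (Sum.inr j) ^ 2

/-- Complex-valued compactly supported smooth functions, `C₀^∞(ℝⁿ)`. -/
abbrev CcInfty (p q : ℕ) : Type := 𝓓((⊤ : TopologicalSpace.Opens (Flat p q)), ℂ)

/-- Real-valued compactly supported smooth functions on `ℝⁿ`. -/
abbrev CcInftyReal (p q : ℕ) : Type := 𝓓((⊤ : TopologicalSpace.Opens (Flat p q)), ℝ)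

/-- Complex-valued Schwartz distributions on `ℝⁿ` (in Mathlib: continuous real-linear maps from
real-valued test functions to `ℂ`). -/
abbrev Distr (p q : ℕ) : Type := 𝓓'((⊤ : TopologicalSpace.Opens (Flat p q)), ℂ)

/-! ### Operations on distributions -/

/-- The product `c • T` of a complex number and a distribution. -/
def cmul {p q : ℕ} (c : ℂ) (T : Distr p q) : Distr p q :=
  Distribution.mapCLM ((ContinuousLinearMap.mul ℝ ℂ) c) T

/-- The complex conjugate `T̄` of a distribution. -/
def conjDistr {p q : ℕ} (T : Distr p q) : Distr p q :=
  Distribution.mapCLM (Complex.conjCLE : ℂ →L[ℝ] ℂ) T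

/-- The real-valued test function `x ↦ L (φ (y - x))`; it is used for `L = Re` and `L = Im`. -/
def reflectTranslate {p q : ℕ} (L : ℂ →L[ℝ] ℝ) (φ : CcInfty p q) (y : Flat p q) :
    CcInftyReal p q where
  toFun x := L (φ (y - x))
  contDiff' := L.contDiff.comp (φ.contDiff.comp (contDiff_const.sub contDiff_id))
  hasCompactSupport' := by
    have h : HasCompactSupport (fun x => φ (y - x)) :=
      φ.hasCompactSupport.comp_homeomorph (Homeomorph.subLeft y)
    exact h.comp_left (g := fun w => L w) (map_zero L)
  tsupport_subset' := by
    intro x _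
    trivial

/-- The convolution `(T * φ)(y) = ⟨T, φ(y - ·)⟩` of a distribution with a complex-valued test
function; `T` is extended to complex-valued test functions by complex linearity. -/
def conv {p q : ℕ} (T : Distr p q) (φ : CcInfty p q) (y : Flat p q) : ℂ :=
  T (reflectTranslate Complex.reCLM φ y) +
    Complex.I * T (reflectTranslate Complex.imCLM φ y)

/-! ### The distribution `(P + i0)^l`, the fundamental solution `E` and the Green function `E₀` -/

/-- `T = (P + i0)^l`: for every test function, `T` is the limit of the integrals against
`(P + iR)^l` (principal branch) as the positive definite quadratic form `R` tends to `0`.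
The integrals converge absolutely for `Re l > -n/2`. -/
def IsQuadPAddIZeroPow {p q : ℕ} (l : ℂ) (T : Distr p q) : Prop :=
  ∀ φ : CcInftyReal p q,
    Filter.Tendsto
      (fun R : Matrix (Fin (p - 1) ⊕ Fin (q - 1)) (Fin (p - 1) ⊕ Fin (q - 1)) ℝ =>
        ∫ x : Flat p q,
          ((quadP x : ℂ) + Complex.I * ((x.ofLp ⬝ᵥ R.mulVec x.ofLp : ℝ) : ℂ)) ^ l * (φ x : ℂ))
      (𝓝[{R | R.PosDef}] 0) (𝓝 (T φ))

open Classical in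
/-- The distribution `(P + i0)^l` (zero if the defining limit does not exist). -/
def quadPAddIZeroPow (p q : ℕ) (l : ℂ) : Distr p q :=
  if h : ∃ T : Distr p q, IsQuadPAddIZeroPow l T then h.choose else 0

/-- `E = - Γ(n/2 - 1) e^{iπ(q-1)/2} / (4 π^{n/2}) · (P + i0)^{1 - n/2}`. -/
def fundE (p q : ℕ) : Distr p q :=
  cmul (-(Complex.Gamma ((dimN p q : ℂ) / 2 - 1) *
      Complex.exp (Complex.I * Real.pi * ((q : ℂ) - 1) / 2)) /
        (4 * (Real.pi : ℂ) ^ ((dimN p q : ℂ) / 2)))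
    (quadPAddIZeroPow p q (1 - (dimN p q : ℂ) / 2))

/-- The Green function `E₀ = (-E + Ē) / (2πi)`. -/
def greenE₀ (p q : ℕ) : Distr p q :=
  cmul (1 / (2 * Real.pi * Complex.I)) (-fundE p q + conjDistr (fundE p q))

/-- The operator `S φ = E₀ * φ`. -/
def opS (p q : ℕ) (φ : CcInfty p q) : Flat p q → ℂ := conv (greenE₀ p q) φ

/-! ### The Knapp–Stein kernel `ψ_{ν,ε}(P(z))` and the Knapp–Stein operator -/

/-- `χ_ε(sgn y)`: `1` for `ε = 1`, and `sgn y` for `ε = -1`. -/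
def chi (ε : ℤ) (y : ℝ) : ℂ := if ε = 1 then 1 else ((SignType.sign y : ℤ) : ℂ)

/-- The function `ψ_{ν,ε}(y) = |y|^ν χ_ε(sgn y) / Γ((2ν + 3 - ε)/4)` of a real variable `y`;
it is a continuous function for `Re ν > 0`. -/
def psiFun (ν : ℂ) (ε : ℤ) (y : ℝ) : ℂ :=
  1 / Complex.Gamma ((2 * ν + 3 - ε) / 4) * ((|y| : ℝ) : ℂ) ^ ν * chi ε y

/-- `T = ψ_{ν,ε}(P(z))`, defined by analytic continuation in the parameter: for every test
function `φ`, the integral of `ψ_{μ,ε}(P(z)) φ(z)`, `Re μ > 0`, extends to a holomorphic function of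
`μ` in the half-plane `Re μ > -n/2`, and `T φ` is the value of this extension at `ν`. -/
def IsKnappSteinKernel {p q : ℕ} (ν : ℂ) (ε : ℤ) (T : Distr p q) : Prop :=
  -(dimN p q) / 2 < ν.re ∧
  ∀ φ : CcInftyReal p q, ∃ F : ℂ → ℂ,
    DifferentiableOn ℂ F {μ : ℂ | -(dimN p q) / 2 < μ.re} ∧
    (∀ μ : ℂ, 0 < μ.re → F μ = ∫ x : Flat p q, psiFun μ ε (quadP x) * (φ x : ℂ)) ∧
    T φ = F ν

open Classical in
/-- The distribution `ψ_{ν,ε}(P(z))` on `ℝⁿ` (zero if the analytic continuation does not exist). -/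
def knappSteinKernel (p q : ℕ) (ν : ℂ) (ε : ℤ) : Distr p q :=
  if h : ∃ T : Distr p q, IsKnappSteinKernel ν ε T then h.choose else 0

/-- The Knapp–Stein operator in the flat picture, on `C₀^∞(ℝⁿ)`:
`A_{l,ε} φ = 2 ψ_{l - n/2,ε}(P(z)) * φ`. -/
def knappSteinFlat (p q : ℕ) (l : ℂ) (ε : ℤ) (φ : CcInfty p q) : Flat p q → ℂ :=
  fun y => 2 * conv (knappSteinKernel p q (l - (dimN p q : ℂ) / 2) ε) φ y

/-! ### Constants -/

/-- `ε = (-1)^{(p-q)/2}` (for `p ≡ q mod 2`). -/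
def signEps (p q : ℕ) : ℤ := (-1) ^ (((p : ℤ) - q) / 2).natAbs

/-- `δ = 1` if `p - q ≡ 0, 2 mod 8`, and `δ = -1` if `p - q ≡ 4, 6 mod 8`. -/
def signDelta (p q : ℕ) : ℤ :=
  if ((p : ℤ) - q) % 8 = 0 ∨ ((p : ℤ) - q) % 8 = 2 then 1 else -1

/-- `c₂ = 4 δ π^{n/2} Γ((-1 + n + ε)/4) / Γ(n/2 - 1)`. -/
def constC₂ (p q : ℕ) : ℝ :=
  4 * (signDelta p q : ℝ) * Real.pi ^ (dimN p q / 2) *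
    Real.Gamma ((-1 + dimN p q + (signEps p q : ℝ)) / 4) / Real.Gamma (dimN p q / 2 - 1)

/-! ### The compact space `M = S^{p-1} × S^{q-1}` and its Yamabe operator -/

/-- The unit sphere `S^k` in `ℝ^{k+1}`. -/
abbrev Sph (k : ℕ) : Type := Metric.sphere (0 : EuclideanSpace ℝ (Fin (k + 1))) 1

/-- `M = S^{p-1} × S^{q-1}`. -/
abbrev CompactM (p q : ℕ) : Type := Sph (p - 1) × Sph (q - 1)

/-- Complex-valued smooth functions on the manifold `M`. -/
def IsSmoothM {p q : ℕ} (F : CompactM p q → ℂ) : Prop :=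
  ContMDiff ((𝓡 (p - 1)).prod (𝓡 (q - 1))) 𝓘(ℝ, ℂ) ∞ F

/-- The extension of `f` from the unit sphere to `ℝ^{k+1} ∖ {0}` as a function which is constant
along rays. -/
def radialExt {k : ℕ} (f : Sph k → ℂ) (x : EuclideanSpace ℝ (Fin (k + 1))) : ℂ :=
  if h : x ≠ 0 then f ⟨‖x‖⁻¹ • x, by simp [norm_smul, h]⟩ else 0

/-- The Laplace–Beltrami operator of the standard unit sphere `S^k`: the Euclidean Laplacian of
the extension which is constant along rays, restricted to the sphere. -/
def sphereLaplacian {k : ℕ} (f : Sph k → ℂ) (u : Sph k) : ℂ := Laplacian.laplacian (radialExt f) u.1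

/-- The Yamabe operator `Δ_{S^{p-1}} - Δ_{S^{q-1}} - ((p-2)/2)² + ((q-2)/2)²` of
`M = S^{p-1} × S^{q-1}` with the metric `g_{S^{p-1}} ⊕ (-g_{S^{q-1}})`. -/
def yamabeM {p q : ℕ} (F : CompactM p q → ℂ) (w : CompactM p q) : ℂ :=
  sphereLaplacian (fun u => F (u, w.2)) w.1 - sphereLaplacian (fun v => F (w.1, v)) w.2
    - (((p : ℂ) - 2) / 2) ^ 2 * F w + (((q : ℂ) - 2) / 2) ^ 2 * F w

/-- `V^{p,q}`, the kernel of the Yamabe operator on `C^∞(M)`. -/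
def kerYamabe (p q : ℕ) : Set (CompactM p q → ℂ) :=
  {F | IsSmoothM F ∧ ∀ w, yamabeM F w = 0}

/-! ### The conformal embedding `Ψ : ℝⁿ → M` and the twisted pull-back -/

/-- The first block `(1 - P(z)/4, z') ∈ ℝ^p` of
`ι(z) = (1 - P(z)/4, z', z'', 1 + P(z)/4) ∈ ℝ^p × ℝ^q`. -/
def iotaFst {p q : ℕ} (z : Flat p q) : EuclideanSpace ℝ (Fin (p - 1 + 1)) :=
  WithLp.toLp 2 (Fin.cons (1 - quadP z / 4) (fun i => z (Sum.inl i)))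

/-- The second block `(z'', 1 + P(z)/4) ∈ ℝ^q` of `ι(z)`. -/
def iotaSnd {p q : ℕ} (z : Flat p q) : EuclideanSpace ℝ (Fin (q - 1 + 1)) :=
  WithLp.toLp 2 (Fin.snoc (fun j => z (Sum.inr j)) (1 + quadP z / 4))

/-- `τ(z)`, the length of the first block of `ι(z)`. -/
def tau {p q : ℕ} (z : Flat p q) : ℝ := ‖iotaFst z‖

theorem norm_iotaFst_sq {p q : ℕ} (z : Flat p q) :
    ‖iotaFst z‖ ^ 2 = (1 - quadP z / 4) ^ 2 + ∑ i, z (Sum.inl i) ^ 2 := by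
  rw [EuclideanSpace.norm_sq_eq, Fin.sum_univ_succ]
  simp [iotaFst]

theorem norm_iotaSnd_sq {p q : ℕ} (z : Flat p q) :
    ‖iotaSnd z‖ ^ 2 = ∑ j, z (Sum.inr j) ^ 2 + (1 + quadP z / 4) ^ 2 := by
  rw [EuclideanSpace.norm_sq_eq, Fin.sum_univ_castSucc]
  simp [iotaSnd]

theorem norm_iotaSnd {p q : ℕ} (z : Flat p q) : ‖iotaSnd z‖ = tau z := by
  have h : ‖iotaSnd z‖ ^ 2 = ‖iotaFst z‖ ^ 2 := by
    rw [norm_iotaFst_sq, norm_iotaSnd_sq]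
    unfold quadP
    ring
  exact (sq_eq_sq₀ (norm_nonneg _) (norm_nonneg _)).1 h

theorem tau_ne_zero {p q : ℕ} (z : Flat p q) : tau z ≠ 0 := by
  intro h
  have h1 := norm_iotaFst_sq z
  have h2 := norm_iotaSnd_sq z
  rw [norm_iotaSnd, h] at h2
  change tau z ^ 2 = _ at h1
  rw [h] at h1
  have a : 0 ≤ ∑ i, z (Sum.inl i) ^ 2 := Finset.sum_nonneg fun i _ => sq_nonneg _
  have b : 0 ≤ ∑ j, z (Sum.inr j) ^ 2 := Finset.sum_nonneg fun j _ => sq_nonneg _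
  nlinarith [sq_nonneg (quadP z)]

/-- The conformal embedding `Ψ(z) = τ(z)⁻¹ ι(z)` of `ℝⁿ` into `M`. -/
def PsiEmb {p q : ℕ} (z : Flat p q) : CompactM p q :=
  (⟨(tau z)⁻¹ • iotaFst z, by
      have h := tau_ne_zero z
      unfold tau at *
      simp [norm_smul, h]⟩,
   ⟨(tau z)⁻¹ • iotaSnd z, by
      have h := tau_ne_zero z
      have h' : 0 ≤ tau z := norm_nonneg _
      simp [norm_smul, norm_iotaSnd, h, abs_of_nonneg h']⟩)

/-- The twisted pull-back `(Ψ_l^* F)(z) = τ(z)^{-l} F(Ψ(z))`. -/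
def twistedPullback {p q : ℕ} (l : ℂ) (F : CompactM p q → ℂ) (z : Flat p q) : ℂ :=
  ((tau z : ℝ) : ℂ) ^ (-l) * F (PsiEmb z)

end UltraHyperbolic

end

/-!
Everything is reduced to complex powers of functions with values in the closed right half-plane.
With `q = -i P`, the power `q ^ μ` of the principal branch has no branch problem, and
`(y + i0) ^ μ = e^{iπμ/2} (-i y) ^ μ` turns `(P + i0) ^ μ`, its conjugate and `ψ_{μ,ε}(P)` into
linear combinations of `(-i P) ^ μ` and `(i P) ^ μ`, with coefficients built from the Gamma
function.

*Continuation.* The functional equation `β(∂) q ^ (μ + 1) = 4 (μ + 1) (μ + n/2) q ^ μ` continues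
`∫ q ^ μ φ` meromorphically (`powInt_qform_functional_equation`, `raise`, `bern`). Its value
`regVal` at `μ = -m = 1 - n/2` is expressed as a mean over a circle around `-m` which avoids the zeros of the
polynomial factor. This mean depends continuously on the quadratic form (`continuousOn_regVal`). If
the form has positive definite real part, then it is the convergent integral of `q ^ (-m) φ`
(`regVal_eq_of_definite`); so the limit `R → 0` exists, and the zeros of the polynomial factor in
`Re μ > -n/2` are cancelled also in the limit (`exists_continuation`). This gives the existence of
both distributions (`isQuadPAddIZeroPow_regDistr`, `isKnappSteinKernel_regPDistr`). Both kernels are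
multiples of the same combination of the two regularized powers, and a computation with Gamma
functions identifies the constants (`greenE₀_eq`, `constC₂_mul_greenConst`).

*The wave equation.* Applied to the regularized powers, the wave operator gives multiples of the
delta distribution which cancel in the combination (`regP_boxT_add`). It is enough to compute them
for diagonal forms with positive definite real part, where they come out of the heat kernel. Hence
`S φ` is a smooth solution of the ultrahyperbolic wave equation (`sum_signs_mul_pderiv_opS`).

*Extension to `M`.* The value of `S φ` at `z` integrates `φ` against a power of `P(z - x)`, and
`P(z - x) = -2 ⟪ι(z), ι(x)⟫` for the pairing of signature `(p, q)`. For any point `w` of the light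
cone the polynomial `k(x) = -2 ⟪w, ι(x)⟫` on `ℝⁿ` again satisfies a functional equation, because its
gradient has the square length `4 c k`, where `c` is its leading coefficient
(`famInt_functional_equation`). Hence the regularized integrals of `(∓i k) ^ (-m) φ` extend smoothly
to all of `M`, also across the points at infinity (`contDiffOn_polyVal_comp`, `isSmoothM_greenM`),
and the pull-back of this extension is `S φ` (`twistedPullback_greenM`).

*The Yamabe equation.* Where `c ≠ 0`, the function on `M` is the restriction of a function on
`ℝ^p × ℝ^q` which is homogeneous of degree `-m` and solves the flat wave equation there; Euler's
relations turn this into the Yamabe equation (`yamabeM_eq_zero_of_homExt`). The set `c ≠ 0` is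
dense, and the extension is smooth (`yamabeM_greenM`).
-/

open scoped Distributions ContDiff Manifold EuclideanSpace InnerProductSpace Topology
open MeasureTheory Filter Set

noncomputable section

namespace UltraHyperbolic

section

/-! ### Complex powers on the closed right half-plane -/

theorem mem_slitPlane_of_re_nonneg {w : ℂ} (hw : 0 ≤ w.re) (h0 : w ≠ 0) : w ∈ Complex.slitPlane := by
  rw [Complex.mem_slitPlane_iff]
  rcases hw.lt_or_eq with h | h
  · exact Or.inl h
  · right
    intro him
    exact h0 (Complex.ext h.symm him)

/-- On the closed right half-plane the principal power `w ^ (μ + 1)`, `Re μ > 0`, is complex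
differentiable, the vertex `w = 0` included. -/
theorem hasDerivAt_cpow_add_one {w μ : ℂ} (hw : 0 ≤ w.re) (hμ : 0 < μ.re) :
    HasDerivAt (fun w : ℂ => w ^ (μ + 1)) ((μ + 1) * w ^ μ) w := by
  by_cases h0 : w = 0
  · subst h0
    have hμ0 : μ ≠ 0 := by rintro rfl; simp at hμ
    have hμ1 : μ + 1 ≠ 0 := by
      intro h
      have := congrArg Complex.re h
      simp at this
      linarith
    rw [hasDerivAt_iff_tendsto_slope, Complex.zero_cpow hμ0, mul_zero]
    have hc : Tendsto (fun w : ℂ => w ^ μ) (𝓝[≠] 0) (𝓝 0) := by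
      have := (Complex.continuousAt_cpow_const_of_re_pos (z := 0) (w := μ) (Or.inl le_rfl) hμ).tendsto
      rw [Complex.zero_cpow hμ0] at this
      exact this.mono_left nhdsWithin_le_nhds
    refine hc.congr' ?_
    filter_upwards [self_mem_nhdsWithin] with w hw
    have hw : w ≠ 0 := hw
    simp only [slope, vsub_eq_sub, sub_zero, Complex.zero_cpow hμ1, smul_eq_mul]
    rw [Complex.cpow_add _ _ hw, Complex.cpow_one]
    field_simp
  · have := (hasDerivAt_id w).cpow_const (c := μ + 1) (mem_slitPlane_of_re_nonneg hw h0)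
    simpa using this

theorem norm_cpow_le_mul_exp (w μ : ℂ) :
    ‖w ^ μ‖ ≤ ‖w‖ ^ μ.re * Real.exp (Real.pi * |μ.im|) := by
  refine (Complex.norm_cpow_le w μ).trans ?_
  rw [div_eq_mul_inv, ← Real.exp_neg]
  gcongr
  have h1 := Complex.abs_arg_le_pi w
  calc -(w.arg * μ.im) ≤ |w.arg * μ.im| := neg_le_abs _
    _ = |w.arg| * |μ.im| := abs_mul _ _
    _ ≤ _ := by gcongr

/-- Joint continuity of the principal power on the closed right half-plane. -/
theorem continuousOn_cpow_of_re : ContinuousOn (fun p : ℂ × ℂ => p.1 ^ p.2)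
    {p | 0 ≤ p.1.re ∧ 0 < p.2.re} := fun _ hp =>
  (Complex.continuousAt_cpow_of_re_pos (Or.inl hp.1) hp.2).continuousWithinAt

theorem differentiableAt_const_cpow_exponent {w μ : ℂ} (h : w ≠ 0 ∨ μ ≠ 0) :
    DifferentiableAt ℂ (fun μ : ℂ => w ^ μ) μ :=
  differentiableAt_id.const_cpow h

/-! ### Holomorphic functions on half-planes -/

theorem isOpen_re_gt (a : ℝ) : IsOpen {μ : ℂ | a < μ.re} :=
  isOpen_lt continuous_const Complex.continuous_re

theorem isPreconnected_re_gt (a : ℝ) : IsPreconnected {μ : ℂ | a < μ.re} :=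
  (convex_halfSpace_re_gt a).isPreconnected

theorem eqOn_re_gt_of_eqOn {f g : ℂ → ℂ} {a b : ℝ} (hf : DifferentiableOn ℂ f {μ | a < μ.re})
    (hg : DifferentiableOn ℂ g {μ | a < μ.re}) (h : ∀ μ : ℂ, b < μ.re → f μ = g μ) :
    ∀ μ : ℂ, a < μ.re → f μ = g μ := by
  intro μ hμ
  have hz : ((max a b + 1 : ℝ) : ℂ) ∈ {μ : ℂ | a < μ.re} := by
    simp only [mem_ofPred_eq, Complex.ofReal_re]
    linarith [le_max_left a b]
  refine (hf.analyticOnNhd (isOpen_re_gt a)).eqOn_of_preconnected_of_eventuallyEq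
    (hg.analyticOnNhd (isOpen_re_gt a)) (isPreconnected_re_gt a) hz ?_ hμ
  have : {μ : ℂ | b < μ.re} ∈ 𝓝 ((max a b + 1 : ℝ) : ℂ) := (isOpen_re_gt b).mem_nhds (by
    simp only [mem_ofPred_eq, Complex.ofReal_re]
    linarith [le_max_right a b])
  filter_upwards [this] with x hx using h x hx

/-- A holomorphic function vanishing at finitely many given points is divisible by the product of
the corresponding linear factors. -/
theorem exists_differentiableOn_prod_mul {U : Set ℂ} (hU : IsOpen U) (K : ℕ) (c : ℕ → ℂ)
    (hc : ∀ j < K, c j ∈ U) (hinj : ∀ i < K, ∀ j < K, c i = c j → i = j) (f : ℂ → ℂ)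
    (hf : DifferentiableOn ℂ f U) (h0 : ∀ j < K, f (c j) = 0) :
    ∃ g : ℂ → ℂ, DifferentiableOn ℂ g U ∧
      ∀ z, f z = (∏ j ∈ Finset.range K, (z - c j)) * g z := by
  induction K with
  | zero => exact ⟨f, hf, by simp⟩
  | succ K ih =>
    obtain ⟨g, hg, hfg⟩ := ih (fun j hj => hc j (by omega))
      (fun i hi j hj => hinj i (by omega) j (by omega)) (fun j hj => h0 j (by omega))
    have hgK : g (c K) = 0 := by
      have h1 := hfg (c K)
      rw [h0 K (by omega)] at h1
      have h2 : (∏ j ∈ Finset.range K, (c K - c j)) ≠ 0 := by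
        rw [Finset.prod_ne_zero_iff]
        intro j hj he
        rw [Finset.mem_range] at hj
        have := hinj K (by omega) j (by omega) (sub_eq_zero.1 he)
        omega
      exact (mul_eq_zero.1 h1.symm).resolve_left h2
    refine ⟨dslope g (c K), (Complex.differentiableOn_dslope (hU.mem_nhds (hc K (by omega)))).2 hg, ?_⟩
    intro z
    have h3 : (z - c K) * dslope g (c K) z = g z := by
      have := sub_smul_dslope g (c K) z
      rw [hgK, sub_zero, smul_eq_mul] at this
      exact this
    rw [hfg z, Finset.prod_range_succ, mul_assoc, h3]

/-- A parameter integral of holomorphic functions is holomorphic when it is locally dominated. The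
bound on the derivative is supplied by Cauchy's estimate. -/
theorem differentiableOn_integral {α : Type*} [MeasurableSpace α] {ν : Measure α} {U : Set ℂ}
    (hU : IsOpen U) {f : ℂ → α → ℂ} (hm : ∀ z ∈ U, AEStronglyMeasurable (f z) ν)
    (hd : ∀ᵐ x ∂ν, DifferentiableOn ℂ (fun z => f z x) U)
    (hb : ∀ z ∈ U, ∃ t ∈ 𝓝 z, ∃ g : α → ℝ, Integrable g ν ∧ ∀ᵐ x ∂ν, ∀ y ∈ t, ‖f y x‖ ≤ g x) :
    DifferentiableOn ℂ (fun z => ∫ x, f z x ∂ν) U := by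
  intro z hz
  obtain ⟨t, ht, g, hg, hfg⟩ := hb z hz
  obtain ⟨r, hr, hrt⟩ := Metric.mem_nhds_iff.1 (Filter.inter_mem ht (hU.mem_nhds hz))
  have hr2 : 0 < r / 2 := by positivity
  have hF' : AEStronglyMeasurable (fun x => deriv (fun w => f w x) z) ν := by
    set u : ℕ → ℂ := fun k => z + ((r / 2 / (k + 1) : ℝ) : ℂ) with hu
    have hu_pos : ∀ k : ℕ, 0 < r / 2 / ((k : ℝ) + 1) := fun k => by positivity
    have huU : ∀ k, u k ∈ U := by
      intro k
      refine (hrt ?_).2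
      have h1 : r / 2 / ((k : ℝ) + 1) ≤ r / 2 := div_le_self hr2.le (by linarith [k.cast_nonneg (α := ℝ)])
      rw [Metric.mem_ball, dist_eq_norm, hu]
      simp only [add_sub_cancel_left, Complex.norm_real, Real.norm_eq_abs, abs_of_pos (hu_pos k)]
      linarith
    have hut : Tendsto u atTop (𝓝[≠] z) := by
      rw [tendsto_nhdsWithin_iff]
      constructor
      · have h2 : Tendsto (fun k : ℕ => r / 2 / ((k : ℝ) + 1)) atTop (𝓝 0) := by
          have := (tendsto_one_div_add_atTop_nhds_zero_nat (𝕜 := ℝ)).const_mul (r / 2)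
          simpa [div_eq_mul_inv] using this
        have h3 := (Complex.continuous_ofReal.tendsto 0).comp h2
        simpa [hu] using tendsto_const_nhds (x := z).add h3
      · refine Eventually.of_forall fun k => ?_
        simp only [hu, mem_compl_iff, mem_singleton_iff, add_eq_left, Complex.ofReal_eq_zero]
        exact (hu_pos k).ne'
    refine aestronglyMeasurable_of_tendsto_ae (u := atTop)
      (f := fun k x => slope (fun w => f w x) z (u k)) ?_ ?_
    · intro k
      simp only [slope, vsub_eq_sub]
      exact ((hm _ (huU k)).sub (hm _ hz)).const_smul ((u k - z)⁻¹ : ℂ)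
    · filter_upwards [hd] with x hx
      exact (hasDerivAt_iff_tendsto_slope.1
        (hx.differentiableAt (hU.mem_nhds hz)).hasDerivAt).comp hut
  refine (hasDerivAt_integral_of_dominated_loc_of_deriv_le (F := f)
    (F' := fun w x => deriv (fun w => f w x) w) (bound := fun x => g x / (r / 2))
    (Metric.ball_mem_nhds z hr2) ?_ ?_ hF' ?_ (hg.div_const _) ?_).2.differentiableAt.differentiableWithinAt
  · filter_upwards [hU.mem_nhds hz] with w hw using hm w hw
  · refine hg.mono' (hm z hz) ?_
    filter_upwards [hfg] with x hx using hx z (mem_of_mem_nhds ht)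
  · filter_upwards [hfg, hd] with x hx hdx w hw
    have hsub : Metric.closedBall w (r / 2) ⊆ Metric.ball z r := by
      intro y hy
      rw [Metric.mem_closedBall] at hy
      rw [Metric.mem_ball] at hw ⊢
      linarith [dist_triangle y w z]
    refine Complex.norm_deriv_le_of_forall_mem_sphere_norm_le hr2 ?_ ?_
    · refine DifferentiableOn.diffContOnCl ?_
      rw [closure_ball _ hr2.ne']
      exact hdx.mono fun y hy => (hrt (hsub hy)).2
    · intro y hy
      exact hx y (hrt (hsub (Metric.sphere_subset_closedBall hy))).1
  · filter_upwards [hd] with x hx w hw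
    have : w ∈ U := (hrt (Metric.ball_subset_ball (by linarith) hw)).2
    exact (hx.differentiableAt (hU.mem_nhds this)).hasDerivAt

/-! ### Raising the exponent -/

/-- The polynomial `∏_{j < K} (μ + 1 + j) (μ + h + j)`; for `h = n / 2` and a quadratic form in `n`
variables it is the product of the values at `μ, …, μ + K - 1` of the Bernstein–Sato polynomial. -/
def bern (h : ℂ) (K : ℕ) (μ : ℂ) : ℂ := ∏ j ∈ Finset.range K, (μ + 1 + j) * (μ + h + j)

theorem bern_succ (h : ℂ) (K : ℕ) (μ : ℂ) :
    bern h (K + 1) μ = (μ + 1) * (μ + h) * bern h K (μ + 1) := by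
  unfold bern
  rw [Finset.prod_range_succ', mul_comm]
  congr 1
  · simp
  · refine Finset.prod_congr rfl fun j _ => ?_
    push_cast
    ring

theorem differentiable_bern (h : ℂ) (K : ℕ) : Differentiable ℂ (bern h K) := by
  unfold bern
  fun_prop

/-- `K`-fold application of the functional equation
`(μ + 1) (μ + h) I(μ, φ) = ∑ₗ wₗ(μ) I(μ + 1, Oₗ φ)`, without the polynomial factor. -/
def raise {T Λ : Type*} [Fintype Λ] (I : ℂ → T → ℂ) (w : Λ → ℂ → ℂ) (O : Λ → T → T) :
    ℕ → ℂ → T → ℂ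
  | 0, μ, φ => I μ φ
  | K + 1, μ, φ => ∑ l, w l μ * raise I w O K (μ + 1) (O l φ)

section raise

variable {T Λ : Type*} [Fintype Λ] {I : ℂ → T → ℂ} {w : Λ → ℂ → ℂ} {O : Λ → T → T}

theorem raise_eq_bern_mul {h : ℂ}
    (hI : ∀ μ : ℂ, 1 < μ.re → ∀ φ, (μ + 1) * (μ + h) * I μ φ = ∑ l, w l μ * I (μ + 1) (O l φ))
    (K : ℕ) : ∀ μ : ℂ, 1 < μ.re → ∀ φ, raise I w O K μ φ = bern h K μ * I μ φ := by
  induction K with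
  | zero => intro μ _ φ; simp [raise, bern]
  | succ K ih =>
    intro μ hμ φ
    have h1 : 1 < (μ + 1).re := by simp; linarith
    simp only [raise, ih _ h1]
    rw [bern_succ, mul_comm ((μ + 1) * (μ + h)), mul_assoc, hI μ hμ φ, Finset.mul_sum]
    exact Finset.sum_congr rfl fun l _ => by ring

theorem differentiableOn_raise (hI : ∀ φ, DifferentiableOn ℂ (fun μ => I μ φ) {μ | 0 < μ.re})
    (hw : ∀ l, Differentiable ℂ (w l)) (K : ℕ) :
    ∀ φ, DifferentiableOn ℂ (fun μ => raise I w O K μ φ) {μ | -(K : ℝ) < μ.re} := by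
  induction K with
  | zero => intro φ; simpa [raise] using hI φ
  | succ K ih =>
    intro φ
    simp only [raise]
    refine DifferentiableOn.fun_sum fun l _ => (hw l).differentiableOn.mul ?_
    refine (ih (O l φ)).comp (differentiableOn_id.add_const 1) ?_
    intro μ hμ
    simp only [mem_ofPred_eq, Nat.cast_add, Nat.cast_one, Complex.add_re, Complex.one_re] at hμ ⊢
    linarith

end raise

end

section

/-! ### Test functions and integration by parts -/

/-- Complex-valued test functions on `ℝ^ι`. -/
abbrev Tst (ι : Type*) [Fintype ι] : Type _ :=
  𝓓((⊤ : TopologicalSpace.Opens (EuclideanSpace ℝ ι)), ℂ)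

variable {ι : Type*} [Fintype ι]

/-- The test function `g φ` for a smooth function `g`. -/
def mulTst (g : EuclideanSpace ℝ ι → ℂ) (hg : ContDiff ℝ ∞ g) (φ : Tst ι) : Tst ι where
  toFun x := g x * φ x
  contDiff' := hg.mul φ.contDiff
  hasCompactSupport' := φ.hasCompactSupport.mul_left
  tsupport_subset' := fun _ _ => trivial

@[simp]
theorem mulTst_apply (g : EuclideanSpace ℝ ι → ℂ) (hg : ContDiff ℝ ∞ g) (φ : Tst ι)
    (x : EuclideanSpace ℝ ι) : mulTst g hg φ x = g x * φ x := rfl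

theorem integrable_mul_tst {f : EuclideanSpace ℝ ι → ℂ} (hf : Continuous f) (φ : Tst ι) :
    Integrable (fun x => f x * φ x) :=
  (hf.mul φ.continuous).integrable_of_hasCompactSupport φ.hasCompactSupport.mul_left

/-! ### Integrals of complex powers against test functions -/

/-- `∫ q ^ μ φ`. -/
def powInt (q : EuclideanSpace ℝ ι → ℂ) (μ : ℂ) (φ : Tst ι) : ℂ := ∫ x, q x ^ μ * φ x

theorem continuous_cpow_comp {E : Type*} [TopologicalSpace E] {q : E → ℂ} (hq : Continuous q)
    (hre : ∀ x, 0 ≤ (q x).re) {μ : ℂ} (hμ : 0 < μ.re) : Continuous fun x => q x ^ μ := by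
  rw [continuous_iff_continuousAt]
  intro x
  exact ContinuousAt.comp (f := q) (g := fun w : ℂ => w ^ μ)
    (Complex.continuousAt_cpow_const_of_re_pos (Or.inl (hre x)) hμ) hq.continuousAt

theorem hasFDerivAt_cpow_comp {q : EuclideanSpace ℝ ι → ℂ} (hq : ContDiff ℝ ∞ q)
    (hre : ∀ x, 0 ≤ (q x).re) {μ : ℂ} (hμ : 0 < μ.re) (x : EuclideanSpace ℝ ι) :
    HasFDerivAt (fun x => q x ^ (μ + 1)) (((μ + 1) * q x ^ μ) • fderiv ℝ q x) x :=
  (hasDerivAt_cpow_add_one (hre x) hμ).comp_hasFDerivAt x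
    (hq.differentiable (by simp) x).hasFDerivAt

theorem differentiableOn_powInt {q : EuclideanSpace ℝ ι → ℂ} (hq : Continuous q)
    (hre : ∀ x, 0 ≤ (q x).re) (φ : Tst ι) :
    DifferentiableOn ℂ (fun μ => powInt q μ φ) {μ | 0 < μ.re} := by
  unfold powInt
  refine differentiableOn_integral (isOpen_re_gt 0) ?_ ?_ ?_
  · intro μ hμ
    exact (integrable_mul_tst (continuous_cpow_comp hq hre hμ) φ).aestronglyMeasurable
  · refine Eventually.of_forall fun x => ?_
    intro μ hμ
    have : μ ≠ 0 := by rintro rfl; simp at hμ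
    exact ((differentiableAt_const_cpow_exponent (Or.inr this)).mul_const _).differentiableWithinAt
  · intro μ hμ
    have hμ : 0 < μ.re := hμ
    refine ⟨{z | 0 < z.re ∧ z.re < μ.re + 1 ∧ |z.im| < |μ.im| + 1}, ?_,
      fun x => (1 + ‖q x‖) ^ (μ.re + 1) * Real.exp (Real.pi * (|μ.im| + 1)) * ‖φ x‖, ?_, ?_⟩
    · refine IsOpen.mem_nhds ?_ ⟨hμ, by linarith, by linarith⟩
      exact (isOpen_lt continuous_const Complex.continuous_re).inter
        ((isOpen_lt Complex.continuous_re continuous_const).inter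
          (isOpen_lt Complex.continuous_im.abs continuous_const))
    · refine Continuous.integrable_of_hasCompactSupport ?_ φ.hasCompactSupport.norm.mul_left
      have : Continuous fun x => (1 + ‖q x‖) ^ (μ.re + 1) :=
        (continuous_const.add hq.norm).rpow_const fun x => Or.inr (by linarith)
      exact (this.mul continuous_const).mul φ.continuous.norm
    · refine Eventually.of_forall fun x z hz => ?_
      obtain ⟨h0, h1, h2⟩ := hz
      rw [norm_mul]
      beta_reduce
      gcongr
      refine (norm_cpow_le_mul_exp _ _).trans ?_
      gcongr
      calc ‖q x‖ ^ z.re ≤ (1 + ‖q x‖) ^ z.re :=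
            Real.rpow_le_rpow (norm_nonneg _) (by linarith) h0.le
        _ ≤ (1 + ‖q x‖) ^ (μ.re + 1) :=
            Real.rpow_le_rpow_of_exponent_le (by linarith [norm_nonneg (q x)]) h1.le

theorem continuousOn_powInt {Θ : Type*} [TopologicalSpace Θ]
    {q : Θ → EuclideanSpace ℝ ι → ℂ} {S : Set (Θ × ℂ)} (hq : Continuous (Function.uncurry q))
    (hS : ∀ p ∈ S, (∀ x, 0 ≤ (q p.1 x).re) ∧ 0 < p.2.re) (φ : Tst ι) :
    ContinuousOn (fun p : Θ × ℂ => powInt (q p.1) p.2 φ) S := by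
  unfold powInt
  refine continuousOn_integral_of_compact_support (k := tsupport φ) φ.hasCompactSupport ?_ ?_
  · have h1 : ContinuousOn (fun y : (Θ × ℂ) × EuclideanSpace ℝ ι => q y.1.1 y.2 ^ y.1.2)
        (S ×ˢ univ) := by
      refine ContinuousOn.comp (g := fun p : ℂ × ℂ => p.1 ^ p.2)
        (f := fun y : (Θ × ℂ) × EuclideanSpace ℝ ι => (q y.1.1 y.2, y.1.2))
        continuousOn_cpow_of_re ?_ ?_
      · refine Continuous.continuousOn ?_
        have : Continuous fun y : (Θ × ℂ) × EuclideanSpace ℝ ι => q y.1.1 y.2 :=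
          hq.comp ((continuous_fst.comp continuous_fst).prodMk continuous_snd)
        exact this.prodMk (continuous_snd.comp continuous_fst)
      · rintro ⟨p, x⟩ ⟨hp, -⟩
        exact ⟨(hS p hp).1 x, (hS p hp).2⟩
    exact h1.mul (φ.continuous.comp continuous_snd).continuousOn
  · intro p x _ hx
    rw [image_eq_zero_of_notMem_tsupport hx, mul_zero]

/-! ### Complex quadratic forms -/

/-- The complex quadratic form `xᵀ B x` of a real vector. -/
def qform (B : Matrix ι ι ℂ) (x : EuclideanSpace ℝ ι) : ℂ := ∑ i, ∑ j, B i j * (x i : ℂ) * (x j : ℂ)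

theorem contDiff_coord (i : ι) : ContDiff ℝ ∞ fun x : EuclideanSpace ℝ ι => (x i : ℂ) :=
  Complex.ofRealCLM.contDiff.comp (EuclideanSpace.proj i : EuclideanSpace ℝ ι →L[ℝ] ℝ).contDiff

theorem contDiff_qform (B : Matrix ι ι ℂ) : ContDiff ℝ ∞ (qform B) := by
  unfold qform
  exact ContDiff.sum fun i _ => ContDiff.sum fun j _ =>
    (contDiff_const.mul (contDiff_coord i)).mul (contDiff_coord j)

/-! ### Partial derivatives -/

variable [DecidableEq ι]

/-- The partial derivative of a function on `ℝ^ι`. -/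
def pderiv (i : ι) (f : EuclideanSpace ℝ ι → ℂ) (x : EuclideanSpace ℝ ι) : ℂ :=
  fderiv ℝ f x (EuclideanSpace.single i 1)

/-- The partial derivative as a continuous linear operator on test functions. -/
def pdT (i : ι) : Tst ι →L[ℂ] Tst ι := TestFunction.lineDerivCLM ℂ (EuclideanSpace.single i 1)

theorem pdT_apply (i : ι) (φ : Tst ι) (x : EuclideanSpace ℝ ι) : pdT i φ x = pderiv i φ x := by
  unfold pdT pderiv
  rw [TestFunction.lineDerivCLM_apply_of_le (by simp)]
  exact (φ.contDiff.differentiable (by simp)).differentiableAt.lineDeriv_eq_fderiv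

theorem contDiff_pderiv {f : EuclideanSpace ℝ ι → ℂ} (hf : ContDiff ℝ ∞ f) (i : ι) :
    ContDiff ℝ ∞ (pderiv i f) := by
  unfold pderiv
  exact (hf.fderiv_right (by simp)).clm_apply contDiff_const

theorem integral_mul_pdT {f : EuclideanSpace ℝ ι → ℂ} (hf : Differentiable ℝ f) (i : ι)
    (hc : Continuous (pderiv i f)) (φ : Tst ι) :
    ∫ x, f x * pdT i φ x = -∫ x, pderiv i f x * φ x := by
  simp only [pdT_apply]
  refine integral_mul_fderiv_eq_neg_fderiv_mul_of_integrable ?_ ?_ ?_ (fun x _ => hf x)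
    (fun x _ => (φ.contDiff.differentiable (by simp)) x)
  · exact integrable_mul_tst hc φ
  · have := integrable_mul_tst hf.continuous (pdT i φ)
    simpa only [pdT_apply, pderiv] using this
  · exact integrable_mul_tst hf.continuous φ

theorem powInt_add_one_pdT {q : EuclideanSpace ℝ ι → ℂ} (hq : ContDiff ℝ ∞ q)
    (hre : ∀ x, 0 ≤ (q x).re) {μ : ℂ} (hμ : 0 < μ.re) (i : ι) (φ : Tst ι) :
    powInt q (μ + 1) (pdT i φ) =
      -(μ + 1) * powInt q μ (mulTst (pderiv i q) (contDiff_pderiv hq i) φ) := by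
  have hpd : pderiv i (fun x => q x ^ (μ + 1)) = fun x => (μ + 1) * q x ^ μ * pderiv i q x := by
    funext x
    rw [pderiv, (hasFDerivAt_cpow_comp hq hre hμ x).fderiv]
    rfl
  have hc := continuous_cpow_comp hq.continuous hre hμ
  unfold powInt
  rw [integral_mul_pdT (fun x => (hasFDerivAt_cpow_comp hq hre hμ x).differentiableAt), hpd,
    ← integral_const_mul, ← integral_neg]
  · refine integral_congr_ae (Eventually.of_forall fun x => ?_)
    simp only [mulTst_apply]
    ring
  · rw [hpd]
    exact (continuous_const.mul hc).mul (contDiff_pderiv hq i).continuous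

theorem pderiv_mul {f g : EuclideanSpace ℝ ι → ℂ} {x : EuclideanSpace ℝ ι}
    (hf : DifferentiableAt ℝ f x) (hg : DifferentiableAt ℝ g x) (i : ι) :
    pderiv i (fun x => f x * g x) x = pderiv i f x * g x + f x * pderiv i g x := by
  unfold pderiv
  rw [fderiv_fun_mul hf hg]
  simp
  ring

theorem powInt_add_one_pdT_pdT {q : EuclideanSpace ℝ ι → ℂ} (hq : ContDiff ℝ ∞ q)
    (hre : ∀ x, 0 ≤ (q x).re) {μ : ℂ} (hμ : 1 < μ.re) (i j : ι) (φ : Tst ι) :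
    powInt q (μ + 1) (pdT i (pdT j φ)) =
      (μ + 1) * ∫ x, (μ * q x ^ (μ - 1) * (pderiv i q x * pderiv j q x)
        + q x ^ μ * pderiv j (pderiv i q) x) * φ x := by
  have hi := contDiff_pderiv hq i
  have hμ1 : 0 < (μ - 1).re := by simp; linarith
  have hμ0 : 0 < μ.re := by linarith
  rw [powInt_add_one_pdT hq hre hμ0]
  set φ₁ : Tst ι := mulTst (pderiv i q) hi φ
  set φ₂ : Tst ι := mulTst (pderiv j (pderiv i q)) (contDiff_pderiv hi j) φ
  have h1 : powInt q μ (mulTst (pderiv i q) hi (pdT j φ)) = powInt q μ (pdT j φ₁) - powInt q μ φ₂ := by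
    unfold powInt
    rw [← integral_sub (integrable_mul_tst (continuous_cpow_comp hq.continuous hre hμ0) _)
      (integrable_mul_tst (continuous_cpow_comp hq.continuous hre hμ0) _)]
    refine integral_congr_ae (Eventually.of_forall fun x => ?_)
    simp only [mulTst_apply, pdT_apply, φ₁, φ₂]
    have := pderiv_mul (hi.differentiable (by simp) x) (φ.contDiff.differentiable (by simp) x) j
    have h2 : pderiv j (mulTst (pderiv i q) hi φ) x = _ := this
    rw [h2]
    ring
  have h3 := powInt_add_one_pdT hq hre hμ1 j φ₁
  rw [sub_add_cancel] at h3
  rw [h1, h3]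
  unfold powInt
  have e1 : -(μ + 1) * (-μ * (∫ x, q x ^ (μ - 1) *
      (mulTst (pderiv j q) (contDiff_pderiv hq j) φ₁) x) - ∫ x, q x ^ μ * φ₂ x) =
        (μ + 1) * (μ * (∫ x, q x ^ (μ - 1) *
      (mulTst (pderiv j q) (contDiff_pderiv hq j) φ₁) x) + ∫ x, q x ^ μ * φ₂ x) := by ring
  rw [e1, ← integral_const_mul, ← integral_add]
  · congr 1
    refine integral_congr_ae (Eventually.of_forall fun x => ?_)
    simp only [mulTst_apply, φ₁, φ₂]
    ring
  · exact (integrable_mul_tst (continuous_cpow_comp hq.continuous hre hμ1) _).const_mul _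
  · exact integrable_mul_tst (continuous_cpow_comp hq.continuous hre hμ0) _

/-! ### Functional equation of the powers of a quadratic form -/

theorem pderiv_coord (i j : ι) (x : EuclideanSpace ℝ ι) :
    pderiv i (fun x : EuclideanSpace ℝ ι => (x j : ℂ)) x = if i = j then 1 else 0 := by
  have : (fun x : EuclideanSpace ℝ ι => (x j : ℂ)) =
      (Complex.ofRealCLM.comp (EuclideanSpace.proj j : EuclideanSpace ℝ ι →L[ℝ] ℝ)) := rfl
  rw [pderiv, this, ContinuousLinearMap.fderiv]
  by_cases h : i = j
  · subst h; simp
  · simp [h, Ne.symm h]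

theorem pderiv_sum {κ : Type*} (s : Finset κ) {f : κ → EuclideanSpace ℝ ι → ℂ}
    {x : EuclideanSpace ℝ ι} (hf : ∀ k ∈ s, DifferentiableAt ℝ (f k) x) (i : ι) :
    pderiv i (fun x => ∑ k ∈ s, f k x) x = ∑ k ∈ s, pderiv i (f k) x := by
  unfold pderiv
  rw [fderiv_fun_sum hf]
  simp

theorem pderiv_const_mul {f : EuclideanSpace ℝ ι → ℂ} {x : EuclideanSpace ℝ ι}
    (hf : DifferentiableAt ℝ f x) (c : ℂ) (i : ι) :
    pderiv i (fun x => c * f x) x = c * pderiv i f x := by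
  unfold pderiv
  rw [fderiv_const_mul hf]
  simp

theorem pderiv_linear (a : ι → ℂ) (i : ι) (x : EuclideanSpace ℝ ι) :
    pderiv i (fun x : EuclideanSpace ℝ ι => ∑ j, a j * (x j : ℂ)) x = a i := by
  have hd : ∀ j, DifferentiableAt ℝ (fun x : EuclideanSpace ℝ ι => (x j : ℂ)) x := fun j =>
    (contDiff_coord j).differentiable (by simp) x
  rw [pderiv_sum _ fun j _ => (hd j).const_mul _]
  simp [pderiv_const_mul (hd _), pderiv_coord]

theorem pderiv_qform {B : Matrix ι ι ℂ} (hB : B.IsSymm) (i : ι) :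
    pderiv i (qform B) = fun x => ∑ j, 2 * B i j * (x j : ℂ) := by
  funext x
  have hd : ∀ j, DifferentiableAt ℝ (fun x : EuclideanSpace ℝ ι => (x j : ℂ)) x := fun j =>
    (contDiff_coord j).differentiable (by simp) x
  unfold qform
  have h0 := pderiv_sum Finset.univ (f := fun k x => ∑ j, B k j * (x k : ℂ) * (x j : ℂ)) (x := x)
    (fun k _ => DifferentiableAt.fun_sum fun j _ => ((hd k).const_mul _).fun_mul (hd j)) i
  rw [h0]
  have h1 : ∀ k, pderiv i (fun x : EuclideanSpace ℝ ι => ∑ j, B k j * (x k : ℂ) * (x j : ℂ)) x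
      = (if i = k then ∑ j, B k j * (x j : ℂ) else 0) + B k i * (x k : ℂ) := by
    intro k
    have h0 := pderiv_sum Finset.univ (f := fun j x => B k j * (x k : ℂ) * (x j : ℂ)) (x := x)
      (fun j _ => ((hd k).const_mul _).fun_mul (hd j)) i
    rw [h0]
    have h2 : ∀ j, pderiv i (fun x : EuclideanSpace ℝ ι => B k j * (x k : ℂ) * (x j : ℂ)) x
        = (if i = k then B k j * (x j : ℂ) else 0) + (if i = j then B k j * (x k : ℂ) else 0) := by
      intro j
      rw [pderiv_mul ((hd k).const_mul _) (hd j), pderiv_const_mul (hd k), pderiv_coord, pderiv_coord]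
      split_ifs <;> simp
    simp only [h2, Finset.sum_add_distrib]
    congr 1
    · split_ifs <;> simp
    · simp
  simp only [h1, Finset.sum_add_distrib]
  rw [Finset.sum_ite_eq Finset.univ i, if_pos (Finset.mem_univ _), ← Finset.sum_add_distrib]
  refine Finset.sum_congr rfl fun j _ => ?_
  rw [hB.apply i j]
  ring

/-- The functional equation of the powers of a nondegenerate quadratic form: with `β B = 1`, the
operator `∑ βᵢⱼ ∂ᵢ ∂ⱼ` maps `q ^ (μ + 1)` to `4 (μ + 1) (μ + n / 2) q ^ μ`. -/
theorem powInt_qform_functional_equation {B β : Matrix ι ι ℂ} (hB : B.IsSymm) (hβ : β * B = 1)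
    (hre : ∀ x, 0 ≤ (qform B x).re) {μ : ℂ} (hμ : 1 < μ.re) (φ : Tst ι) :
    (μ + 1) * (μ + (Fintype.card ι : ℂ) / 2) * powInt (qform B) μ φ =
      ∑ l : ι × ι, β l.1 l.2 / 4 * powInt (qform B) (μ + 1) (pdT l.1 (pdT l.2 φ)) := by
  have hq := contDiff_qform B
  have hμ1 : 0 < (μ - 1).re := by simp; linarith
  have hμ0 : 0 < μ.re := by linarith
  have hμne : μ ≠ 0 := by rintro rfl; simp at hμ0
  have hc1 := continuous_cpow_comp hq.continuous hre hμ1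
  have hc0 := continuous_cpow_comp hq.continuous hre hμ0
  simp only [powInt_add_one_pdT_pdT hq hre hμ]
  have hcont : ∀ i, Continuous (pderiv i (qform B)) := fun i => (contDiff_pderiv hq i).continuous
  have hcont2 : ∀ i j, Continuous (pderiv j (pderiv i (qform B))) := fun i j =>
    (contDiff_pderiv (contDiff_pderiv hq i) j).continuous
  have e1 : ∀ l : ι × ι, β l.1 l.2 / 4 * ((μ + 1) * ∫ x, (μ * qform B x ^ (μ - 1) *
      (pderiv l.1 (qform B) x * pderiv l.2 (qform B) x) +
      qform B x ^ μ * pderiv l.2 (pderiv l.1 (qform B)) x) * φ x) =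
      ∫ x, (μ + 1) * (β l.1 l.2 / 4 * ((μ * qform B x ^ (μ - 1) *
      (pderiv l.1 (qform B) x * pderiv l.2 (qform B) x) +
      qform B x ^ μ * pderiv l.2 (pderiv l.1 (qform B)) x)) * φ x) := by
    intro l
    rw [integral_const_mul]
    simp_rw [mul_assoc (β l.1 l.2 / 4)]
    rw [integral_const_mul]
    ring
  simp only [e1]
  rw [← integral_finsetSum]
  · unfold powInt
    rw [← integral_const_mul]
    refine integral_congr_ae (Eventually.of_forall fun x => ?_)
    simp only
    have h2 : ∀ i j, pderiv j (pderiv i (qform B)) x = 2 * B i j := by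
      intro i j
      rw [pderiv_qform hB, pderiv_linear]
    have h3 : ∑ l : ι × ι, β l.1 l.2 * (pderiv l.1 (qform B) x * pderiv l.2 (qform B) x) =
        4 * qform B x := by
      rw [Fintype.sum_prod_type]
      simp only [pderiv_qform hB]
      have h4 : ∀ i, ∑ j, β i j * ((∑ k, 2 * B i k * (x k : ℂ)) * ∑ k, 2 * B j k * (x k : ℂ)) =
          (∑ k, 2 * B i k * (x k : ℂ)) * (2 * (x i : ℂ)) := by
        intro i
        have h5 : ∑ j, β i j * ∑ k, 2 * B j k * (x k : ℂ) = 2 * (x i : ℂ) := by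
          simp only [Finset.mul_sum]
          rw [Finset.sum_comm]
          have h6 : ∀ k, ∑ j, β i j * (2 * B j k * (x k : ℂ)) = 2 * (x k : ℂ) * (β * B) i k := by
            intro k
            rw [Matrix.mul_apply, Finset.mul_sum]
            exact Finset.sum_congr rfl fun j _ => by ring
          simp only [h6, hβ, Matrix.one_apply]
          simp
        rw [← h5, Finset.mul_sum]
        exact Finset.sum_congr rfl fun j _ => by ring
      simp only [h4]
      rw [qform, Finset.mul_sum]
      refine Finset.sum_congr rfl fun i _ => ?_
      rw [Finset.sum_mul, Finset.mul_sum]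
      exact Finset.sum_congr rfl fun j _ => by ring
    have h7 : ∑ l : ι × ι, β l.1 l.2 * (2 * B l.1 l.2) = 2 * (Fintype.card ι : ℂ) := by
      rw [Fintype.sum_prod_type]
      have h8 : ∀ i, ∑ j, β i j * (2 * B i j) = 2 * (β * B) i i := by
        intro i
        rw [Matrix.mul_apply, Finset.mul_sum]
        refine Finset.sum_congr rfl fun j _ => ?_
        rw [hB.apply i j]
        ring
      simp only [h8, hβ, Matrix.one_apply_eq, ← Finset.mul_sum]
      simp
    have h9 : qform B x ^ (μ - 1) * qform B x = qform B x ^ μ := by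
      by_cases h0 : qform B x = 0
      · rw [h0, Complex.zero_cpow hμne, mul_zero]
      · conv_rhs => rw [← sub_add_cancel μ 1, Complex.cpow_add _ _ h0, Complex.cpow_one]
    have h10 : ∑ l : ι × ι, (μ + 1) * (β l.1 l.2 / 4 * (μ * qform B x ^ (μ - 1) *
        (pderiv l.1 (qform B) x * pderiv l.2 (qform B) x) +
        qform B x ^ μ * pderiv l.2 (pderiv l.1 (qform B)) x) * φ x) =
        (μ + 1) / 4 * φ x * (μ * qform B x ^ (μ - 1) *
          (∑ l : ι × ι, β l.1 l.2 * (pderiv l.1 (qform B) x * pderiv l.2 (qform B) x)) +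
          qform B x ^ μ * ∑ l : ι × ι, β l.1 l.2 * (2 * B l.1 l.2)) := by
      rw [Finset.mul_sum, Finset.mul_sum, ← Finset.sum_add_distrib, Finset.mul_sum]
      refine Finset.sum_congr rfl fun l _ => ?_
      rw [h2]
      ring
    rw [h10, h3, h7, ← h9]
    ring
  · intro l _
    refine (integrable_mul_tst ?_ φ).const_mul _
    exact continuous_const.mul (((continuous_const.mul hc1).mul ((hcont _).mul (hcont _))).add
      (hc0.mul (hcont2 _ _)))

end

section

/-! ### The circle around the exponent `-m` -/

theorem add_intCast_ne_zero_of_norm {m : ℕ} {μ : ℂ} (hμ : ‖μ + m‖ = 1 / 2) (a : ℤ) :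
    μ + (a : ℂ) ≠ 0 := by
  intro h
  have h1 : μ + m = (((m : ℤ) - a : ℤ) : ℂ) := by
    push_cast
    rw [← add_right_cancel_iff (a := (a : ℂ))]
    linear_combination h
  rw [h1, Complex.norm_intCast] at hμ
  have h2 : (2 * |(m : ℤ) - a| : ℤ) = 1 := by
    have : (2 : ℝ) * |(((m : ℤ) - a : ℤ) : ℝ)| = 1 := by rw [hμ]; norm_num
    exact_mod_cast this
  omega

theorem bern_ne_zero_of_norm {m : ℕ} {μ : ℂ} (hμ : ‖μ + m‖ = 1 / 2) (K : ℕ) :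
    bern (m + 1) K μ ≠ 0 := by
  unfold bern
  rw [Finset.prod_ne_zero_iff]
  intro j _
  refine mul_ne_zero ?_ ?_
  · have := add_intCast_ne_zero_of_norm hμ (1 + j)
    push_cast at this
    rwa [add_assoc]
  · have := add_intCast_ne_zero_of_norm hμ (m + 1 + j)
    push_cast at this
    rwa [add_assoc]

theorem bern_ne_zero_of_re {m : ℕ} {μ : ℂ} (hμ : -1 < μ.re) (K : ℕ) :
    bern (m + 1) K μ ≠ 0 := by
  unfold bern
  rw [Finset.prod_ne_zero_iff]
  intro j _
  have hj : (0 : ℝ) ≤ j := j.cast_nonneg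
  have hm : (0 : ℝ) ≤ m := m.cast_nonneg
  refine mul_ne_zero ?_ ?_ <;>
  · intro h
    have := congrArg Complex.re h
    simp at this
    linarith

theorem norm_circleMap_add (m : ℕ) (θ : ℝ) : ‖circleMap (-(m : ℂ)) (1 / 2) θ + m‖ = 1 / 2 := by
  simp [circleMap]

theorem re_gt_of_norm {m : ℕ} {μ : ℂ} (hμ : ‖μ + m‖ ≤ 1 / 2) : -(m : ℝ) - 1 < μ.re := by
  have h1 := (Complex.abs_re_le_norm (μ + m)).trans hμ
  rw [abs_le] at h1
  simp at h1
  linarith [h1.1]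

theorem re_circleMap_add_pos (m : ℕ) (θ : ℝ) :
    0 < (circleMap (-(m : ℂ)) (1 / 2) θ + ((m + 1 : ℕ) : ℂ)).re := by
  have := re_gt_of_norm (norm_circleMap_add m θ).le
  simp only [Complex.add_re, Complex.natCast_re]
  push_cast
  linarith

/-- Mean value property on the circle of radius `1 / 2` around `-m`. -/
theorem circleAverage_eq_of_differentiableOn {m : ℕ} {f : ℂ → ℂ}
    (hf : DifferentiableOn ℂ f {μ | -(m : ℝ) - 1 < μ.re}) :
    Real.circleAverage f (-(m : ℂ)) (1 / 2) = f (-(m : ℂ)) := by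
  refine DiffContOnCl.circleAverage ?_
  refine DifferentiableOn.diffContOnCl (hf.mono ?_)
  intro z hz
  have h1 : z ∈ Metric.closedBall (-(m : ℂ)) |1 / 2| := Metric.closure_ball_subset_closedBall hz
  rw [Metric.mem_closedBall, dist_eq_norm, abs_of_pos (by norm_num), sub_neg_eq_add] at h1
  exact re_gt_of_norm h1

theorem circleAverage_congr_norm {m : ℕ} {f g : ℂ → ℂ} (h : ∀ μ : ℂ, ‖μ + m‖ = 1 / 2 → f μ = g μ) :
    Real.circleAverage f (-(m : ℂ)) (1 / 2) = Real.circleAverage g (-(m : ℂ)) (1 / 2) := by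
  refine Real.circleAverage_congr_sphere fun z hz => h z ?_
  rw [mem_sphere_iff_norm, abs_of_pos (by norm_num), sub_neg_eq_add] at hz
  exact hz

/-- Fubini's theorem for circle averages of compactly supported continuous functions. -/
theorem circleAverage_integral {E : Type*} [TopologicalSpace E] [MeasurableSpace E]
    [OpensMeasurableSpace E] [SecondCountableTopology E] [T2Space E]
    {ν : Measure E} [IsFiniteMeasureOnCompacts ν] [SFinite ν]
    {c : ℂ} {R : ℝ} {f : ℂ → E → ℂ} {k : Set E} (hk : IsCompact k)
    (hf : Continuous fun p : ℝ × E => f (circleMap c R p.1) p.2)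
    (h0 : ∀ μ, ∀ x ∉ k, f μ x = 0) :
    Real.circleAverage (fun μ => ∫ x, f μ x ∂ν) c R = ∫ x, Real.circleAverage (fun μ => f μ x) c R ∂ν := by
  simp only [Real.circleAverage_def]
  rw [integral_smul]
  congr 1
  simp only [intervalIntegral.integral_of_le Real.two_pi_pos.le]
  refine integral_integral_swap ?_
  have h1 : IntegrableOn (fun p : ℝ × E => f (circleMap c R p.1) p.2) (Icc 0 (2 * Real.pi) ×ˢ k)
      ((volume : Measure ℝ).prod ν) :=
    hf.continuousOn.integrableOn_compact (isCompact_Icc.prod hk)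
  have h2 : IntegrableOn (fun p : ℝ × E => f (circleMap c R p.1) p.2) (Ioc 0 (2 * Real.pi) ×ˢ univ)
      ((volume : Measure ℝ).prod ν) := by
    refine (h1.mono_set (prod_mono Ioc_subset_Icc_self subset_rfl)).of_forall_sdiff_eq_zero
      (measurableSet_Ioc.prod MeasurableSet.univ) ?_
    rintro ⟨t, x⟩ ⟨⟨ht, -⟩, hx⟩
    refine h0 _ x fun hxk => hx ⟨ht, hxk⟩
  rw [IntegrableOn, ← Measure.prod_restrict, Measure.restrict_univ] at h2
  exact h2

/-! ### The continued powers of a quadratic form -/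

variable {ι : Type*} [Fintype ι] [DecidableEq ι]

/-- The functional equation of `powInt (qform B)` applied `K` times; it is holomorphic on
`Re μ > -K` and, if `β` is the inverse of the symmetric matrix `B`, equals
`bern (n / 2) K μ * ∫ q ^ μ φ` for large `Re μ`. The matrix `β` is a separate argument since
`formInt` is then polynomial in `β` and its dependence on `B` does not involve the inverse. -/
def formInt (B β : Matrix ι ι ℂ) (K : ℕ) (μ : ℂ) (φ : Tst ι) : ℂ :=
  raise (powInt (qform B)) (fun (l : ι × ι) _ => β l.1 l.2 / 4) (fun l φ => pdT l.1 (pdT l.2 φ)) K μ φ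

/-- The operator `¼ ∑ βᵢⱼ ∂ᵢ ∂ⱼ` on test functions. -/
def boxT (β : Matrix ι ι ℂ) : Tst ι →ₗ[ℂ] Tst ι :=
  ∑ l : ι × ι, (β l.1 l.2 / 4) • ((pdT l.1 : Tst ι →ₗ[ℂ] Tst ι) ∘ₗ (pdT l.2 : Tst ι →ₗ[ℂ] Tst ι))

/-- For `β = B⁻¹` and `n = 2 (m + 1)` variables, the value at `μ = -m` of the analytic continuation
of `∫ q ^ μ φ`, as the mean over a circle which avoids the zeros of the polynomial `bern`. -/
def regVal (B β : Matrix ι ι ℂ) (m : ℕ) (φ : Tst ι) : ℂ :=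
  Real.circleAverage (fun μ => formInt B β (m + 1) μ φ / bern (m + 1) (m + 1) μ) (-(m : ℂ)) (1 / 2)

theorem boxT_apply (β : Matrix ι ι ℂ) (φ : Tst ι) :
    boxT β φ = ∑ l : ι × ι, (β l.1 l.2 / 4) • pdT l.1 (pdT l.2 φ) := by
  simp [boxT]

omit [DecidableEq ι] in
theorem tst_sum_apply {κ : Type*} (s : Finset κ) (f : κ → Tst ι) (x : EuclideanSpace ℝ ι) :
    (∑ k ∈ s, f k) x = ∑ k ∈ s, f k x := by
  classical
  induction s using Finset.induction_on with
  | empty => simp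
  | insert a s ha ih => simp [Finset.sum_insert ha, ih]

theorem formInt_eq_integral {B : Matrix ι ι ℂ} (β : Matrix ι ι ℂ)
    (hre : ∀ x, 0 ≤ (qform B x).re) (K : ℕ) : ∀ (μ : ℂ) (φ : Tst ι), -(K : ℝ) < μ.re →
    formInt B β K μ φ = powInt (qform B) (μ + K) ((boxT β)^[K] φ) := by
  induction K with
  | zero => intro μ φ _; simp [formInt, raise]
  | succ K ih =>
    intro μ φ hμ
    push_cast at hμ
    have h1 : -(K : ℝ) < (μ + 1).re := by simp; linarith
    have h2 : 0 < (μ + ((K + 1 : ℕ) : ℂ)).re := by simp; linarith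
    have e : formInt B β (K + 1) μ φ =
        ∑ l : ι × ι, β l.1 l.2 / 4 * formInt B β K (μ + 1) (pdT l.1 (pdT l.2 φ)) := rfl
    rw [e]
    simp only [ih _ _ h1]
    have hpow : (boxT β)^[K + 1] φ = ((boxT β) ^ K) (boxT β φ) := by
      rw [Function.iterate_succ_apply, Module.End.pow_apply]
    have hpow' : ∀ ψ, (boxT β)^[K] ψ = ((boxT β) ^ K) ψ := fun ψ => by
      rw [Module.End.pow_apply]
    simp only [hpow, hpow']
    rw [boxT_apply, map_sum]
    simp only [map_smul]
    unfold powInt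
    have h3 : μ + 1 + (K : ℂ) = μ + ((K + 1 : ℕ) : ℂ) := by push_cast; ring
    simp only [h3, tst_sum_apply, Finset.mul_sum]
    rw [integral_finsetSum]
    · refine Finset.sum_congr rfl fun l _ => ?_
      rw [← integral_const_mul]
      refine integral_congr_ae (Eventually.of_forall fun x => ?_)
      simp
      ring
    · intro l _
      exact integrable_mul_tst (continuous_cpow_comp (contDiff_qform B).continuous hre h2) _

theorem differentiableOn_formInt {B : Matrix ι ι ℂ} (β : Matrix ι ι ℂ)
    (hre : ∀ x, 0 ≤ (qform B x).re) (K : ℕ) (φ : Tst ι) :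
    DifferentiableOn ℂ (fun μ => formInt B β K μ φ) {μ | -(K : ℝ) < μ.re} :=
  differentiableOn_raise (fun φ => differentiableOn_powInt (contDiff_qform B).continuous hre φ)
    (fun _ => differentiable_const _) K φ

theorem formInt_eq_bern_mul {B β : Matrix ι ι ℂ} (hB : B.IsSymm) (hβ : β * B = 1)
    (hre : ∀ x, 0 ≤ (qform B x).re) (K : ℕ) {μ : ℂ} (hμ : 0 < μ.re) (φ : Tst ι) :
    formInt B β K μ φ = bern ((Fintype.card ι : ℂ) / 2) K μ * powInt (qform B) μ φ := by
  refine eqOn_re_gt_of_eqOn (f := fun μ => formInt B β K μ φ)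
    (g := fun μ => bern ((Fintype.card ι : ℂ) / 2) K μ * powInt (qform B) μ φ)
    (a := 0) (b := 1) ?_ ?_ ?_ μ hμ
  · refine (differentiableOn_formInt β hre K φ).mono fun μ hμ => ?_
    have hμ : 0 < μ.re := hμ
    have : (0 : ℝ) ≤ K := K.cast_nonneg
    simp only [mem_ofPred_eq]
    linarith
  · exact (differentiable_bern _ _).differentiableOn.mul
      (differentiableOn_powInt (contDiff_qform B).continuous hre φ)
  · intro μ hμ
    exact raise_eq_bern_mul (fun μ hμ φ => powInt_qform_functional_equation hB hβ hre hμ φ) K μ hμ φ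

/-- Admissible triples `((B, β), μ)` for the `K`-th continuation. -/
def formDom (ι : Type*) [Fintype ι] (K : ℕ) : Set ((Matrix ι ι ℂ × Matrix ι ι ℂ) × ℂ) :=
  {p | (∀ x, 0 ≤ (qform p.1.1 x).re) ∧ -(K : ℝ) < p.2.re}

omit [DecidableEq ι] in
theorem continuous_qform_uncurry :
    Continuous fun p : Matrix ι ι ℂ × EuclideanSpace ℝ ι => qform p.1 p.2 := by
  unfold qform
  refine continuous_finsetSum _ fun i _ => continuous_finsetSum _ fun j _ => ?_
  have h1 : Continuous fun p : Matrix ι ι ℂ × EuclideanSpace ℝ ι => p.1 i j :=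
    continuous_fst.matrix_elem i j
  have h2 : ∀ i, Continuous fun p : Matrix ι ι ℂ × EuclideanSpace ℝ ι => (p.2 i : ℂ) := fun i =>
    (contDiff_coord i).continuous.comp continuous_snd
  exact (h1.mul (h2 i)).mul (h2 j)

theorem continuousOn_formInt (K : ℕ) : ∀ φ : Tst ι,
    ContinuousOn (fun p : (Matrix ι ι ℂ × Matrix ι ι ℂ) × ℂ => formInt p.1.1 p.1.2 K p.2 φ)
      (formDom ι K) := by
  induction K with
  | zero =>
    intro φ
    have e : ∀ p : (Matrix ι ι ℂ × Matrix ι ι ℂ) × ℂ,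
        formInt p.1.1 p.1.2 0 p.2 φ = powInt (qform p.1.1) p.2 φ := fun p => rfl
    simp only [e]
    have hc : Continuous (Function.uncurry fun (p : Matrix ι ι ℂ × Matrix ι ι ℂ)
        (x : EuclideanSpace ℝ ι) => qform p.1 x) := by
      rw [Function.uncurry_def]
      exact Continuous.comp (g := fun p : Matrix ι ι ℂ × EuclideanSpace ℝ ι => qform p.1 p.2)
        (f := fun y : (Matrix ι ι ℂ × Matrix ι ι ℂ) × EuclideanSpace ℝ ι => (y.1.1, y.2))
        continuous_qform_uncurry (by fun_prop)
    have hS : ∀ p ∈ formDom ι 0, (∀ x, 0 ≤ (qform p.1.1 x).re) ∧ 0 < p.2.re := by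
      intro p hp
      simpa [formDom] using hp
    have h := continuousOn_powInt (q := fun (p : Matrix ι ι ℂ × Matrix ι ι ℂ)
        (x : EuclideanSpace ℝ ι) => qform p.1 x) (S := formDom ι 0) hc hS φ
    exact h
  | succ K ih =>
    intro φ
    have e : ∀ p : (Matrix ι ι ℂ × Matrix ι ι ℂ) × ℂ, formInt p.1.1 p.1.2 (K + 1) p.2 φ =
        ∑ l : ι × ι, p.1.2 l.1 l.2 / 4 * formInt p.1.1 p.1.2 K (p.2 + 1) (pdT l.1 (pdT l.2 φ)) :=
      fun p => rfl
    simp only [e]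
    refine continuousOn_finsetSum _ fun l _ => ContinuousOn.mul ?_ ?_
    · exact (((continuous_snd.comp continuous_fst).matrix_elem l.1 l.2).div_const _).continuousOn
    · refine (ih (pdT l.1 (pdT l.2 φ))).comp (f := fun p : (Matrix ι ι ℂ × Matrix ι ι ℂ) × ℂ =>
        (p.1, p.2 + 1)) (by fun_prop) ?_
      rintro p ⟨h1, h2⟩
      refine ⟨h1, ?_⟩
      push_cast at h2
      simp only [Complex.add_re, Complex.one_re]
      linarith

theorem continuousOn_regVal (m : ℕ) (φ : Tst ι) :
    ContinuousOn (fun p : Matrix ι ι ℂ × Matrix ι ι ℂ => regVal p.1 p.2 m φ)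
      {p | ∀ x, 0 ≤ (qform p.1 x).re} := by
  rw [continuousOn_iff_continuous_domRestrict]
  unfold regVal
  simp only [Real.circleAverage_def, Set.domRestrict_def]
  refine (intervalIntegral.continuous_parametric_intervalIntegral_of_continuous' ?_ _ _).const_smul _
  refine Continuous.div ?_ ?_ ?_
  · refine (continuousOn_formInt (m + 1) φ).comp_continuous
      (f := fun y : {p : Matrix ι ι ℂ × Matrix ι ι ℂ | ∀ x, 0 ≤ (qform p.1 x).re} × ℝ =>
        ((y.1 : Matrix ι ι ℂ × Matrix ι ι ℂ), circleMap (-(m : ℂ)) (1 / 2) y.2)) (by fun_prop) ?_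
    rintro ⟨p, t⟩
    refine ⟨p.2, ?_⟩
    have := re_gt_of_norm (norm_circleMap_add m t).le
    push_cast
    linarith
  · exact (differentiable_bern _ _).continuous.comp ((continuous_circleMap _ _).comp continuous_snd)
  · rintro ⟨p, t⟩
    exact bern_ne_zero_of_norm (norm_circleMap_add m t) _

end

section

/-! ### Forms with positive definite real part -/

variable {ι : Type*} [Fintype ι]

theorem locallyIntegrable_norm_rpow [Nonempty ι] {s : ℝ} (hs : -(Fintype.card ι : ℝ) < s) :
    LocallyIntegrable fun x : EuclideanSpace ℝ ι => ‖x‖ ^ s := by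
  rw [locallyIntegrable_iff]
  intro k hk
  obtain ⟨r, hr, hkr⟩ := hk.isBounded.subset_ball_lt 0 0
  refine IntegrableOn.mono_set ?_ hkr
  rw [integrableOn_fun_norm_addHaar volume (f := fun y : ℝ => y ^ s), finrank_euclideanSpace]
  have h1 : IntegrableOn (fun y : ℝ => y ^ ((Fintype.card ι : ℝ) - 1 + s)) (Ioo 0 r) := by
    rw [intervalIntegral.integrableOn_Ioo_rpow_iff hr]
    linarith
  refine h1.congr_fun (fun y hy => ?_) measurableSet_Ioo
  have hn : 1 ≤ Fintype.card ι := Fintype.card_pos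
  simp only [smul_eq_mul]
  rw [Real.rpow_add hy.1, ← Real.rpow_natCast, Nat.cast_sub hn, Nat.cast_one]

theorem ae_ne_zero [Nonempty ι] : ∀ᵐ x : EuclideanSpace ℝ ι, x ≠ 0 :=
  compl_mem_ae_iff.2 (measure_singleton (0 : EuclideanSpace ℝ ι))

theorem norm_cpow_le_of_definite {q : EuclideanSpace ℝ ι → ℂ} {c : ℝ} (hc : 0 < c)
    (hqc : ∀ x, c * ‖x‖ ^ 2 ≤ (q x).re) {a b : ℝ} (ha : a ≤ 0) (hb : 0 ≤ b)
    {z : ℂ} (haz : a ≤ z.re) (hzb : z.re ≤ b) {x : EuclideanSpace ℝ ι} (hx : x ≠ 0) :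
    ‖q x ^ z‖ ≤ (c ^ a * ‖x‖ ^ (2 * a) + (1 + ‖q x‖) ^ b) * Real.exp (Real.pi * |z.im|) := by
  refine (norm_cpow_le_mul_exp _ _).trans ?_
  gcongr
  have hx' : 0 < ‖x‖ := norm_pos_iff.2 hx
  have h1 : 0 < c * ‖x‖ ^ 2 := by positivity
  have h2 : c * ‖x‖ ^ 2 ≤ ‖q x‖ := (hqc x).trans (Complex.re_le_norm _)
  have h3 : 0 < ‖q x‖ := h1.trans_le h2
  have h4 : 0 ≤ c ^ a * ‖x‖ ^ (2 * a) := by positivity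
  have h5 : 0 ≤ (1 + ‖q x‖) ^ b := by positivity
  rcases le_total ‖q x‖ 1 with h | h
  · calc ‖q x‖ ^ z.re ≤ ‖q x‖ ^ a := Real.rpow_le_rpow_of_exponent_ge h3 h haz
      _ ≤ (c * ‖x‖ ^ 2) ^ a := Real.rpow_le_rpow_of_nonpos h1 h2 ha
      _ = c ^ a * ‖x‖ ^ (2 * a) := by
          rw [Real.mul_rpow hc.le (by positivity), ← Real.rpow_natCast, ← Real.rpow_mul hx'.le]
          norm_num
      _ ≤ _ := by linarith
  · calc ‖q x‖ ^ z.re ≤ ‖q x‖ ^ b := Real.rpow_le_rpow_of_exponent_le h hzb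
      _ ≤ (1 + ‖q x‖) ^ b := Real.rpow_le_rpow h3.le (by linarith) hb
      _ ≤ _ := by linarith

theorem integrable_definite_bound [Nonempty ι] {q : EuclideanSpace ℝ ι → ℂ} (hq : Continuous q)
    {c a b E : ℝ} (ha : -(Fintype.card ι : ℝ) < 2 * a) (hb : 0 ≤ b) (φ : Tst ι) :
    Integrable fun x => (c ^ a * ‖x‖ ^ (2 * a) + (1 + ‖q x‖) ^ b) * E * ‖φ x‖ := by
  have h1 : LocallyIntegrable fun x : EuclideanSpace ℝ ι =>
      (c ^ a * ‖x‖ ^ (2 * a) + (1 + ‖q x‖) ^ b) := by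
    have h2 : Continuous fun x => (1 + ‖q x‖) ^ b :=
      (continuous_const.add hq.norm).rpow_const fun x => Or.inr hb
    exact ((locallyIntegrable_norm_rpow ha).smul (c ^ a)).add h2.locallyIntegrable
  have h3 := h1.integrable_smul_right_of_hasCompactSupport
    (φ.continuous.norm.const_mul E) φ.hasCompactSupport.norm.mul_left
  refine h3.congr (Eventually.of_forall fun x => ?_)
  simp only [smul_eq_mul]
  ring

theorem aestronglyMeasurable_cpow_mul {q : EuclideanSpace ℝ ι → ℂ} (hq : Continuous q) (μ : ℂ)
    (φ : Tst ι) : AEStronglyMeasurable (fun x => q x ^ μ * φ x) volume :=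
  ((hq.measurable.pow_const μ).mul φ.continuous.measurable).aestronglyMeasurable

theorem differentiableOn_powInt_of_definite [Nonempty ι] {q : EuclideanSpace ℝ ι → ℂ}
    (hq : Continuous q) {c : ℝ} (hc : 0 < c) (hqc : ∀ x, c * ‖x‖ ^ 2 ≤ (q x).re) (φ : Tst ι) :
    DifferentiableOn ℂ (fun μ => powInt q μ φ) {μ | -(Fintype.card ι : ℝ) / 2 < μ.re} := by
  unfold powInt
  refine differentiableOn_integral (isOpen_re_gt _) ?_ ?_ ?_
  · intro μ _
    exact aestronglyMeasurable_cpow_mul hq μ φ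
  · filter_upwards [ae_ne_zero] with x hx μ _
    have hqx : q x ≠ 0 := by
      intro h
      have h1 := hqc x
      rw [h, Complex.zero_re] at h1
      have : 0 < c * ‖x‖ ^ 2 := by have := norm_pos_iff.2 hx; positivity
      linarith
    exact ((differentiableAt_const_cpow_exponent (Or.inl hqx)).mul_const _).differentiableWithinAt
  · intro μ hμ
    have hμ : -(Fintype.card ι : ℝ) / 2 < μ.re := hμ
    have hn : (0 : ℝ) < Fintype.card ι := by exact_mod_cast Fintype.card_pos
    set a : ℝ := (-(Fintype.card ι : ℝ) / 2 + min μ.re 0) / 2 with ha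
    have hmin : -(Fintype.card ι : ℝ) / 2 < min μ.re 0 := lt_min hμ (by linarith)
    have ha1 : -(Fintype.card ι : ℝ) < 2 * a := by rw [ha]; linarith
    have ha2 : a < min μ.re 0 := by rw [ha]; linarith
    have ha3 : a < μ.re := ha2.trans_le (min_le_left _ _)
    have ha4 : a ≤ 0 := (ha2.trans_le (min_le_right _ _)).le
    have hb : 0 ≤ |μ.re| + 1 := by positivity
    refine ⟨{z | a < z.re ∧ z.re < |μ.re| + 1 ∧ |z.im| < |μ.im| + 1}, ?_,
      _, integrable_definite_bound hq ha1 hb (c := c) (E := Real.exp (Real.pi * (|μ.im| + 1))) φ, ?_⟩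
    · refine IsOpen.mem_nhds ?_ ⟨ha3, by linarith [le_abs_self μ.re], by linarith⟩
      exact (isOpen_lt continuous_const Complex.continuous_re).inter
        ((isOpen_lt Complex.continuous_re continuous_const).inter
          (isOpen_lt Complex.continuous_im.abs continuous_const))
    · filter_upwards [ae_ne_zero] with x hx z hz
      obtain ⟨h0, h1, h2⟩ := hz
      rw [norm_mul]
      refine mul_le_mul_of_nonneg_right ?_ (norm_nonneg _)
      refine (norm_cpow_le_of_definite hc hqc ha4 hb h0.le h1.le hx).trans ?_
      gcongr

theorem integrable_cpow_mul_of_definite [Nonempty ι] {q : EuclideanSpace ℝ ι → ℂ}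
    (hq : Continuous q) {c : ℝ} (hc : 0 < c) (hqc : ∀ x, c * ‖x‖ ^ 2 ≤ (q x).re) {μ : ℂ}
    (hμ0 : μ.re ≤ 0) (hμ : -(Fintype.card ι : ℝ) / 2 < μ.re) (φ : Tst ι) :
    Integrable fun x => q x ^ μ * φ x := by
  refine (integrable_definite_bound hq (c := c) (a := μ.re) (b := 0)
    (E := Real.exp (Real.pi * |μ.im|)) (by linarith) le_rfl φ).mono'
    (aestronglyMeasurable_cpow_mul hq μ φ) ?_
  filter_upwards [ae_ne_zero] with x hx
  rw [norm_mul]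
  exact mul_le_mul_of_nonneg_right
    (norm_cpow_le_of_definite hc hqc hμ0 le_rfl le_rfl hμ0 hx) (norm_nonneg _)

theorem re_nonneg_of_definite {q : EuclideanSpace ℝ ι → ℂ} {c : ℝ} (hc : 0 < c)
    (hqc : ∀ x, c * ‖x‖ ^ 2 ≤ (q x).re) (x : EuclideanSpace ℝ ι) : 0 ≤ (q x).re :=
  (by positivity : 0 ≤ c * ‖x‖ ^ 2).trans (hqc x)

theorem card_div_two {m : ℕ} (hn : Fintype.card ι = 2 * (m + 1)) :
    (Fintype.card ι : ℂ) / 2 = m + 1 := by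
  rw [hn]
  push_cast
  ring

theorem neg_card_div_two {m : ℕ} (hn : Fintype.card ι = 2 * (m + 1)) :
    -(Fintype.card ι : ℝ) / 2 = -(m : ℝ) - 1 := by
  rw [hn]
  push_cast
  ring

theorem nonempty_of_card {m : ℕ} (hn : Fintype.card ι = 2 * (m + 1)) : Nonempty ι :=
  Fintype.card_pos_iff.1 (by omega)

section definite

variable [DecidableEq ι] {m : ℕ} (hn : Fintype.card ι = 2 * (m + 1)) {B β : Matrix ι ι ℂ}
  (hB : B.IsSymm) (hβ : β * B = 1)

include hn hB hβ

theorem formInt_eq_of_definite {c : ℝ} (hc : 0 < c) (hqc : ∀ x, c * ‖x‖ ^ 2 ≤ (qform B x).re)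
    (φ : Tst ι) {μ : ℂ} (hμ : -(m : ℝ) - 1 < μ.re) :
    formInt B β (m + 1) μ φ = bern (m + 1) (m + 1) μ * powInt (qform B) μ φ := by
  have := nonempty_of_card hn
  have hre := re_nonneg_of_definite hc hqc
  refine eqOn_re_gt_of_eqOn (f := fun μ => formInt B β (m + 1) μ φ)
    (g := fun μ => bern (m + 1) (m + 1) μ * powInt (qform B) μ φ)
    (a := -(m : ℝ) - 1) (b := 0) ?_ ?_ ?_ μ hμ
  · refine (differentiableOn_formInt β hre (m + 1) φ).mono fun μ hμ => ?_
    have hμ : -(m : ℝ) - 1 < μ.re := hμ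
    simp only [mem_ofPred_eq]
    push_cast
    linarith
  · have h1 := differentiableOn_powInt_of_definite (contDiff_qform B).continuous hc hqc φ
    rw [neg_card_div_two hn] at h1
    exact (differentiable_bern _ _).differentiableOn.mul h1
  · intro μ hμ
    rw [formInt_eq_bern_mul hB hβ hre (m + 1) hμ, card_div_two hn]

theorem regVal_eq_of_definite {c : ℝ} (hc : 0 < c) (hqc : ∀ x, c * ‖x‖ ^ 2 ≤ (qform B x).re)
    (φ : Tst ι) : regVal B β m φ = powInt (qform B) (-(m : ℂ)) φ := by
  have := nonempty_of_card hn
  have h1 := differentiableOn_powInt_of_definite (contDiff_qform B).continuous hc hqc φ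
  rw [neg_card_div_two hn] at h1
  rw [← circleAverage_eq_of_differentiableOn h1]
  refine circleAverage_congr_norm fun μ hμ => ?_
  rw [formInt_eq_of_definite hn hB hβ hc hqc φ (re_gt_of_norm hμ.le),
    mul_div_cancel_left₀ _ (bern_ne_zero_of_norm hμ _)]

end definite

/-! ### Passage to forms with semidefinite real part -/

variable [DecidableEq ι]

theorem qform_add_smul_one (B : Matrix ι ι ℂ) (η : ℝ) (x : EuclideanSpace ℝ ι) :
    qform (B + (η : ℂ) • (1 : Matrix ι ι ℂ)) x = qform B x + η * (‖x‖ ^ 2 : ℝ) := by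
  unfold qform
  simp only [Matrix.add_apply, Matrix.smul_apply, Matrix.one_apply, smul_eq_mul, add_mul,
    Finset.sum_add_distrib]
  congr 1
  rw [EuclideanSpace.norm_sq_eq]
  push_cast
  rw [Finset.mul_sum]
  refine Finset.sum_congr rfl fun i _ => ?_
  simp only [mul_ite, mul_one, mul_zero, ite_mul, zero_mul, Finset.sum_ite_eq, Finset.mem_univ,
    if_true, ← Complex.ofReal_pow, Real.norm_eq_abs, sq_abs]
  push_cast
  ring

theorem continuousAt_matrix_inv {B : Matrix ι ι ℂ} (hB : IsUnit B.det) :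
    ContinuousAt (fun B : Matrix ι ι ℂ => B⁻¹) B := by
  simp only [Matrix.inv_def, Ring.inverse_eq_inv']
  have h1 : ContinuousAt (fun B : Matrix ι ι ℂ => B.det) B := continuous_id.matrix_det.continuousAt
  have h2 : ContinuousAt (fun B : Matrix ι ι ℂ => B.adjugate) B :=
    continuous_id.matrix_adjugate.continuousAt
  exact (h1.inv₀ hB.ne_zero).smul h2

omit [Fintype ι] in
theorem tendsto_add_smul_one_fst (B : Matrix ι ι ℂ) :
    Tendsto (fun η : ℝ => B + (η : ℂ) • (1 : Matrix ι ι ℂ)) (𝓝[>] 0) (𝓝 B) := by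
  have : Continuous fun η : ℝ => B + (η : ℂ) • (1 : Matrix ι ι ℂ) := by fun_prop
  have h2 := this.tendsto 0
  simp only [Complex.ofReal_zero, zero_smul, add_zero] at h2
  exact h2.mono_left nhdsWithin_le_nhds

/-- `B + η` tends to `B` together with its inverse. -/
theorem tendsto_add_smul_one {B : Matrix ι ι ℂ} (hB : IsUnit B.det) :
    Tendsto (fun η : ℝ => (B + (η : ℂ) • (1 : Matrix ι ι ℂ), (B + (η : ℂ) • (1 : Matrix ι ι ℂ))⁻¹))
      (𝓝[>] 0) (𝓝 (B, B⁻¹)) := by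
  have h1 := tendsto_add_smul_one_fst B
  exact h1.prodMk_nhds ((continuousAt_matrix_inv hB).tendsto.comp h1)

theorem eventually_det_ne_zero {B : Matrix ι ι ℂ} (hB : IsUnit B.det) {α : Type*} {l : Filter α}
    {f : α → Matrix ι ι ℂ} (hf : Tendsto f l (𝓝 B)) : ∀ᶠ a in l, IsUnit (f a).det := by
  have h1 : Tendsto (fun a => (f a).det) l (𝓝 B.det) :=
    (continuous_id.matrix_det.tendsto B).comp hf
  filter_upwards [h1.eventually_ne hB.ne_zero] with a ha using ha.isUnit

section semidefinite

variable {m : ℕ} (hn : Fintype.card ι = 2 * (m + 1)) {B : Matrix ι ι ℂ} (hB : B.IsSymm)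
  (hdet : IsUnit B.det) (hre : ∀ x, 0 ≤ (qform B x).re)

include hre in
theorem definite_add_smul_one {η : ℝ} (x : EuclideanSpace ℝ ι) :
    η * ‖x‖ ^ 2 ≤ (qform (B + (η : ℂ) • (1 : Matrix ι ι ℂ)) x).re := by
  rw [qform_add_smul_one, Complex.add_re, Complex.re_ofReal_mul, Complex.ofReal_re]
  linarith [hre x]

omit [Fintype ι] in
include hB in
theorem isSymm_add_smul_one (c : ℂ) : (B + c • (1 : Matrix ι ι ℂ)).IsSymm :=
  hB.add (Matrix.isSymm_one.smul c)

include hdet hre in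
theorem tendsto_formInt_add_smul_one {K : ℕ} {μ : ℂ} (hμ : -(K : ℝ) < μ.re) (φ : Tst ι) :
    Tendsto (fun η : ℝ => formInt (B + (η : ℂ) • (1 : Matrix ι ι ℂ))
      (B + (η : ℂ) • (1 : Matrix ι ι ℂ))⁻¹ K μ φ) (𝓝[>] 0) (𝓝 (formInt B B⁻¹ K μ φ)) := by
  have h1 := continuousOn_formInt K φ ((B, B⁻¹), μ) ⟨hre, hμ⟩
  refine Tendsto.comp (g := fun p : (Matrix ι ι ℂ × Matrix ι ι ℂ) × ℂ => formInt p.1.1 p.1.2 K p.2 φ)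
    (f := fun η : ℝ => ((B + (η : ℂ) • (1 : Matrix ι ι ℂ), (B + (η : ℂ) • (1 : Matrix ι ι ℂ))⁻¹), μ))
    h1 ?_
  rw [tendsto_nhdsWithin_iff]
  refine ⟨(tendsto_add_smul_one hdet).prodMk_nhds tendsto_const_nhds, ?_⟩
  filter_upwards [self_mem_nhdsWithin] with η hη
  exact ⟨re_nonneg_of_definite hη (definite_add_smul_one hre), hμ⟩

include hdet hre in
theorem tendsto_regVal_add_smul_one (φ : Tst ι) :
    Tendsto (fun η : ℝ => regVal (B + (η : ℂ) • (1 : Matrix ι ι ℂ))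
      (B + (η : ℂ) • (1 : Matrix ι ι ℂ))⁻¹ m φ) (𝓝[>] 0) (𝓝 (regVal B B⁻¹ m φ)) := by
  have h1 : Tendsto (fun p : Matrix ι ι ℂ × Matrix ι ι ℂ => regVal p.1 p.2 m φ)
      (𝓝[{p | ∀ x, 0 ≤ (qform p.1 x).re}] (B, B⁻¹)) (𝓝 (regVal B B⁻¹ m φ)) :=
    (continuousOn_regVal m φ).continuousWithinAt hre
  refine Tendsto.comp (g := fun p : Matrix ι ι ℂ × Matrix ι ι ℂ => regVal p.1 p.2 m φ)
    (f := fun η : ℝ => (B + (η : ℂ) • (1 : Matrix ι ι ℂ), (B + (η : ℂ) • (1 : Matrix ι ι ℂ))⁻¹))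
    h1 ?_
  rw [tendsto_nhdsWithin_iff]
  refine ⟨tendsto_add_smul_one hdet, ?_⟩
  filter_upwards [self_mem_nhdsWithin] with η hη
  exact re_nonneg_of_definite hη (definite_add_smul_one hre)

include hn hB hdet hre in
theorem eventually_formInt_add_smul_one (φ : Tst ι) :
    ∀ᶠ η : ℝ in 𝓝[>] 0, ∀ μ : ℂ, -(m : ℝ) - 1 < μ.re →
      formInt (B + (η : ℂ) • (1 : Matrix ι ι ℂ)) (B + (η : ℂ) • (1 : Matrix ι ι ℂ))⁻¹ (m + 1) μ φ =
      bern (m + 1) (m + 1) μ * powInt (qform (B + (η : ℂ) • (1 : Matrix ι ι ℂ))) μ φ := by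
  have hdet' : ∀ᶠ η : ℝ in 𝓝[>] 0, IsUnit (B + (η : ℂ) • (1 : Matrix ι ι ℂ)).det :=
    eventually_det_ne_zero hdet (tendsto_add_smul_one_fst B)
  filter_upwards [self_mem_nhdsWithin, hdet'] with η hη hη2 μ hμ
  have hβ : (B + (η : ℂ) • (1 : Matrix ι ι ℂ))⁻¹ * (B + (η : ℂ) • (1 : Matrix ι ι ℂ)) = 1 :=
    Matrix.nonsing_inv_mul _ hη2
  have hη : 0 < η := hη
  exact formInt_eq_of_definite hn (isSymm_add_smul_one hB (η : ℂ)) hβ hη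
    (fun x => definite_add_smul_one hre x) φ hμ

include hn hB hdet hre in
/-- The continued integral inherits the zeros of `bern` which lie in `Re μ > -n / 2`, because
after a perturbation to a form with positive definite real part it is `bern` times a convergent
integral. -/
theorem formInt_eq_zero (φ : Tst ι) {j : ℕ} (hj : j < m) :
    formInt B B⁻¹ (m + 1) (-1 - (j : ℂ)) φ = 0 := by
  have hμ : -(m : ℝ) - 1 < (-1 - (j : ℂ)).re := by
    have : (j : ℝ) < m := by exact_mod_cast hj
    simp
    linarith
  refine tendsto_nhds_unique (tendsto_formInt_add_smul_one hdet hre (K := m + 1)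
    (by push_cast; linarith) φ) ((tendsto_const_nhds (x := (0 : ℂ))).congr' ?_)
  filter_upwards [eventually_formInt_add_smul_one hn hB hdet hre φ] with η hη
  rw [hη _ hμ]
  have : bern (m + 1) (m + 1) (-1 - (j : ℂ)) = 0 := by
    unfold bern
    rw [Finset.prod_eq_zero (Finset.mem_range.2 (show j < m + 1 by omega))]
    ring
  rw [this, zero_mul]

include hn hB hdet hre in
theorem formInt_zero_exponent (φ : Tst ι) :
    formInt B B⁻¹ (m + 1) 0 φ = bern (m + 1) (m + 1) 0 * ∫ x, φ x := by
  have hm : (0 : ℝ) ≤ m := m.cast_nonneg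
  have h0 : -(m : ℝ) - 1 < (0 : ℂ).re := by simp; linarith
  refine tendsto_nhds_unique (tendsto_formInt_add_smul_one hdet hre (K := m + 1)
    (by push_cast; linarith) φ)
    ((tendsto_const_nhds (x := bern (m + 1) (m + 1) 0 * ∫ x, φ x)).congr' ?_)
  filter_upwards [eventually_formInt_add_smul_one hn hB hdet hre φ] with η hη
  rw [hη _ h0]
  simp [powInt]

include hn hB hdet hre in
/-- The analytic continuation of `∫ q ^ μ φ` to `Re μ > -n / 2`. The zeros of `bern` in this
half-plane are cancelled by zeros of `formInt`; these are visible after perturbing `B` to a form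
with positive definite real part, for which the integral converges on the whole half-plane. -/
theorem exists_continuation (φ : Tst ι) :
    ∃ V : ℂ → ℂ, DifferentiableOn ℂ V {μ | -(m : ℝ) - 1 < μ.re} ∧
      (∀ μ : ℂ, 0 < μ.re → V μ = powInt (qform B) μ φ) ∧
      V (-(m : ℂ)) = regVal B B⁻¹ m φ ∧ V 0 = ∫ x, φ x := by
  have hm : (0 : ℝ) ≤ m := m.cast_nonneg
  set U : Set ℂ := {μ | -(m : ℝ) - 1 < μ.re} with hU
  -- The factors of `bern (m + 1) (m + 1)` without zeros in the half-plane `Re μ > -n / 2`.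
  set rest : ℂ → ℂ := fun μ => (μ + 1 + m) * ∏ j ∈ Finset.range (m + 1), (μ + (m + 1) + j) with hrest
  have hrest_ne : ∀ μ ∈ U, rest μ ≠ 0 := by
    intro μ hμ
    have hμ : -(m : ℝ) - 1 < μ.re := hμ
    refine mul_ne_zero ?_ (Finset.prod_ne_zero_iff.2 fun j _ => ?_)
    · intro h
      have := congrArg Complex.re h
      simp at this
      linarith
    · intro h
      have := congrArg Complex.re h
      have hj : (0 : ℝ) ≤ j := j.cast_nonneg
      simp at this
      linarith
  have hbern : ∀ μ, bern (m + 1) (m + 1) μ =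
      (∏ j ∈ Finset.range m, (μ - (-1 - (j : ℂ)))) * rest μ := by
    intro μ
    simp only [bern, hrest]
    rw [Finset.prod_mul_distrib, Finset.prod_range_succ, mul_assoc]
    congr 1
    exact Finset.prod_congr rfl fun j _ => by ring
  have hUo : IsOpen U := isOpen_re_gt _
  have hform : DifferentiableOn ℂ (fun μ => formInt B B⁻¹ (m + 1) μ φ) U := by
    convert differentiableOn_formInt B⁻¹ hre (m + 1) φ using 1
    ext μ
    simp only [hU, mem_ofPred_eq]
    push_cast
    constructor <;> intro h <;> linarith
  have hrestd : Differentiable ℂ rest := by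
    simp only [hrest]
    fun_prop
  -- The other zeros of `bern`, at `-1, …, -m`, are zeros of `formInt` and can be divided out.
  obtain ⟨V, hV, hVf⟩ := exists_differentiableOn_prod_mul hUo m (fun j => -1 - (j : ℂ))
    (fun j hj => by
      have : (j : ℝ) < m := by exact_mod_cast hj
      simp [hU]
      linarith)
    (fun i _ j _ h => by
      have := sub_right_injective h
      exact_mod_cast this)
    (fun μ => formInt B B⁻¹ (m + 1) μ φ / rest μ) (hform.div hrestd.differentiableOn hrest_ne)
    (fun j hj => by simp only [formInt_eq_zero hn hB hdet hre φ hj, zero_div])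
  have hkey : ∀ μ ∈ U, formInt B B⁻¹ (m + 1) μ φ = bern (m + 1) (m + 1) μ * V μ := by
    intro μ hμ
    have := hVf μ
    rw [div_eq_iff (hrest_ne μ hμ)] at this
    rw [this, hbern]
    ring
  refine ⟨V, hV, ?_, ?_, ?_⟩
  · intro μ hμ
    have h1 := hkey μ (by simp only [hU, mem_ofPred_eq]; linarith)
    rw [formInt_eq_bern_mul hB (Matrix.nonsing_inv_mul _ hdet) hre (m + 1) hμ, card_div_two hn] at h1
    exact (mul_left_cancel₀ (bern_ne_zero_of_re (by linarith) _) h1).symm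
  · rw [← circleAverage_eq_of_differentiableOn hV]
    refine circleAverage_congr_norm fun μ hμ => ?_
    rw [hkey μ (re_gt_of_norm hμ.le), mul_div_cancel_left₀ _ (bern_ne_zero_of_norm hμ _)]
  · have h0 : -(m : ℝ) - 1 < (0 : ℂ).re := by simp; linarith
    have h1 := hkey 0 h0
    rw [formInt_zero_exponent hn hB hdet hre φ] at h1
    exact (mul_left_cancel₀ (bern_ne_zero_of_re (by simp) _) h1).symm

end semidefinite

end

section

/-! ### The regularized powers as distributions -/

section kernel

variable {ι : Type*} [Fintype ι]

/-- The continuous kernel of `regVal`: the regularized power is obtained by applying a power of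
`boxT` to the test function and integrating against this function. -/
def regKernel (B : Matrix ι ι ℂ) (m : ℕ) (x : EuclideanSpace ℝ ι) : ℂ :=
  Real.circleAverage (fun μ => qform B x ^ (μ + ((m + 1 : ℕ) : ℂ)) / bern (m + 1) (m + 1) μ)
    (-(m : ℂ)) (1 / 2)

theorem continuous_regKernel_integrand {B : Matrix ι ι ℂ} (hre : ∀ x, 0 ≤ (qform B x).re) (m : ℕ) :
    Continuous fun p : ℝ × EuclideanSpace ℝ ι =>
      qform B p.2 ^ (circleMap (-(m : ℂ)) (1 / 2) p.1 + ((m + 1 : ℕ) : ℂ)) /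
        bern (m + 1) (m + 1) (circleMap (-(m : ℂ)) (1 / 2) p.1) := by
  refine Continuous.div ?_ ?_ ?_
  · refine continuousOn_cpow_of_re.comp_continuous (f := fun p : ℝ × EuclideanSpace ℝ ι =>
      (qform B p.2, circleMap (-(m : ℂ)) (1 / 2) p.1 + ((m + 1 : ℕ) : ℂ))) ?_ ?_
    · exact ((contDiff_qform B).continuous.comp continuous_snd).prodMk
        (((continuous_circleMap _ _).comp continuous_fst).add continuous_const)
    · exact fun p => ⟨hre _, re_circleMap_add_pos m p.1⟩
  · exact (differentiable_bern _ _).continuous.comp ((continuous_circleMap _ _).comp continuous_fst)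
  · exact fun p => bern_ne_zero_of_norm (norm_circleMap_add m p.1) _

theorem continuous_regKernel {B : Matrix ι ι ℂ} (hre : ∀ x, 0 ≤ (qform B x).re) (m : ℕ) :
    Continuous (regKernel B m) := by
  unfold regKernel
  simp only [Real.circleAverage_def]
  refine (intervalIntegral.continuous_parametric_intervalIntegral_of_continuous' ?_ _ _).const_smul _
  exact Continuous.comp (g := fun p : ℝ × EuclideanSpace ℝ ι =>
      qform B p.2 ^ (circleMap (-(m : ℂ)) (1 / 2) p.1 + ((m + 1 : ℕ) : ℂ)) /
        bern (m + 1) (m + 1) (circleMap (-(m : ℂ)) (1 / 2) p.1))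
    (f := fun p : EuclideanSpace ℝ ι × ℝ => (p.2, p.1))
    (continuous_regKernel_integrand hre m) continuous_swap

variable [DecidableEq ι]

theorem regVal_eq_integral {B : Matrix ι ι ℂ} (β : Matrix ι ι ℂ) (hre : ∀ x, 0 ≤ (qform B x).re)
    (m : ℕ) (φ : Tst ι) :
    regVal B β m φ = ∫ x, regKernel B m x * ((boxT β)^[m + 1] φ) x := by
  set ψ := (boxT β)^[m + 1] φ with hψ
  have h1 : regVal B β m φ = Real.circleAverage (fun μ => ∫ x,
      qform B x ^ (μ + ((m + 1 : ℕ) : ℂ)) / bern (m + 1) (m + 1) μ * ψ x) (-(m : ℂ)) (1 / 2) := by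
    refine circleAverage_congr_norm fun μ hμ => ?_
    have h2 : -((m + 1 : ℕ) : ℝ) < μ.re := by
      have := re_gt_of_norm hμ.le
      push_cast
      linarith
    rw [formInt_eq_integral β hre (m + 1) μ φ h2, ← hψ, powInt, ← integral_div]
    refine integral_congr_ae (Eventually.of_forall fun x => ?_)
    simp only
    ring
  rw [h1, circleAverage_integral (k := tsupport ψ) ψ.hasCompactSupport]
  · refine integral_congr_ae (Eventually.of_forall fun x => ?_)
    simp only [regKernel, Real.circleAverage_def]
    rw [intervalIntegral.integral_mul_const, smul_mul_assoc]
  · exact (continuous_regKernel_integrand hre m).mul (ψ.continuous.comp continuous_snd)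
  · intro μ x hx
    rw [image_eq_zero_of_notMem_tsupport hx, mul_zero]

theorem regVal_add {B : Matrix ι ι ℂ} (β : Matrix ι ι ℂ) (hre : ∀ x, 0 ≤ (qform B x).re)
    (m : ℕ) (φ ψ : Tst ι) : regVal B β m (φ + ψ) = regVal B β m φ + regVal B β m ψ := by
  simp only [regVal_eq_integral β hre]
  rw [← integral_add (integrable_mul_tst (continuous_regKernel hre m) _)
    (integrable_mul_tst (continuous_regKernel hre m) _)]
  refine integral_congr_ae (Eventually.of_forall fun x => ?_)
  simp only [← Module.End.pow_apply, map_add]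
  exact mul_add _ _ _

theorem regVal_smul {B : Matrix ι ι ℂ} (β : Matrix ι ι ℂ) (hre : ∀ x, 0 ≤ (qform B x).re)
    (m : ℕ) (c : ℂ) (φ : Tst ι) : regVal B β m (c • φ) = c * regVal B β m φ := by
  simp only [regVal_eq_integral β hre]
  rw [← integral_const_mul]
  refine integral_congr_ae (Eventually.of_forall fun x => ?_)
  simp only [← Module.End.pow_apply, map_smul]
  simp
  ring

theorem continuous_boxT (β : Matrix ι ι ℂ) : Continuous (boxT β) := by
  have h1 : ⇑(boxT β) = fun φ => ∑ l : ι × ι, TestFunction.postcompCLM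
      (ContinuousLinearMap.mul ℝ ℂ (β l.1 l.2 / 4)) (pdT l.1 (pdT l.2 φ)) := by
    funext φ
    rw [boxT_apply]
    refine Finset.sum_congr rfl fun l _ => ?_
    ext x
    simp
  rw [h1]
  fun_prop

/-- Real test functions as complex test functions. -/
def ofRealT (φ : 𝓓((⊤ : TopologicalSpace.Opens (EuclideanSpace ℝ ι)), ℝ)) : Tst ι :=
  TestFunction.postcompCLM Complex.ofRealCLM φ

omit [DecidableEq ι] in
@[simp]
theorem ofRealT_apply (φ : 𝓓((⊤ : TopologicalSpace.Opens (EuclideanSpace ℝ ι)), ℝ))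
    (x : EuclideanSpace ℝ ι) : ofRealT φ x = (φ x : ℂ) := rfl

/-- The regularized power `regVal` as a distribution. -/
def regDistr (B β : Matrix ι ι ℂ) (hre : ∀ x, 0 ≤ (qform B x).re) (m : ℕ) :
    𝓓'((⊤ : TopologicalSpace.Opens (EuclideanSpace ℝ ι)), ℂ) where
  toFun φ := regVal B β m (ofRealT φ)
  map_add' φ ψ := by
    rw [← regVal_add β hre]
    congr 1
    exact map_add (TestFunction.postcompCLM Complex.ofRealCLM) φ ψ
  map_smul' c φ := by
    rw [RingHom.id_apply, Complex.real_smul, ← regVal_smul β hre]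
    congr 1
    ext x
    simp
  cont := by
    have h1 : ∀ φ, regVal B β m (ofRealT φ) = TestFunction.integralAgainstBilinCLM
        (ContinuousLinearMap.mul ℝ ℂ) volume (regKernel B m) ((boxT β)^[m + 1] (ofRealT φ)) := by
      intro φ
      rw [regVal_eq_integral β hre, TestFunction.integralAgainstBilinCLM_eq_integral
        ((continuous_regKernel hre m).locallyIntegrable.locallyIntegrableOn _)]
      simp only [ContinuousLinearMap.mul_apply', mul_comm]
    simp only [h1]
    exact (ContinuousLinearMap.continuous _).comp (((continuous_boxT β).iterate (m + 1)).comp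
      (TestFunction.postcompCLM Complex.ofRealCLM).continuous)

theorem regDistr_apply (B β : Matrix ι ι ℂ) (hre : ∀ x, 0 ≤ (qform B x).re) (m : ℕ)
    (φ : 𝓓((⊤ : TopologicalSpace.Opens (EuclideanSpace ℝ ι)), ℝ)) :
    regDistr B β hre m φ = regVal B β m (ofRealT φ) := rfl

theorem tendsto_powInt_regVal {m : ℕ} (hn : Fintype.card ι = 2 * (m + 1)) {B : Matrix ι ι ℂ}
    (hB : B.IsSymm) (hdet : IsUnit B.det) (hre : ∀ x, 0 ≤ (qform B x).re) (φ : Tst ι) :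
    Tendsto (fun η : ℝ => powInt (qform (B + (η : ℂ) • (1 : Matrix ι ι ℂ))) (-(m : ℂ)) φ) (𝓝[>] 0)
      (𝓝 (regVal B B⁻¹ m φ)) := by
  refine (tendsto_regVal_add_smul_one (m := m) hdet hre φ).congr' ?_
  have hdet' : ∀ᶠ η : ℝ in 𝓝[>] 0, IsUnit (B + (η : ℂ) • (1 : Matrix ι ι ℂ)).det :=
    eventually_det_ne_zero hdet (tendsto_add_smul_one_fst B)
  filter_upwards [self_mem_nhdsWithin, hdet'] with η hη hη2
  have hβ : (B + (η : ℂ) • (1 : Matrix ι ι ℂ))⁻¹ * (B + (η : ℂ) • (1 : Matrix ι ι ℂ)) = 1 :=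
    Matrix.nonsing_inv_mul _ hη2
  have hη : 0 < η := hη
  exact regVal_eq_of_definite hn (isSymm_add_smul_one hB (η : ℂ)) hβ hη
    (fun x => definite_add_smul_one hre x) φ

omit [DecidableEq ι] in
theorem qform_map_star (B : Matrix ι ι ℂ) (x : EuclideanSpace ℝ ι) :
    qform (B.map (starRingEnd ℂ)) x = (starRingEnd ℂ) (qform B x) := by
  simp [qform]

omit [Fintype ι] in
theorem map_star_add_smul_one (B : Matrix ι ι ℂ) (η : ℝ) :
    (B + (η : ℂ) • (1 : Matrix ι ι ℂ)).map (starRingEnd ℂ) =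
      B.map (starRingEnd ℂ) + (η : ℂ) • (1 : Matrix ι ι ℂ) := by
  ext i j
  by_cases h : i = j <;> simp [h]

/-- Conjugation of the form conjugates the regularized power on real test functions. -/
theorem regVal_map_star {m : ℕ} (hn : Fintype.card ι = 2 * (m + 1)) {B : Matrix ι ι ℂ}
    (hB : B.IsSymm) (hdet : IsUnit B.det) (hre : ∀ x, 0 ≤ (qform B x).re)
    (φ : 𝓓((⊤ : TopologicalSpace.Opens (EuclideanSpace ℝ ι)), ℝ)) :
    regVal (B.map (starRingEnd ℂ)) (B.map (starRingEnd ℂ))⁻¹ m (ofRealT φ) =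
      (starRingEnd ℂ) (regVal B B⁻¹ m (ofRealT φ)) := by
  have hB' : (B.map (starRingEnd ℂ)).IsSymm := hB.map _
  have hdet' : IsUnit (B.map (starRingEnd ℂ)).det := by
    have : (B.map (starRingEnd ℂ)).det = (starRingEnd ℂ) B.det := (RingHom.map_det _ _).symm
    rw [this]
    exact hdet.map _
  have hre' : ∀ x, 0 ≤ (qform (B.map (starRingEnd ℂ)) x).re := fun x => by
    rw [qform_map_star, Complex.conj_re]
    exact hre x
  refine tendsto_nhds_unique (tendsto_powInt_regVal hn hB' hdet' hre' (ofRealT φ)) ?_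
  refine ((Complex.continuous_conj.tendsto _).comp
    (tendsto_powInt_regVal hn hB hdet hre (ofRealT φ))).congr fun η => ?_
  simp only [Function.comp_apply]
  rw [powInt, powInt, ← integral_conj]
  refine integral_congr_ae (Eventually.of_forall fun x => ?_)
  simp only [← map_star_add_smul_one, qform_map_star, Complex.cpow_neg, Complex.cpow_natCast,
    ofRealT_apply, map_mul, map_inv₀, map_pow, Complex.conj_ofReal]

end kernel

end

section

/-! ### The form `P` and the distribution `(P + i0) ^ (-m)` -/

/-- The index set of the coordinates of `Flat p q`. -/
abbrev Idx (p q : ℕ) : Type := Fin (p - 1) ⊕ Fin (q - 1)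

/-- The diagonal matrix of the quadratic form `P`. -/
def signJ (p q : ℕ) : Matrix (Idx p q) (Idx p q) ℂ :=
  Matrix.diagonal (Sum.elim (fun _ => 1) (fun _ => -1))

variable {p q m : ℕ}

theorem card_idx (hm : (p - 1) + (q - 1) = 2 * (m + 1)) :
    Fintype.card (Idx p q) = 2 * (m + 1) := by
  simp [hm]

theorem qform_smul (c : ℂ) {ι : Type*} [Fintype ι] (B : Matrix ι ι ℂ) (x : EuclideanSpace ℝ ι) :
    qform (c • B) x = c * qform B x := by
  simp only [qform, Matrix.smul_apply, smul_eq_mul, Finset.mul_sum, mul_assoc]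

theorem qform_diagonal {ι : Type*} [Fintype ι] [DecidableEq ι] (a : ι → ℂ) (x : EuclideanSpace ℝ ι) :
    qform (Matrix.diagonal a) x = ∑ i, a i * (x i : ℂ) ^ 2 := by
  unfold qform
  refine Finset.sum_congr rfl fun i _ => ?_
  rw [Finset.sum_eq_single i]
  · rw [Matrix.diagonal_apply_eq]
    ring
  · intro j _ hj
    rw [Matrix.diagonal_apply_ne _ hj.symm]
    ring
  · simp

theorem qform_smul_signJ (c : ℂ) (x : Flat p q) : qform (c • signJ p q) x = c * quadP x := by
  rw [qform_smul, signJ, qform_diagonal, Fintype.sum_sum_type, quadP]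
  push_cast
  simp [sub_eq_add_neg]

theorem isSymm_smul_signJ (c : ℂ) : (c • signJ p q).IsSymm :=
  (Matrix.isSymm_diagonal _).smul c

theorem signJ_mul_signJ : signJ p q * signJ p q = 1 := by
  rw [signJ, Matrix.diagonal_mul_diagonal, ← Matrix.diagonal_one]
  congr 1
  funext i
  cases i <;> simp

theorem isUnit_det_smul_signJ {c : ℂ} (hc : c ≠ 0) : IsUnit (c • signJ p q).det := by
  have h := congrArg Matrix.det (signJ_mul_signJ (p := p) (q := q))
  rw [Matrix.det_mul, Matrix.det_one] at h
  rw [Matrix.det_smul]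
  exact ((pow_ne_zero _ hc).isUnit).mul (IsUnit.of_mul_eq_one _ h)

theorem re_qform_smul_signJ {c : ℂ} (hc : c.re = 0) (x : Flat p q) :
    0 ≤ (qform (c • signJ p q) x).re := by
  rw [qform_smul_signJ, mul_comm, Complex.re_ofReal_mul, hc, mul_zero]

/-- The regularized power `(c P) ^ (-m)` for an imaginary number `c`, as a functional on complex
test functions. -/
def regP (p q m : ℕ) (c : ℂ) (φ : CcInfty p q) : ℂ := regVal (c • signJ p q) (c • signJ p q)⁻¹ m φ

theorem regP_conj (hm : (p - 1) + (q - 1) = 2 * (m + 1)) (φ : CcInftyReal p q) :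
    regP p q m Complex.I (ofRealT φ) =
      (starRingEnd ℂ) (regP p q m (-Complex.I) (ofRealT φ)) := by
  have h : (-Complex.I • signJ p q).map (starRingEnd ℂ) = Complex.I • signJ p q := by
    ext i j
    rcases i with i | i <;> rcases j with j | j <;> simp [signJ, Matrix.diagonal_apply] <;>
      split_ifs <;> simp
  have h1 := regVal_map_star (card_idx hm) (B := -Complex.I • signJ p q) (isSymm_smul_signJ _)
    (isUnit_det_smul_signJ (by simp)) (re_qform_smul_signJ (by simp)) φ
  rw [h] at h1
  exact h1

theorem exists_coercive {ι : Type*} [Fintype ι] [Nonempty ι] [DecidableEq ι] {R : Matrix ι ι ℝ}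
    (hR : R.PosDef) :
    ∃ c > 0, ∀ x : EuclideanSpace ℝ ι, c * ‖x‖ ^ 2 ≤ x.ofLp ⬝ᵥ R.mulVec x.ofLp := by
  have hcont : Continuous fun x : EuclideanSpace ℝ ι => x.ofLp ⬝ᵥ R.mulVec x.ofLp := by
    simp only [dotProduct, Matrix.mulVec]
    fun_prop
  obtain ⟨i⟩ := ‹Nonempty ι›
  have hne : (Metric.sphere (0 : EuclideanSpace ℝ ι) 1).Nonempty :=
    ⟨EuclideanSpace.single i 1, by simp⟩
  obtain ⟨u, hu, hmin⟩ := (isCompact_sphere (0 : EuclideanSpace ℝ ι) 1).exists_isMinOn hne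
    hcont.continuousOn
  have hu1 : ‖u‖ = 1 := by simpa using hu
  refine ⟨u.ofLp ⬝ᵥ R.mulVec u.ofLp, ?_, fun x => ?_⟩
  · have hu0 : u.ofLp ≠ 0 := by
      intro h
      have : u = 0 := by ext j; exact congrFun h j
      simp [this] at hu1
    simpa using hR.dotProduct_mulVec_pos hu0
  · rcases eq_or_ne x 0 with rfl | hx
    · simp
    · have hx' : 0 < ‖x‖ := norm_pos_iff.2 hx
      have h1 : ‖x‖⁻¹ • x ∈ Metric.sphere (0 : EuclideanSpace ℝ ι) 1 := by
        simp [norm_smul, hx]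
      have h2 := hmin h1
      simp only [mem_ofPred_eq, WithLp.ofLp_smul, Matrix.mulVec_smul, dotProduct_smul,
        smul_dotProduct, smul_eq_mul] at h2
      calc _ ≤ (‖x‖⁻¹ * (‖x‖⁻¹ * (x.ofLp ⬝ᵥ R.mulVec x.ofLp))) * ‖x‖ ^ 2 := by gcongr
        _ = _ := by field_simp

theorem qform_map_ofReal {ι : Type*} [Fintype ι] (R : Matrix ι ι ℝ) (x : EuclideanSpace ℝ ι) :
    qform (R.map (fun r : ℝ => (r : ℂ))) x = ((x.ofLp ⬝ᵥ R.mulVec x.ofLp : ℝ) : ℂ) := by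
  simp only [qform, dotProduct, Matrix.mulVec, Matrix.map_apply]
  push_cast
  refine Finset.sum_congr rfl fun i _ => ?_
  rw [Finset.mul_sum]
  exact Finset.sum_congr rfl fun j _ => by ring

theorem qform_add {ι : Type*} [Fintype ι] (A B : Matrix ι ι ℂ) (x : EuclideanSpace ℝ ι) :
    qform (A + B) x = qform A x + qform B x := by
  simp only [qform, Matrix.add_apply, add_mul, Finset.sum_add_distrib]

theorem tendsto_map_add_smul_signJ (c : ℂ) :
    Tendsto (fun R : Matrix (Idx p q) (Idx p q) ℝ =>
      R.map (fun r : ℝ => (r : ℂ)) + c • signJ p q) (𝓝[{R | R.PosDef}] 0) (𝓝 (c • signJ p q)) := by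
  have : Continuous fun R : Matrix (Idx p q) (Idx p q) ℝ =>
      R.map (fun r : ℝ => (r : ℂ)) + c • signJ p q :=
    (continuous_id.matrix_map Complex.continuous_ofReal).add continuous_const
  have h := this.tendsto 0
  have h0 : (0 : Matrix (Idx p q) (Idx p q) ℝ).map (fun r : ℝ => (r : ℂ)) = 0 := by ext; simp
  rw [h0, zero_add] at h
  exact h.mono_left nhdsWithin_le_nhds

/-- The limit `R → 0`: since `-i (P + i R) = R - i P` has positive definite real part,
`(P + i R) ^ (-m)` is `i ^ (-m)` times an integral power to which `regVal` applies, and `regVal`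
depends continuously on the form. -/
theorem isQuadPAddIZeroPow_regDistr (hm : (p - 1) + (q - 1) = 2 * (m + 1)) :
    IsQuadPAddIZeroPow (-(m : ℂ)) (cmul ((Complex.I ^ m)⁻¹)
      (regDistr (-Complex.I • signJ p q) (-Complex.I • signJ p q)⁻¹
        (re_qform_smul_signJ (by simp)) m)) := by
  intro φ
  set B₀ : Matrix (Idx p q) (Idx p q) ℂ := -Complex.I • signJ p q with hB₀
  have hdet : IsUnit B₀.det := isUnit_det_smul_signJ (by simp)
  have hlim := tendsto_map_add_smul_signJ (p := p) (q := q) (-Complex.I)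
  rw [← hB₀] at hlim
  have hne : Nonempty (Idx p q) := nonempty_of_card (card_idx hm)
  have hqf : ∀ (R : Matrix (Idx p q) (Idx p q) ℝ) (x : Flat p q),
      qform (R.map (fun r : ℝ => (r : ℂ)) + B₀) x =
        ((x.ofLp ⬝ᵥ R.mulVec x.ofLp : ℝ) : ℂ) + -Complex.I * quadP x := fun R x => by
    rw [qform_add, qform_map_ofReal, hB₀, qform_smul_signJ]
  have hqre : ∀ (R : Matrix (Idx p q) (Idx p q) ℝ) (x : Flat p q),
      (qform (R.map (fun r : ℝ => (r : ℂ)) + B₀) x).re = x.ofLp ⬝ᵥ R.mulVec x.ofLp := fun R x => by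
    rw [hqf]
    simp
  have hcoer : ∀ R : Matrix (Idx p q) (Idx p q) ℝ, R.PosDef → ∃ c > 0, ∀ x : Flat p q,
      c * ‖x‖ ^ 2 ≤ (qform (R.map (fun r : ℝ => (r : ℂ)) + B₀) x).re := by
    intro R hR
    obtain ⟨c, hc, h⟩ := exists_coercive hR
    exact ⟨c, hc, fun x => (h x).trans_eq (hqre R x).symm⟩
  have h1 : Tendsto (fun B : Matrix (Idx p q) (Idx p q) ℂ × Matrix (Idx p q) (Idx p q) ℂ =>
      regVal B.1 B.2 m (ofRealT φ)) (𝓝[{B | ∀ x, 0 ≤ (qform B.1 x).re}] (B₀, B₀⁻¹))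
      (𝓝 (regVal B₀ B₀⁻¹ m (ofRealT φ))) :=
    (continuousOn_regVal m (ofRealT φ)).continuousWithinAt (re_qform_smul_signJ (by simp))
  have h2 : Tendsto (fun R : Matrix (Idx p q) (Idx p q) ℝ =>
      ((R.map (fun r : ℝ => (r : ℂ)) + B₀), (R.map (fun r : ℝ => (r : ℂ)) + B₀)⁻¹))
      (𝓝[{R | R.PosDef}] 0) (𝓝[{B | ∀ x, 0 ≤ (qform B.1 x).re}] (B₀, B₀⁻¹)) := by
    rw [tendsto_nhdsWithin_iff]
    refine ⟨hlim.prodMk_nhds ((continuousAt_matrix_inv hdet).tendsto.comp hlim), ?_⟩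
    filter_upwards [self_mem_nhdsWithin] with R hR
    obtain ⟨c, hc, h⟩ := hcoer R hR
    exact re_nonneg_of_definite hc h
  have h3 := (h1.comp h2).const_mul ((Complex.I ^ m)⁻¹)
  have e : cmul ((Complex.I ^ m)⁻¹) (regDistr B₀ B₀⁻¹ (re_qform_smul_signJ (by simp)) m) φ =
      (Complex.I ^ m)⁻¹ * regVal B₀ B₀⁻¹ m (ofRealT φ) := rfl
  rw [e]
  refine h3.congr' ?_
  have hdet' : ∀ᶠ R : Matrix (Idx p q) (Idx p q) ℝ in 𝓝[{R | R.PosDef}] 0,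
      IsUnit (R.map (fun r : ℝ => (r : ℂ)) + B₀).det := eventually_det_ne_zero hdet hlim
  filter_upwards [self_mem_nhdsWithin, hdet'] with R hR hRdet
  obtain ⟨c, hc, h⟩ := hcoer R hR
  have hR : R.PosDef := hR
  have hsymm : (R.map (fun r : ℝ => (r : ℂ)) + B₀).IsSymm := by
    have h4 : R.IsSymm := by
      have := hR.isHermitian
      rwa [Matrix.IsHermitian, Matrix.conjTranspose_eq_transpose_of_trivial] at this
    exact (h4.map _).add (isSymm_smul_signJ _)
  simp only [Function.comp_apply]
  rw [regVal_eq_of_definite (card_idx hm) hsymm (Matrix.nonsing_inv_mul _ hRdet) hc h, powInt,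
    ← integral_const_mul]
  refine integral_congr_ae (Eventually.of_forall fun x => ?_)
  simp only [ofRealT_apply]
  rw [hqf, Complex.cpow_neg, Complex.cpow_natCast, Complex.cpow_neg, Complex.cpow_natCast,
    ← mul_assoc, ← mul_inv, ← mul_pow]
  congr 3
  linear_combination (-(quadP x : ℂ)) * Complex.I_sq

instance neBot_nhdsWithin_posDef {ι : Type*} [Fintype ι] [DecidableEq ι] :
    (𝓝[{R : Matrix ι ι ℝ | R.PosDef}] 0).NeBot := by
  have h1 : Tendsto (fun η : ℝ => η • (1 : Matrix ι ι ℝ)) (𝓝[>] 0)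
      (𝓝[{R : Matrix ι ι ℝ | R.PosDef}] 0) := by
    rw [tendsto_nhdsWithin_iff]
    constructor
    · have : Continuous fun η : ℝ => η • (1 : Matrix ι ι ℝ) := by fun_prop
      have h := this.tendsto 0
      rw [zero_smul] at h
      exact h.mono_left nhdsWithin_le_nhds
    · filter_upwards [self_mem_nhdsWithin] with η hη
      exact Matrix.PosDef.one.smul hη
  exact h1.neBot

theorem IsQuadPAddIZeroPow.unique {l : ℂ} {T T' : Distr p q} (h : IsQuadPAddIZeroPow l T)
    (h' : IsQuadPAddIZeroPow l T') : T = T' :=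
  DFunLike.ext _ _ fun φ => tendsto_nhds_unique (h φ) (h' φ)

theorem IsQuadPAddIZeroPow.quadPAddIZeroPow_eq {l : ℂ} {T : Distr p q}
    (h : IsQuadPAddIZeroPow l T) : quadPAddIZeroPow p q l = T := by
  have hex : ∃ T : Distr p q, IsQuadPAddIZeroPow l T := ⟨T, h⟩
  rw [quadPAddIZeroPow, dif_pos hex]
  exact hex.choose_spec.unique h

end

section

/-! ### The Knapp–Stein kernel -/

/-- Gluing of holomorphic functions on two overlapping half-planes. -/
theorem exists_differentiableOn_glue {G H : ℂ → ℂ} {a : ℝ}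
    (hG : DifferentiableOn ℂ G {μ | a < μ.re ∧ μ.re < 1}) (hH : DifferentiableOn ℂ H {μ | 0 < μ.re})
    (hGH : ∀ μ : ℂ, 0 < μ.re → μ.re < 1 → G μ = H μ) :
    ∃ F : ℂ → ℂ, DifferentiableOn ℂ F {μ | a < μ.re} ∧ (∀ μ : ℂ, 0 < μ.re → F μ = H μ) ∧
      ∀ μ : ℂ, μ.re ≤ 0 → F μ = G μ := by
  refine ⟨fun μ => if 0 < μ.re then H μ else G μ, ?_, fun μ h => if_pos h,
    fun μ h => if_neg h.not_gt⟩
  intro μ hμ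
  have hμ : a < μ.re := hμ
  refine DifferentiableAt.differentiableWithinAt ?_
  rcases lt_or_ge 0 μ.re with h | h
  · have hU : {μ : ℂ | 0 < μ.re} ∈ 𝓝 μ := (isOpen_re_gt 0).mem_nhds h
    refine (hH.differentiableAt hU).congr_of_eventuallyEq ?_
    filter_upwards [hU] with z hz
    exact if_pos hz
  · have hU : {μ : ℂ | a < μ.re ∧ μ.re < 1} ∈ 𝓝 μ :=
      ((isOpen_re_gt a).inter (isOpen_lt Complex.continuous_re continuous_const)).mem_nhds
        ⟨hμ, h.trans_lt one_pos⟩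
    refine (hG.differentiableAt hU).congr_of_eventuallyEq ?_
    filter_upwards [hU] with z hz
    by_cases hz0 : 0 < z.re
    · rw [if_pos hz0, hGH z hz0 hz.2]
    · rw [if_neg hz0]

theorem mul_ofReal_cpow {s μ : ℂ} (hs : s ≠ 0) (hμ : μ ≠ 0) (y : ℝ) :
    (s * (y : ℂ)) ^ μ =
      s ^ μ * ((max y 0 : ℝ) : ℂ) ^ μ + (-s) ^ μ * ((max (-y) 0 : ℝ) : ℂ) ^ μ := by
  have key : ∀ {r : ℝ} {s : ℂ}, 0 < r → s ≠ 0 → (s * (r : ℂ)) ^ μ = s ^ μ * (r : ℂ) ^ μ := by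
    intro r s hr hs
    have hr' : (r : ℂ) ≠ 0 := by exact_mod_cast hr.ne'
    rw [Complex.cpow_def_of_ne_zero (mul_ne_zero hs hr'), Complex.cpow_def_of_ne_zero hs,
      Complex.cpow_def_of_ne_zero hr', ← Complex.exp_add, mul_comm s, Complex.log_ofReal_mul hr hs,
      Complex.ofReal_log hr.le]
    ring_nf
  rcases lt_trichotomy y 0 with hy | rfl | hy
  · rw [max_eq_right hy.le, max_eq_left (by linarith), Complex.ofReal_zero, Complex.zero_cpow hμ,
      mul_zero, zero_add, ← key (by linarith) (neg_ne_zero.2 hs)]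
    push_cast
    ring_nf
  · simp [Complex.zero_cpow hμ]
  · rw [max_eq_left hy.le, max_eq_right (by linarith), Complex.ofReal_zero, Complex.zero_cpow hμ,
      mul_zero, add_zero, key hy hs]

theorem psiFun_eq {ε : ℤ} (hε : ε = 1 ∨ ε = -1) {μ : ℂ} (hμ : μ ≠ 0) (y : ℝ) :
    psiFun μ ε y = (Complex.Gamma ((2 * μ + 3 - ε) / 4))⁻¹ *
      (((max y 0 : ℝ) : ℂ) ^ μ + ε * ((max (-y) 0 : ℝ) : ℂ) ^ μ) := by
  unfold psiFun chi
  rw [one_div, mul_assoc]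
  congr 1
  rcases lt_trichotomy y 0 with hy | rfl | hy
  · rw [max_eq_right hy.le, max_eq_left (by linarith), Complex.ofReal_zero, Complex.zero_cpow hμ,
      abs_of_neg hy, sign_neg hy]
    rcases hε with rfl | rfl <;> simp
  · simp [Complex.zero_cpow hμ]
  · rw [max_eq_left hy.le, max_eq_right (by linarith), Complex.ofReal_zero, Complex.zero_cpow hμ,
      abs_of_pos hy, sign_pos hy]
    rcases hε with rfl | rfl <;> simp

theorem I_cpow (μ : ℂ) : Complex.I ^ μ = Complex.exp ((Real.pi * μ / 2) * Complex.I) := by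
  rw [Complex.cpow_def_of_ne_zero Complex.I_ne_zero, Complex.log_I]
  ring_nf

theorem neg_I_cpow (μ : ℂ) : (-Complex.I) ^ μ = Complex.exp (-(Real.pi * μ / 2) * Complex.I) := by
  rw [Complex.cpow_def_of_ne_zero (by simp), Complex.log_neg_I]
  ring_nf

theorem I_cpow_add (μ : ℂ) : (-Complex.I) ^ μ + Complex.I ^ μ = 2 * Complex.cos (Real.pi * μ / 2) := by
  rw [I_cpow, neg_I_cpow, Complex.two_cos]
  ring

theorem I_cpow_sub (μ : ℂ) :
    (-Complex.I) ^ μ - Complex.I ^ μ = -2 * Complex.I * Complex.sin (Real.pi * μ / 2) := by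
  have h := Complex.two_sin (Real.pi * μ / 2)
  rw [I_cpow, neg_I_cpow]
  linear_combination Complex.I * h + (Complex.exp (-(Real.pi * μ / 2) * Complex.I) -
    Complex.exp ((Real.pi * μ / 2) * Complex.I)) * Complex.I_sq

/-- The reflection formula in the form which compares the coefficient of the combination of
`(∓i P) ^ μ` with the normalizing factor of `ψ_{μ,1}`. -/
theorem Gamma_mul_cos {μ : ℂ} (h0 : 0 < μ.re) (h1 : μ.re < 1) :
    Complex.Gamma ((1 - μ) / 2) * Complex.cos (Real.pi * μ / 2) =
      Real.pi * (Complex.Gamma ((2 * μ + 3 - (1 : ℤ)) / 4))⁻¹ := by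
  have h := Complex.Gamma_mul_Gamma_one_sub ((1 + μ) / 2)
  have e1 : (1 : ℂ) - (1 + μ) / 2 = (1 - μ) / 2 := by ring
  have e2 : (Real.pi : ℂ) * ((1 + μ) / 2) = Real.pi * μ / 2 + Real.pi / 2 := by ring
  have e3 : (2 * μ + 3 - (1 : ℤ)) / 4 = (1 + μ) / 2 := by push_cast; ring
  rw [e1, e2, Complex.sin_add_pi_div_two] at h
  rw [e3]
  have hG : Complex.Gamma ((1 + μ) / 2) ≠ 0 := Complex.Gamma_ne_zero_of_re_pos (by
    simp only [Complex.div_ofNat_re, Complex.add_re, Complex.one_re]; linarith)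
  have hG' : Complex.Gamma ((1 - μ) / 2) ≠ 0 := Complex.Gamma_ne_zero_of_re_pos (by
    simp only [Complex.div_ofNat_re, Complex.sub_re, Complex.one_re]; linarith)
  have hc : Complex.cos (Real.pi * μ / 2) ≠ 0 := by
    intro hc
    rw [hc, div_zero] at h
    exact mul_ne_zero hG hG' h
  rw [eq_div_iff hc] at h
  rw [eq_mul_inv_iff_mul_eq₀ hG]
  linear_combination h

/-- The reflection formula in the form which compares the coefficient of the combination of
`(∓i P) ^ μ` with the normalizing factor of `ψ_{μ,-1}`. -/
theorem Gamma_mul_sin {μ : ℂ} (h0 : 0 < μ.re) (h1 : μ.re < 1) :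
    Complex.Gamma (1 - μ / 2) * Complex.sin (Real.pi * μ / 2) =
      Real.pi * μ / 2 * (Complex.Gamma ((2 * μ + 3 - (-1 : ℤ)) / 4))⁻¹ := by
  have h := Complex.Gamma_mul_Gamma_one_sub (μ / 2)
  have e2 : (Real.pi : ℂ) * (μ / 2) = Real.pi * μ / 2 := by ring
  have e3 : (2 * μ + 3 - (-1 : ℤ)) / 4 = μ / 2 + 1 := by push_cast; ring
  have hμ : μ / 2 ≠ 0 := by
    intro h
    have := congrArg Complex.re h
    simp at this
    linarith
  rw [e2] at h
  rw [e3, Complex.Gamma_add_one _ hμ]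
  have hG : Complex.Gamma (μ / 2) ≠ 0 := Complex.Gamma_ne_zero_of_re_pos (by
    simp only [Complex.div_ofNat_re]; linarith)
  have hG' : Complex.Gamma (1 - μ / 2) ≠ 0 := Complex.Gamma_ne_zero_of_re_pos (by
    simp only [Complex.div_ofNat_re, Complex.sub_re, Complex.one_re]; linarith)
  have hc : Complex.sin (Real.pi * μ / 2) ≠ 0 := by
    intro hc
    rw [hc, div_zero] at h
    exact mul_ne_zero hG hG' h
  rw [eq_div_iff hc] at h
  rw [eq_mul_inv_iff_mul_eq₀ (mul_ne_zero hμ hG)]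
  linear_combination μ / 2 * h

variable {p q m : ℕ}

theorem continuous_quadP : Continuous (quadP : Flat p q → ℝ) := by
  unfold quadP
  fun_prop

theorem continuous_posPart (s : ℝ) :
    Continuous fun x : Flat p q => ((max (s * quadP x) 0 : ℝ) : ℂ) :=
  Complex.continuous_ofReal.comp ((continuous_const.mul continuous_quadP).max continuous_const)

theorem re_posPart (s : ℝ) (x : Flat p q) : 0 ≤ ((max (s * quadP x) 0 : ℝ) : ℂ).re := by
  rw [Complex.ofReal_re]
  exact le_max_right _ _

/-- The integral of the positive part (`s = 1`) or negative part (`s = -1`) of `P` to the power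
`μ`. -/
def partInt (s : ℝ) (φ : CcInfty p q) (μ : ℂ) : ℂ :=
  powInt (fun x : Flat p q => ((max (s * quadP x) 0 : ℝ) : ℂ)) μ φ

theorem differentiableOn_partInt (s : ℝ) (φ : CcInfty p q) :
    DifferentiableOn ℂ (partInt s φ) {μ | 0 < μ.re} :=
  differentiableOn_powInt (continuous_posPart s) (re_posPart s) φ

theorem integrable_posPart (s : ℝ) (φ : CcInfty p q) {μ : ℂ} (hμ : 0 < μ.re) :
    Integrable fun x : Flat p q => ((max (s * quadP x) 0 : ℝ) : ℂ) ^ μ * φ x :=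
  integrable_mul_tst (continuous_cpow_comp (continuous_posPart s) (re_posPart s) hμ) φ

theorem powInt_smul_signJ {c μ : ℂ} (hc : c ≠ 0) (hμ : 0 < μ.re) (φ : CcInfty p q) :
    powInt (qform (c • signJ p q)) μ φ =
      c ^ μ * partInt 1 φ μ + (-c) ^ μ * partInt (-1) φ μ := by
  have hμ0 : μ ≠ 0 := by rintro rfl; simp at hμ
  unfold partInt powInt
  rw [← integral_const_mul, ← integral_const_mul,
    ← integral_add ((integrable_posPart 1 φ hμ).const_mul _)
      ((integrable_posPart (-1) φ hμ).const_mul _)]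
  refine integral_congr_ae (Eventually.of_forall fun x => ?_)
  simp only [qform_smul_signJ, mul_ofReal_cpow hc hμ0, one_mul, neg_one_mul]
  ring

theorem integral_psiFun {ε : ℤ} (hε : ε = 1 ∨ ε = -1) {μ : ℂ} (hμ : 0 < μ.re)
    (φ : CcInftyReal p q) :
    ∫ x : Flat p q, psiFun μ ε (quadP x) * (φ x : ℂ) =
      (Complex.Gamma ((2 * μ + 3 - ε) / 4))⁻¹ *
        (partInt 1 (ofRealT φ) μ + ε * partInt (-1) (ofRealT φ) μ) := by
  have hμ0 : μ ≠ 0 := by rintro rfl; simp at hμ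
  unfold partInt powInt
  rw [← integral_const_mul, ← integral_add (integrable_posPart 1 _ hμ)
      ((integrable_posPart (-1) _ hμ).const_mul _), ← integral_const_mul]
  refine integral_congr_ae (Eventually.of_forall fun x => ?_)
  simp only [psiFun_eq hε hμ0, one_mul, neg_one_mul, ofRealT_apply]
  ring

/-- The factor relating the Knapp–Stein kernel to the regularized powers. -/
def ksConst (m : ℕ) (ε : ℤ) : ℂ :=
  Complex.Gamma ((1 + 2 * m + ε) / 4) / (2 * Real.pi) * (if ε = 1 then 1 else -Complex.I)

theorem differentiableOn_integral_psiFun {ε : ℤ} (hε : ε = 1 ∨ ε = -1) (φ : CcInftyReal p q) :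
    DifferentiableOn ℂ (fun μ : ℂ => ∫ x : Flat p q, psiFun μ ε (quadP x) * (φ x : ℂ))
      {μ | 0 < μ.re} := by
  have h1 : Differentiable ℂ fun μ : ℂ => (Complex.Gamma ((2 * μ + 3 - ε) / 4))⁻¹ :=
    Complex.differentiable_one_div_Gamma.comp (by fun_prop)
  refine (h1.differentiableOn.mul ((differentiableOn_partInt 1 (ofRealT φ)).add
    ((differentiableOn_partInt (-1) (ofRealT φ)).const_mul (ε : ℂ)))).congr fun μ hμ => ?_
  exact integral_psiFun hε hμ φ

theorem differentiableAt_Gamma_comp {f : ℂ → ℂ} {μ : ℂ} (hf : DifferentiableAt ℂ f μ)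
    (h : 0 < (f μ).re) : DifferentiableAt ℂ (fun μ => Complex.Gamma (f μ)) μ := by
  refine DifferentiableAt.comp μ (g := Complex.Gamma) (Complex.differentiableAt_Gamma _ ?_) hf
  intro k hk
  have : (0 : ℝ) ≤ k := k.cast_nonneg
  rw [hk] at h
  simp at h
  linarith

/-- The analytic continuation of `∫ ψ_{μ,ε}(P) φ`, and its value at `-m`. -/
theorem exists_psi_continuation (hm : (p - 1) + (q - 1) = 2 * (m + 1)) (hm1 : 1 ≤ m) {ε : ℤ}
    (hε : ε = 1 ∨ ε = -1) (φ : CcInftyReal p q) :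
    ∃ F : ℂ → ℂ, DifferentiableOn ℂ F {μ | -(m : ℝ) - 1 < μ.re} ∧
      (∀ μ : ℂ, 0 < μ.re → F μ = ∫ x : Flat p q, psiFun μ ε (quadP x) * (φ x : ℂ)) ∧
      F (-(m : ℂ)) = ksConst m ε * (regP p q m (-Complex.I) (ofRealT φ) +
        ε * regP p q m Complex.I (ofRealT φ)) := by
  have hmpos : (1 : ℝ) ≤ m := by exact_mod_cast hm1
  obtain ⟨V₁, hV₁, hpow₁, hreg₁, hzero₁⟩ := exists_continuation (card_idx hm)
    (isSymm_smul_signJ (-Complex.I)) (isUnit_det_smul_signJ (by simp))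
    (re_qform_smul_signJ (by simp)) (ofRealT φ)
  obtain ⟨V₂, hV₂, hpow₂, hreg₂, hzero₂⟩ := exists_continuation (card_idx hm)
    (isSymm_smul_signJ Complex.I) (isUnit_det_smul_signJ (by simp))
    (re_qform_smul_signJ (by simp)) (ofRealT φ)
  have hmono : {μ : ℂ | -(m : ℝ) - 1 < μ.re ∧ μ.re < 1} ⊆ {μ | -(m : ℝ) - 1 < μ.re} :=
    fun μ hμ => hμ.1
  have hI : (-Complex.I) ≠ 0 := by simp
  have hre : (-(m : ℂ)).re ≤ 0 := by simp
  rcases hε with rfl | rfl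
  · have hG : DifferentiableOn ℂ
        (fun μ => Complex.Gamma ((1 - μ) / 2) / (2 * Real.pi) * (V₁ μ + V₂ μ))
        {μ | -(m : ℝ) - 1 < μ.re ∧ μ.re < 1} := by
      refine DifferentiableOn.mul (fun μ hμ => ?_) ((hV₁.mono hmono).add (hV₂.mono hmono))
      refine ((differentiableAt_Gamma_comp (by fun_prop) ?_).div_const _).differentiableWithinAt
      have := hμ.2
      simp only [Complex.div_ofNat_re, Complex.sub_re, Complex.one_re]
      linarith
    have hGH : ∀ μ : ℂ, 0 < μ.re → μ.re < 1 →
        Complex.Gamma ((1 - μ) / 2) / (2 * Real.pi) * (V₁ μ + V₂ μ) =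
        ∫ x : Flat p q, psiFun μ 1 (quadP x) * (φ x : ℂ) := by
      intro μ h0 h1
      rw [integral_psiFun (Or.inl rfl) h0, hpow₁ μ h0, hpow₂ μ h0, powInt_smul_signJ hI h0,
        powInt_smul_signJ Complex.I_ne_zero h0, neg_neg]
      have h2 := Gamma_mul_cos h0 h1
      have h3 := I_cpow_add μ
      have hpi : (Real.pi : ℂ) ≠ 0 := by exact_mod_cast Real.pi_ne_zero
      rw [div_mul_eq_mul_div, div_eq_iff (by simp [hpi])]
      push_cast at h2 ⊢
      linear_combination (Complex.Gamma ((1 - μ) / 2) *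
          (partInt 1 (ofRealT φ) μ + partInt (-1) (ofRealT φ) μ)) * h3 +
        2 * (partInt 1 (ofRealT φ) μ + partInt (-1) (ofRealT φ) μ) * h2
    -- The integral is holomorphic on `Re μ > 0` and the combination of `V₁` and `V₂` on `Re μ < 1`.
    obtain ⟨F, hF, hFH, hFG⟩ := exists_differentiableOn_glue hG
      (differentiableOn_integral_psiFun (Or.inl rfl) φ) hGH
    refine ⟨F, hF, hFH, ?_⟩
    rw [hFG _ hre, hreg₁, hreg₂, ksConst, regP, regP]
    simp only [if_pos, mul_one, Int.cast_one, one_mul]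
    congr 3
    ring
  -- The coefficient `Γ(-μ/2)` has a pole at `μ = 0`, which is cancelled since `V₁ 0 = V₂ 0`; the
  -- quotient `(V₁ - V₂) / μ` is made holomorphic as a `dslope`.
  · have h00 : {μ : ℂ | -(m : ℝ) - 1 < μ.re} ∈ 𝓝 (0 : ℂ) :=
      (isOpen_re_gt _).mem_nhds (by simp only [mem_ofPred_eq, Complex.zero_re]; linarith)
    have hds := (Complex.differentiableOn_dslope h00).2 (hV₁.sub hV₂)
    have hslope : ∀ μ : ℂ, μ ≠ 0 → dslope (V₁ - V₂) 0 μ = (V₁ μ - V₂ μ) / μ := by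
      intro μ hμ
      rw [dslope_of_ne _ hμ, slope_def_field]
      simp only [Pi.sub_apply, hzero₁, hzero₂, sub_self, sub_zero]
    have hG : DifferentiableOn ℂ
        (fun μ => Complex.I / Real.pi * Complex.Gamma (1 - μ / 2) * dslope (V₁ - V₂) 0 μ)
        {μ | -(m : ℝ) - 1 < μ.re ∧ μ.re < 1} := by
      refine DifferentiableOn.mul (fun μ hμ => ?_) (hds.mono hmono)
      refine ((differentiableAt_Gamma_comp (by fun_prop) ?_).const_mul _).differentiableWithinAt
      have := hμ.2
      simp only [Complex.div_ofNat_re, Complex.sub_re, Complex.one_re]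
      linarith
    have hGH : ∀ μ : ℂ, 0 < μ.re → μ.re < 1 →
        Complex.I / Real.pi * Complex.Gamma (1 - μ / 2) * dslope (V₁ - V₂) 0 μ =
        ∫ x : Flat p q, psiFun μ (-1) (quadP x) * (φ x : ℂ) := by
      intro μ h0 h1
      have hμ0 : μ ≠ 0 := by rintro rfl; simp at h0
      rw [hslope μ hμ0, integral_psiFun (Or.inr rfl) h0, hpow₁ μ h0, hpow₂ μ h0,
        powInt_smul_signJ hI h0, powInt_smul_signJ Complex.I_ne_zero h0, neg_neg]
      have h2 := Gamma_mul_sin h0 h1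
      have h3 := I_cpow_sub μ
      have hpi : (Real.pi : ℂ) ≠ 0 := by exact_mod_cast Real.pi_ne_zero
      rw [mul_div_assoc', div_eq_iff hμ0, div_mul_eq_mul_div, div_mul_eq_mul_div, div_eq_iff hpi]
      push_cast at h2 ⊢
      linear_combination (Complex.I * Complex.Gamma (1 - μ / 2) *
          (partInt 1 (ofRealT φ) μ - partInt (-1) (ofRealT φ) μ)) * h3 +
        2 * (partInt 1 (ofRealT φ) μ - partInt (-1) (ofRealT φ) μ) * h2 -
        2 * Complex.Gamma (1 - μ / 2) * Complex.sin (Real.pi * μ / 2) *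
          (partInt 1 (ofRealT φ) μ - partInt (-1) (ofRealT φ) μ) * Complex.I_sq
    obtain ⟨F, hF, hFH, hFG⟩ := exists_differentiableOn_glue hG
      (differentiableOn_integral_psiFun (Or.inr rfl) φ) hGH
    refine ⟨F, hF, hFH, ?_⟩
    have hmC : (m : ℂ) ≠ 0 := by exact_mod_cast (by omega : m ≠ 0)
    rw [hFG _ hre, hslope _ (neg_ne_zero.2 hmC), hreg₁, hreg₂, ksConst, ← regP, ← regP]
    have e1 : (1 : ℂ) - -(m : ℂ) / 2 = (m : ℂ) / 2 + 1 := by ring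
    have e2 : (1 + 2 * (m : ℂ) + ((-1 : ℤ) : ℂ)) / 4 = (m : ℂ) / 2 := by push_cast; ring
    rw [e1, e2, Complex.Gamma_add_one _ (div_ne_zero hmC two_ne_zero), if_neg (by norm_num)]
    push_cast
    field_simp
    ring

theorem dimN_eq (hp : 1 ≤ p) (hq : 1 ≤ q) (hm : (p - 1) + (q - 1) = 2 * (m + 1)) :
    dimN p q = 2 * m + 2 := by
  have h : p + q = 2 * m + 4 := by omega
  have : (p : ℝ) + q = 2 * m + 4 := by exact_mod_cast h
  rw [dimN]
  linarith

theorem IsKnappSteinKernel.unique {ν : ℂ} {ε : ℤ} {T T' : Distr p q}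
    (h : IsKnappSteinKernel ν ε T) (h' : IsKnappSteinKernel ν ε T') : T = T' := by
  refine DFunLike.ext _ _ fun φ => ?_
  obtain ⟨F, hF, hFi, hT⟩ := h.2 φ
  obtain ⟨F', hF', hFi', hT'⟩ := h'.2 φ
  rw [hT, hT']
  exact eqOn_re_gt_of_eqOn (f := F) (g := F') (b := 0) hF hF'
    (fun μ hμ => (hFi μ hμ).trans (hFi' μ hμ).symm) ν h.1

theorem IsKnappSteinKernel.knappSteinKernel_eq {ν : ℂ} {ε : ℤ} {T : Distr p q}
    (h : IsKnappSteinKernel ν ε T) : knappSteinKernel p q ν ε = T := by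
  have hex : ∃ T : Distr p q, IsKnappSteinKernel ν ε T := ⟨T, h⟩
  rw [knappSteinKernel, dif_pos hex]
  exact hex.choose_spec.unique h

/-- The regularized power `(c P) ^ (-m)` for an imaginary number `c`, as a distribution. -/
def regPDistr (p q m : ℕ) (c : ℂ) (hc : c.re = 0) : Distr p q :=
  regDistr (c • signJ p q) (c • signJ p q)⁻¹ (re_qform_smul_signJ hc) m

theorem isKnappSteinKernel_regPDistr (hp : 1 ≤ p) (hq : 1 ≤ q)
    (hm : (p - 1) + (q - 1) = 2 * (m + 1)) (hm1 : 1 ≤ m) {ε : ℤ} (hε : ε = 1 ∨ ε = -1) :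
    IsKnappSteinKernel (-(m : ℂ)) ε (cmul (ksConst m ε)
      (regPDistr p q m (-Complex.I) (by simp) +
        cmul (ε : ℂ) (regPDistr p q m Complex.I Complex.I_re))) := by
  have hd : -(dimN p q) / 2 = -(m : ℝ) - 1 := by rw [dimN_eq hp hq hm]; ring
  refine ⟨by rw [hd]; simp, fun φ => ?_⟩
  rw [hd]
  obtain ⟨F, hF, hFi, hFv⟩ := exists_psi_continuation hm hm1 hε φ
  exact ⟨F, hF, hFi, hFv.symm⟩

end

section

/-! ### The Green function and the constants -/

variable {p q m : ℕ}

theorem signEps_eq (p q : ℕ) : signEps p q = 1 ∨ signEps p q = -1 := by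
  unfold signEps
  exact neg_one_pow_eq_or ℤ _

theorem one_sub_dimN_div_two (hp : 1 ≤ p) (hq : 1 ≤ q) (hm : (p - 1) + (q - 1) = 2 * (m + 1)) :
    (1 : ℂ) - (dimN p q : ℂ) / 2 = -(m : ℂ) := by
  rw [dimN_eq hp hq hm]
  push_cast
  ring

theorem I_pow_eq_signs (hp : 1 ≤ p) (hq : 1 ≤ q) (hm : (p - 1) + (q - 1) = 2 * (m + 1)) :
    Complex.I ^ (q - 1) * (Complex.I ^ m)⁻¹ =
      (signDelta p q : ℂ) * (if signEps p q = 1 then 1 else -Complex.I) * Complex.I := by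
  obtain ⟨k, hk⟩ : ∃ k : ℤ, (p : ℤ) - q = 2 * k := ⟨(m : ℤ) + 2 - q, by omega⟩
  have h1 : Complex.I ^ (q - 1) * (Complex.I ^ m)⁻¹ = Complex.I ^ (1 - k) := by
    rw [← zpow_natCast, ← zpow_natCast, ← zpow_neg, ← zpow_add₀ Complex.I_ne_zero]
    congr 1
    omega
  have h4 : Complex.I ^ (4 : ℤ) = 1 := by
    have := Complex.I_pow_four
    exact_mod_cast this
  have hε : signEps p q = if k % 2 = 0 then 1 else -1 := by
    unfold signEps
    have : ((p : ℤ) - q) / 2 = k := by omega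
    rw [this]
    split_ifs with h
    · exact Even.neg_one_pow (Int.natAbs_even.2 (Int.even_iff.2 h))
    · exact Odd.neg_one_pow (Int.natAbs_odd.2 (Int.odd_iff.2 (by omega)))
  have hδ : signDelta p q = if k % 4 = 0 ∨ k % 4 = 1 then 1 else -1 := by
    unfold signDelta
    rw [hk]
    have : (2 * k % 8 = 0 ∨ 2 * k % 8 = 2) ↔ (k % 4 = 0 ∨ k % 4 = 1) := by omega
    simp only [this]
  rw [h1, hε, hδ]
  obtain ⟨t, r, hr, hkr⟩ : ∃ t r : ℤ, (r = 0 ∨ r = 1 ∨ r = 2 ∨ r = 3) ∧ k = 4 * t + r :=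
    ⟨k / 4, k % 4, by omega, by omega⟩
  have h5 : Complex.I ^ (1 - k) = Complex.I ^ (1 - r) := by
    rw [hkr, show 1 - (4 * t + r) = (1 - r) + 4 * (-t) by ring, zpow_add₀ Complex.I_ne_zero,
      zpow_mul, h4, one_zpow, mul_one]
  rw [h5]
  have h2 : k % 2 = r % 2 := by omega
  have h3 : k % 4 = r := by omega
  rw [h2, h3]
  rcases hr with rfl | rfl | rfl | rfl
  · simp
  · simp
  · simp
  · have : Complex.I ^ (1 - 3 : ℤ) = -1 := by
      rw [show (1 - 3 : ℤ) = -(2 : ℕ) by norm_num, zpow_neg, zpow_natCast, Complex.I_sq]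
      norm_num
    rw [this]
    norm_num

/-- The factor relating the Green function to the regularized powers. -/
def greenConst (q m : ℕ) : ℂ :=
  (Real.Gamma m / (4 * Real.pi ^ (m + 1)) : ℝ) / (2 * Real.pi * Complex.I) *
    (Complex.I ^ (q - 1) * (Complex.I ^ m)⁻¹)

theorem constC₂_mul_greenConst (hp : 1 ≤ p) (hq : 1 ≤ q) (hm : (p - 1) + (q - 1) = 2 * (m + 1))
    (hm1 : 1 ≤ m) : (constC₂ p q : ℂ) * greenConst q m = ksConst m (signEps p q) := by
  have hmpos : (0 : ℝ) < m := by exact_mod_cast hm1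
  have hG : Real.Gamma m ≠ 0 := (Real.Gamma_pos_of_pos hmpos).ne'
  have hpi := Real.pi_ne_zero
  have hδ : (signDelta p q : ℂ) * signDelta p q = 1 := by
    unfold signDelta
    split_ifs <;> norm_num
  have e1 : constC₂ p q = signDelta p q * (4 * Real.pi ^ (m + 1)) / Real.Gamma m *
      Real.Gamma ((1 + 2 * m + signEps p q) / 4) := by
    unfold constC₂
    have a1 : dimN p q / 2 = ((m + 1 : ℕ) : ℝ) := by
      rw [dimN_eq hp hq hm]; push_cast; ring
    have a2 : -1 + dimN p q + (signEps p q : ℝ) = 1 + 2 * m + signEps p q := by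
      rw [dimN_eq hp hq hm]; ring
    rw [a2, a1, Real.rpow_natCast]
    have a3 : ((m + 1 : ℕ) : ℝ) - 1 = m := by push_cast; ring
    rw [a3]
    ring
  have e2 : Complex.Gamma ((1 + 2 * m + (signEps p q : ℂ)) / 4) =
      (Real.Gamma ((1 + 2 * m + signEps p q) / 4) : ℝ) := by
    rw [← Complex.Gamma_ofReal]
    push_cast
    rfl
  rw [greenConst, I_pow_eq_signs hp hq hm, ksConst, e1, e2]
  have hGc : (Real.Gamma m : ℂ) ≠ 0 := by exact_mod_cast hG
  have hpic : (Real.pi : ℂ) ≠ 0 := by exact_mod_cast hpi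
  push_cast
  field_simp
  linear_combination (Real.Gamma ((1 + 2 * m + signEps p q) / 4) *
    (if signEps p q = 1 then 1 else -Complex.I)) * hδ

theorem cmul_apply (c : ℂ) (T : Distr p q) (φ : CcInftyReal p q) : cmul c T φ = c * T φ := rfl

/-- The sum of the two conjugate regularized powers which is proportional to both kernels. -/
def regSum (p q m : ℕ) : Distr p q :=
  regPDistr p q m (-Complex.I) (by simp) +
    cmul (signEps p q : ℂ) (regPDistr p q m Complex.I Complex.I_re)

theorem regSum_apply (φ : CcInftyReal p q) : regSum p q m φ =
    regP p q m (-Complex.I) (ofRealT φ) + signEps p q * regP p q m Complex.I (ofRealT φ) := rfl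

theorem fundE_apply (hp : 1 ≤ p) (hq : 1 ≤ q) (hm : (p - 1) + (q - 1) = 2 * (m + 1))
    (φ : CcInftyReal p q) :
    fundE p q φ = -((Real.Gamma m / (4 * Real.pi ^ (m + 1)) : ℝ) *
      (Complex.I ^ (q - 1) * (Complex.I ^ m)⁻¹)) * regP p q m (-Complex.I) (ofRealT φ) := by
  have e1 := (isQuadPAddIZeroPow_regDistr hm).quadPAddIZeroPow_eq
  rw [fundE, one_sub_dimN_div_two hp hq hm, e1, cmul_apply, cmul_apply, regDistr_apply, ← regP]
  have e2 : (dimN p q : ℂ) / 2 = ((m + 1 : ℕ) : ℂ) := by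
    rw [dimN_eq hp hq hm]; push_cast; ring
  have e3 : Complex.exp (Complex.I * Real.pi * ((q : ℂ) - 1) / 2) = Complex.I ^ (q - 1) := by
    rw [← Complex.cpow_natCast, I_cpow]
    congr 1
    push_cast [hq]
    ring
  have e4 : ((m + 1 : ℕ) : ℂ) - 1 = ((m : ℝ) : ℂ) := by push_cast; ring
  rw [e2, e3, Complex.cpow_natCast, e4, Complex.Gamma_ofReal]
  push_cast
  ring

/-- The kernel `E₀` is a multiple of the combination which also gives the Knapp–Stein kernel:
complex conjugation exchanges the two regularized powers and multiplies `i ^ (q-1) i ^ (-m)` by `-ε`. -/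
theorem greenE₀_eq (hp : 1 ≤ p) (hq : 1 ≤ q) (hm : (p - 1) + (q - 1) = 2 * (m + 1)) :
    greenE₀ p q = cmul (greenConst q m) (regSum p q m) := by
  refine DFunLike.ext _ _ fun φ => ?_
  have e1 : greenE₀ p q φ = 1 / (2 * Real.pi * Complex.I) *
      (-fundE p q φ + (starRingEnd ℂ) (fundE p q φ)) := rfl
  have hu := I_pow_eq_signs hp hq hm
  have hconj : (starRingEnd ℂ) (Complex.I ^ (q - 1) * (Complex.I ^ m)⁻¹) =
      -signEps p q * (Complex.I ^ (q - 1) * (Complex.I ^ m)⁻¹) := by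
    rw [hu]
    rcases signEps_eq p q with h | h <;> simp [h]
  rw [e1, cmul_apply, regSum_apply, fundE_apply hp hq hm, map_mul, map_neg, map_mul,
    Complex.conj_ofReal, ← regP_conj hm, hconj, greenConst]
  ring

/-- The complex test function `x ↦ φ (y - x)`. -/
def reflT (φ : CcInfty p q) (y : Flat p q) : CcInfty p q where
  toFun x := φ (y - x)
  contDiff' := φ.contDiff.comp (contDiff_const.sub contDiff_id)
  hasCompactSupport' := φ.hasCompactSupport.comp_homeomorph (Homeomorph.subLeft y)
  tsupport_subset' := fun _ _ => trivial

@[simp]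
theorem reflT_apply (φ : CcInfty p q) (y x : Flat p q) : reflT φ y x = φ (y - x) := rfl

theorem conv_regPDistr (c : ℂ) (hc : c.re = 0) (φ : CcInfty p q) (y : Flat p q) :
    conv (regPDistr p q m c hc) φ y = regP p q m c (reflT φ y) := by
  have h : reflT φ y = ofRealT (reflectTranslate Complex.reCLM φ y) +
      Complex.I • ofRealT (reflectTranslate Complex.imCLM φ y) := by
    ext x
    have : φ (y - x) = ((φ (y - x)).re : ℂ) + Complex.I * ((φ (y - x)).im : ℂ) := by
      rw [mul_comm, Complex.re_add_im]
    exact this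
  rw [h, regP, regVal_add _ (re_qform_smul_signJ hc), regVal_smul _ (re_qform_smul_signJ hc)]
  rfl

theorem conv_cmul (c : ℂ) (T : Distr p q) (φ : CcInfty p q) (y : Flat p q) :
    conv (cmul c T) φ y = c * conv T φ y := by
  simp only [conv, cmul_apply]
  ring

theorem conv_add (T T' : Distr p q) (φ : CcInfty p q) (y : Flat p q) :
    conv (T + T') φ y = conv T φ y + conv T' φ y := by
  have h : ∀ ψ, (T + T') ψ = T ψ + T' ψ := fun _ => rfl
  simp only [conv, h]
  ring

theorem opS_eq (hp : 1 ≤ p) (hq : 1 ≤ q) (hm : (p - 1) + (q - 1) = 2 * (m + 1)) (φ : CcInfty p q)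
    (y : Flat p q) : opS p q φ y = greenConst q m * (regP p q m (-Complex.I) (reflT φ y) +
      signEps p q * regP p q m Complex.I (reflT φ y)) := by
  rw [opS, greenE₀_eq hp hq hm, conv_cmul, regSum, conv_add, conv_cmul, conv_regPDistr,
    conv_regPDistr]

end

section

/-! ### The fundamental solution of a complex diagonal Laplacian -/

theorem integrableOn_pow_mul_exp (k : ℕ) {r : ℝ} (hr : 0 < r) :
    IntegrableOn (fun s : ℝ => s ^ k * Real.exp (-(s * r))) (Ioi 0) := by
  have h := integrableOn_rpow_mul_exp_neg_mul_rpow (p := 1) (s := k) (b := r)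
    (by have : (0 : ℝ) ≤ k := k.cast_nonneg
        linarith) one_pos hr
  refine h.congr_fun (fun s _ => ?_) measurableSet_Ioi
  simp only [Real.rpow_natCast, Real.rpow_one]
  ring_nf

theorem norm_pow_mul_cexp (k : ℕ) (w : ℂ) {s : ℝ} (hs : 0 ≤ s) :
    ‖(s : ℂ) ^ k * Complex.exp (-(s * w))‖ = s ^ k * Real.exp (-(s * w.re)) := by
  rw [norm_mul, norm_pow, Complex.norm_real, Real.norm_of_nonneg hs, Complex.norm_exp,
    Complex.neg_re, Complex.re_ofReal_mul]

theorem integrableOn_pow_mul_cexp (k : ℕ) {w : ℂ} (hw : 0 < w.re) :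
    IntegrableOn (fun s : ℝ => (s : ℂ) ^ k * Complex.exp (-(s * w))) (Ioi 0) := by
  refine (integrableOn_pow_mul_exp k hw).mono' ?_ ?_
  · have : Continuous fun s : ℝ => (s : ℂ) ^ k * Complex.exp (-(s * w)) := by fun_prop
    exact this.aestronglyMeasurable
  · filter_upwards [ae_restrict_mem measurableSet_Ioi] with s hs
    rw [norm_pow_mul_cexp k w (le_of_lt hs)]

theorem integral_pow_mul_cexp (k : ℕ) {w : ℂ} (hw : 0 < w.re) :
    ∫ s : ℝ in Ioi 0, (s : ℂ) ^ k * Complex.exp (-(s * w)) = k.factorial / w ^ (k + 1) := by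
  have hw0 : w ≠ 0 := by rintro rfl; simp at hw
  have hexp : ∀ s : ℝ, HasDerivAt (fun s : ℝ => Complex.exp (-(s * w)))
      (-w * Complex.exp (-(s * w))) s := by
    intro s
    have h1 : HasDerivAt (fun s : ℝ => -((s : ℂ) * w)) (-(1 * w)) s :=
      ((HasDerivAt.ofReal_comp (hasDerivAt_id s)).mul_const w).neg
    convert h1.cexp using 1
    ring
  have hlim : ∀ k : ℕ, Tendsto (fun s : ℝ => (s : ℂ) ^ k * Complex.exp (-(s * w))) atTop (𝓝 0) := by
    intro k
    rw [tendsto_zero_iff_norm_tendsto_zero]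
    refine (tendsto_rpow_mul_exp_neg_mul_atTop_nhds_zero k w.re hw).congr' ?_
    filter_upwards [eventually_ge_atTop 0] with s hs
    rw [norm_pow_mul_cexp k w hs, Real.rpow_natCast]
    ring_nf
  induction k with
  | zero =>
    have h := integral_Ioi_of_hasDerivAt_of_tendsto (f := fun s : ℝ => Complex.exp (-(s * w)))
      (hexp 0).continuousAt.continuousWithinAt (fun s _ => hexp s)
      (by simpa [IntegrableOn] using (integrableOn_pow_mul_cexp 0 hw).const_mul (-w))
      (by simpa using hlim 0)
    rw [integral_const_mul] at h
    simp only [Complex.ofReal_zero, zero_mul, neg_zero, Complex.exp_zero, zero_sub] at h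
    simp only [pow_zero, one_mul, Nat.factorial_zero, Nat.cast_one, zero_add, pow_one]
    rw [eq_div_iff hw0]
    linear_combination -h
  | succ k ih =>
    have hd : ∀ s : ℝ, HasDerivAt (fun s : ℝ => (s : ℂ) ^ (k + 1) * Complex.exp (-(s * w)))
        ((k + 1) * ((s : ℂ) ^ k * Complex.exp (-(s * w))) -
          w * ((s : ℂ) ^ (k + 1) * Complex.exp (-(s * w)))) s := by
      intro s
      have h1 : HasDerivAt (fun s : ℝ => (s : ℂ) ^ (k + 1)) (((k + 1 : ℕ) : ℂ) * (s : ℂ) ^ k * 1) s :=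
        (HasDerivAt.ofReal_comp (hasDerivAt_id s)).pow (k + 1)
      refine (h1.fun_mul (hexp s)).congr_deriv ?_
      push_cast
      ring
    have i1 := (integrableOn_pow_mul_cexp k hw).const_mul (k + 1 : ℂ)
    have i2 := (integrableOn_pow_mul_cexp (k + 1) hw).const_mul w
    have h := integral_Ioi_of_hasDerivAt_of_tendsto
      (f := fun s : ℝ => (s : ℂ) ^ (k + 1) * Complex.exp (-(s * w)))
      (hd 0).continuousAt.continuousWithinAt (fun s _ => hd s) (i1.sub i2) (hlim (k + 1))
    rw [integral_sub i1 i2, integral_const_mul, integral_const_mul, ih] at h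
    simp only [Complex.ofReal_zero, ne_eq, Nat.add_eq_zero_iff, one_ne_zero, and_false,
      not_false_eq_true, zero_pow, zero_mul, sub_zero] at h
    have h2 : (k.factorial : ℂ) / w ^ (k + 1) * w ^ (k + 1) = k.factorial :=
      div_mul_cancel₀ _ (pow_ne_zero _ hw0)
    rw [Nat.factorial_succ, eq_div_iff (pow_ne_zero _ hw0)]
    push_cast
    linear_combination (k + 1 : ℂ) * h2 - w ^ (k + 1) * h

variable {ι : Type*} [Fintype ι] [DecidableEq ι]

theorem boxT_diagonal (b : ι → ℂ) (φ : Tst ι) :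
    boxT (Matrix.diagonal b) φ = ∑ i, (b i / 4) • pdT i (pdT i φ) := by
  rw [boxT_apply, Fintype.sum_prod_type]
  refine Finset.sum_congr rfl fun i _ => ?_
  rw [Finset.sum_eq_single i]
  · simp
  · intro j _ hj
    simp [Matrix.diagonal_apply_ne _ hj.symm]
  · simp

theorem pderiv_qform_diagonal (a : ι → ℂ) (i : ι) (x : EuclideanSpace ℝ ι) :
    pderiv i (qform (Matrix.diagonal a)) x = 2 * a i * (x i : ℂ) := by
  rw [pderiv_qform (Matrix.isSymm_diagonal a)]
  simp only
  rw [Finset.sum_eq_single i]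
  · simp
  · intro j _ hj
    simp [Matrix.diagonal_apply_ne _ hj.symm]
  · simp

theorem pderiv_cexp {f : EuclideanSpace ℝ ι → ℂ} {x : EuclideanSpace ℝ ι}
    (hf : DifferentiableAt ℝ f x) (i : ι) :
    pderiv i (fun x => Complex.exp (f x)) x = Complex.exp (f x) * pderiv i f x := by
  unfold pderiv
  rw [hf.hasFDerivAt.cexp.fderiv]
  rfl

omit [DecidableEq ι] in
theorem contDiff_cexp_qform (B : Matrix ι ι ℂ) (s : ℝ) :
    ContDiff ℝ ∞ fun x : EuclideanSpace ℝ ι => Complex.exp (-(s * qform B x)) :=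
  (contDiff_const.mul (contDiff_qform B)).neg.cexp

theorem pderiv_cexp_qform (a : ι → ℂ) (s : ℝ) (i : ι) (x : EuclideanSpace ℝ ι) :
    pderiv i (fun x => Complex.exp (-(s * qform (Matrix.diagonal a) x))) x =
      -(2 * s * a i) * ((x i : ℂ) * Complex.exp (-(s * qform (Matrix.diagonal a) x))) := by
  have hq : DifferentiableAt ℝ (qform (Matrix.diagonal a)) x :=
    (contDiff_qform _).differentiable (by simp) x
  have e : (fun x : EuclideanSpace ℝ ι => Complex.exp (-(s * qform (Matrix.diagonal a) x))) =
      fun x => Complex.exp ((-(s : ℂ)) * qform (Matrix.diagonal a) x) := by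
    simp only [neg_mul]
  rw [e, pderiv_cexp (hq.const_mul _), pderiv_const_mul hq, pderiv_qform_diagonal, neg_mul]
  ring

theorem integral_cexp_mul_pdT_pdT (a : ι → ℂ) (s : ℝ) (i : ι) (φ : Tst ι) :
    ∫ x, Complex.exp (-(s * qform (Matrix.diagonal a) x)) * pdT i (pdT i φ) x =
      ∫ x, (4 * s ^ 2 * a i ^ 2 * (x i : ℂ) ^ 2 - 2 * s * a i) *
        Complex.exp (-(s * qform (Matrix.diagonal a) x)) * φ x := by
  have hE := contDiff_cexp_qform (Matrix.diagonal a) s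
  have hd : ∀ x : EuclideanSpace ℝ ι, DifferentiableAt ℝ (fun x : EuclideanSpace ℝ ι => (x i : ℂ)) x :=
    fun x => (contDiff_coord i).differentiable (by simp) x
  have hg : ContDiff ℝ ∞ fun x : EuclideanSpace ℝ ι => -(2 * s * a i) *
      ((x i : ℂ) * Complex.exp (-(s * qform (Matrix.diagonal a) x))) :=
    contDiff_const.mul ((contDiff_coord i).mul hE)
  have e1 : pderiv i (fun x => Complex.exp (-(s * qform (Matrix.diagonal a) x))) = _ :=
    funext (pderiv_cexp_qform a s i)
  have e2 : pderiv i (fun x : EuclideanSpace ℝ ι => -(2 * s * a i) *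
      ((x i : ℂ) * Complex.exp (-(s * qform (Matrix.diagonal a) x)))) = fun x =>
      (4 * s ^ 2 * a i ^ 2 * (x i : ℂ) ^ 2 - 2 * s * a i) *
        Complex.exp (-(s * qform (Matrix.diagonal a) x)) := by
    funext x
    have hEx := hE.differentiable (by simp) x
    rw [pderiv_const_mul ((hd x).fun_mul hEx), pderiv_mul (hd x) hEx, pderiv_coord, if_pos rfl,
      pderiv_cexp_qform]
    ring
  rw [integral_mul_pdT (hE.differentiable (by simp)) i (contDiff_pderiv hE i).continuous, e1,
    ← integral_neg]
  have e3 : ∀ x, -(-(2 * s * a i) * ((x i : ℂ) * Complex.exp (-(s * qform (Matrix.diagonal a) x))) *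
      pdT i φ x) = -((-(2 * s * a i) * ((x i : ℂ) *
        Complex.exp (-(s * qform (Matrix.diagonal a) x)))) * pdT i φ x) := fun x => by ring
  rw [integral_neg, integral_mul_pdT (hg.differentiable (by simp)) i
    (contDiff_pderiv hg i).continuous, neg_neg, e2]

/-- The Gaussians are eigenfunctions of `boxT` up to multiplication by a polynomial. -/
theorem integral_cexp_mul_boxT {a : ι → ℂ} (ha : ∀ i, a i ≠ 0) (s : ℝ) (φ : Tst ι) :
    ∫ x, Complex.exp (-(s * qform (Matrix.diagonal a) x)) *
        boxT (Matrix.diagonal fun i => (a i)⁻¹) φ x =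
      ∫ x, (s ^ 2 * qform (Matrix.diagonal a) x - s * ((Fintype.card ι : ℂ) / 2)) *
        Complex.exp (-(s * qform (Matrix.diagonal a) x)) * φ x := by
  have hE := (contDiff_cexp_qform (Matrix.diagonal a) s).continuous
  rw [boxT_diagonal]
  simp only [tst_sum_apply, Finset.mul_sum]
  rw [integral_finsetSum]
  · have e1 : ∀ i, ∫ x, Complex.exp (-(s * qform (Matrix.diagonal a) x)) *
        (((a i)⁻¹ / 4) • pdT i (pdT i φ)) x = ∫ x, (a i)⁻¹ / 4 *
          ((4 * s ^ 2 * a i ^ 2 * (x i : ℂ) ^ 2 - 2 * s * a i) *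
        Complex.exp (-(s * qform (Matrix.diagonal a) x)) * φ x) := by
      intro i
      rw [integral_const_mul, ← integral_cexp_mul_pdT_pdT, ← integral_const_mul]
      refine integral_congr_ae (Eventually.of_forall fun x => ?_)
      simp
      ring
    simp only [e1]
    rw [← integral_finsetSum]
    · refine integral_congr_ae (Eventually.of_forall fun x => ?_)
      simp only [qform_diagonal, ← mul_assoc, ← Finset.sum_mul]
      congr 2
      rw [Finset.mul_sum]
      have : (s : ℂ) * ((Fintype.card ι : ℂ) / 2) = ∑ _i : ι, (s : ℂ) / 2 := by
        simp
        ring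
      rw [this, ← Finset.sum_sub_distrib]
      refine Finset.sum_congr rfl fun i _ => ?_
      have := ha i
      field_simp
      ring
    · intro i _
      refine (integrable_mul_tst ?_ φ).const_mul _
      exact ((continuous_const.mul ((contDiff_coord i).continuous.pow 2)).sub continuous_const).mul hE
  · intro i _
    exact integrable_mul_tst hE _

/-! #### The heat integrals -/

theorem exists_coercive_diagonal [Nonempty ι] {a : ι → ℂ} (ha : ∀ i, 0 < (a i).re) :
    ∃ c > 0, ∀ x : EuclideanSpace ℝ ι, c * ‖x‖ ^ 2 ≤ (qform (Matrix.diagonal a) x).re := by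
  obtain ⟨i, -, hi⟩ := Finset.exists_min_image Finset.univ (fun i => (a i).re) Finset.univ_nonempty
  refine ⟨(a i).re, ha i, fun x => ?_⟩
  rw [qform_diagonal, Complex.re_sum, EuclideanSpace.norm_sq_eq, Finset.mul_sum]
  refine Finset.sum_le_sum fun j _ => ?_
  rw [← Complex.ofReal_pow, mul_comm (a j), Complex.re_ofReal_mul, mul_comm, Real.norm_eq_abs, sq_abs]
  exact mul_le_mul_of_nonneg_left (hi j (Finset.mem_univ _)) (sq_nonneg _)

/-- `∫ exp (-s q) φ`. -/
def heatInt (q : EuclideanSpace ℝ ι → ℂ) (φ : Tst ι) (s : ℝ) : ℂ :=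
  ∫ x, Complex.exp (-(s * q x)) * φ x

omit [DecidableEq ι] in
theorem continuous_heatInt {q : EuclideanSpace ℝ ι → ℂ} (hq : Continuous q) (φ : Tst ι) :
    Continuous (heatInt q φ) := by
  rw [← continuousOn_univ]
  refine continuousOn_integral_of_compact_support (k := tsupport φ) φ.hasCompactSupport ?_ ?_
  · refine Continuous.continuousOn ?_
    have h1 : Continuous fun y : ℝ × EuclideanSpace ℝ ι => Complex.exp (-(y.1 * q y.2)) := by
      fun_prop
    exact h1.mul (φ.continuous.comp continuous_snd)
  · intro p x _ hx
    rw [image_eq_zero_of_notMem_tsupport hx, mul_zero]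

omit [DecidableEq ι] in
theorem norm_cexp_le_one {w : ℂ} (hw : 0 ≤ w.re) {s : ℝ} (hs : 0 ≤ s) :
    ‖Complex.exp (-(s * w))‖ ≤ 1 := by
  rw [Complex.norm_exp, Complex.neg_re, Complex.re_ofReal_mul, Real.exp_le_one_iff]
  have := mul_nonneg hs hw
  linarith

omit [DecidableEq ι] in
theorem hasDerivAt_heatInt {q : EuclideanSpace ℝ ι → ℂ} (hq : Continuous q)
    (hre : ∀ x, 0 ≤ (q x).re) (φ : Tst ι) {s : ℝ} (hs : 0 < s) :
    HasDerivAt (heatInt q φ) (-∫ x, q x * Complex.exp (-(s * q x)) * φ x) s := by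
  have hexp : ∀ (s : ℝ) (w : ℂ), HasDerivAt (fun s : ℝ => Complex.exp (-(s * w)))
      (-(w * Complex.exp (-(s * w)))) s := by
    intro s w
    have h1 : HasDerivAt (fun s : ℝ => -((s : ℂ) * w)) (-(1 * w)) s :=
      ((HasDerivAt.ofReal_comp (hasDerivAt_id s)).mul_const w).neg
    refine h1.cexp.congr_deriv ?_
    ring
  have hc : ∀ s : ℝ, Continuous fun x => Complex.exp (-(s * q x)) := fun s => by fun_prop
  have h := hasDerivAt_integral_of_dominated_loc_of_deriv_le (μ := volume) (𝕜 := ℝ)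
    (F := fun s x => Complex.exp (-(s * q x)) * φ x)
    (F' := fun s x => -(q x * Complex.exp (-(s * q x))) * φ x)
    (bound := fun x => ‖q x * φ x‖) (s := Ioi 0) (x₀ := s) (Ioi_mem_nhds hs)
    (Eventually.of_forall fun s => (integrable_mul_tst (hc s) φ).aestronglyMeasurable)
    (integrable_mul_tst (hc s) φ)
    (integrable_mul_tst ((hq.mul (hc s)).neg) φ).aestronglyMeasurable
    (Eventually.of_forall fun x t ht => by
      rw [norm_mul, norm_neg, norm_mul, norm_mul]
      have := norm_cexp_le_one (hre x) (le_of_lt ht)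
      refine mul_le_mul_of_nonneg_right ?_ (norm_nonneg _)
      exact mul_le_of_le_one_right (norm_nonneg _) this)
    (integrable_mul_tst hq φ).norm
    (Eventually.of_forall fun x t _ => (hexp t (q x)).mul_const _)
  refine h.2.congr_deriv ?_
  rw [← integral_neg]
  refine integral_congr_ae (Eventually.of_forall fun x => ?_)
  simp only [neg_mul]

theorem integral_cexp_qform_diagonal {a : ι → ℂ} (ha : ∀ i, 0 < (a i).re) :
    Integrable (fun x => Complex.exp (-qform (Matrix.diagonal a) x)) ∧
    ∫ x, Complex.exp (-qform (Matrix.diagonal a) x) = ∏ i, ((Real.pi : ℂ) / a i) ^ (1 / 2 : ℂ) := by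
  have h1 := GaussianFourier.integral_cexp_neg_sum_mul_add ha 0
  have h2 := GaussianFourier.integrable_cexp_neg_sum_mul_add ha 0
  simp only [Pi.zero_apply, zero_mul, Finset.sum_const_zero, add_zero, ne_eq, OfNat.ofNat_ne_zero,
    not_false_eq_true, zero_pow, zero_div, Complex.exp_zero, mul_one] at h1 h2
  have hmp := PiLp.volume_preserving_ofLp ι
  have hme : MeasurableEmbedding (WithLp.ofLp : EuclideanSpace ℝ ι → ι → ℝ) :=
    (MeasurableEquiv.toLp 2 (ι → ℝ)).symm.measurableEmbedding
  simp only [qform_diagonal]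
  exact ⟨(hmp.integrable_comp_emb hme).2 h2, (hmp.integral_comp hme _).trans h1⟩

theorem tendsto_pow_mul_heatInt {m : ℕ} (hn : Fintype.card ι = 2 * (m + 1)) {a : ι → ℂ}
    (ha : ∀ i, 0 < (a i).re) (φ : Tst ι) :
    Tendsto (fun s : ℝ => (s : ℂ) ^ (m + 1) * heatInt (qform (Matrix.diagonal a)) φ s) atTop
      (𝓝 ((∏ i, ((Real.pi : ℂ) / a i) ^ (1 / 2 : ℂ)) * φ 0)) := by
  obtain ⟨hint, hval⟩ := integral_cexp_qform_diagonal ha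
  have hqc := (contDiff_qform (Matrix.diagonal a)).continuous
  obtain ⟨C, hC⟩ := φ.hasCompactSupport.exists_bound_of_continuous φ.continuous
  -- The substitution `x ↦ x / √s` removes `s` from the Gaussian.
  have h1 : Tendsto (fun s : ℝ => ∫ x, Complex.exp (-qform (Matrix.diagonal a) x) *
      φ ((√s)⁻¹ • x)) atTop (𝓝 (∫ x, Complex.exp (-qform (Matrix.diagonal a) x) * φ 0)) := by
    refine tendsto_integral_filter_of_dominated_convergence
      (fun x => ‖Complex.exp (-qform (Matrix.diagonal a) x)‖ * C) ?_ ?_ (hint.norm.mul_const C) ?_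
    · refine Eventually.of_forall fun s => Continuous.aestronglyMeasurable ?_
      exact hqc.neg.cexp.mul (φ.continuous.comp (continuous_const_smul _))
    · refine Eventually.of_forall fun s => Eventually.of_forall fun x => ?_
      rw [norm_mul]
      exact mul_le_mul_of_nonneg_left (hC _) (norm_nonneg _)
    · refine Eventually.of_forall fun x => Tendsto.const_mul _ ?_
      have h2 : Tendsto (fun s : ℝ => (√s)⁻¹ • x) atTop (𝓝 ((0 : ℝ) • x)) :=
        (tendsto_inv_atTop_zero.comp Real.tendsto_sqrt_atTop).smul_const x
      rw [zero_smul] at h2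
      exact (φ.continuous.tendsto 0).comp h2
  rw [integral_mul_const, hval] at h1
  refine h1.congr' ?_
  filter_upwards [eventually_gt_atTop 0] with s hs
  have hs' : 0 < √s := Real.sqrt_pos.2 hs
  have h3 := Measure.integral_comp_smul (volume : Measure (EuclideanSpace ℝ ι))
    (fun x => Complex.exp (-qform (Matrix.diagonal a) x) * φ ((√s)⁻¹ • x)) (√s)
  have h4 : ∀ x : EuclideanSpace ℝ ι, qform (Matrix.diagonal a) (√s • x) =
      s * qform (Matrix.diagonal a) x := by
    intro x
    simp only [qform_diagonal, Finset.mul_sum, PiLp.smul_apply, smul_eq_mul]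
    refine Finset.sum_congr rfl fun i _ => ?_
    have : ((√s : ℝ) : ℂ) ^ 2 = s := by exact_mod_cast Real.sq_sqrt hs.le
    push_cast
    rw [mul_pow, this]
    ring
  simp only [h4, smul_smul, inv_mul_cancel₀ hs'.ne', one_smul] at h3
  have h5 : |((√s) ^ Module.finrank ℝ (EuclideanSpace ℝ ι))⁻¹| = (s ^ (m + 1))⁻¹ := by
    rw [finrank_euclideanSpace, hn, pow_mul, Real.sq_sqrt hs.le, abs_of_pos (by positivity)]
  rw [h5, Complex.real_smul] at h3
  rw [heatInt, h3]
  push_cast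
  rw [← mul_assoc, mul_inv_cancel₀ (pow_ne_zero _ (by exact_mod_cast hs.ne')), one_mul]

end

section

section fundamental

variable {ι : Type*} [Fintype ι] [DecidableEq ι]

omit [DecidableEq ι] in
theorem re_pos_of_definite {q : EuclideanSpace ℝ ι → ℂ} {c : ℝ} (hc : 0 < c)
    (hqc : ∀ x, c * ‖x‖ ^ 2 ≤ (q x).re) {x : EuclideanSpace ℝ ι} (hx : x ≠ 0) : 0 < (q x).re := by
  have : 0 < c * ‖x‖ ^ 2 := by have := norm_pos_iff.2 hx; positivity
  linarith [hqc x]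

omit [DecidableEq ι] in
theorem integrable_pow_mul_cexp_prod [Nonempty ι] {k : ℕ} (hk : 2 * (k + 1) < Fintype.card ι)
    {q : EuclideanSpace ℝ ι → ℂ} (hq : Continuous q) {c : ℝ} (hc : 0 < c)
    (hqc : ∀ x, c * ‖x‖ ^ 2 ≤ (q x).re) (ψ : Tst ι) :
    Integrable (fun y : EuclideanSpace ℝ ι × ℝ =>
      (y.2 : ℂ) ^ k * Complex.exp (-(y.2 * q y.1)) * ψ y.1)
      ((volume : Measure (EuclideanSpace ℝ ι)).prod (volume.restrict (Ioi 0))) := by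
  have hcont : Continuous fun y : EuclideanSpace ℝ ι × ℝ =>
      (y.2 : ℂ) ^ k * Complex.exp (-(y.2 * q y.1)) * ψ y.1 := by
    have h1 : Continuous fun y : EuclideanSpace ℝ ι × ℝ =>
      (y.2 : ℂ) ^ k * Complex.exp (-(y.2 * q y.1)) := by fun_prop
    exact h1.mul (ψ.continuous.comp continuous_fst)
  rw [integrable_prod_iff hcont.aestronglyMeasurable]
  constructor
  · filter_upwards [ae_ne_zero] with x hx
    exact (integrableOn_pow_mul_cexp k (re_pos_of_definite hc hqc hx)).mul_const _
  · have hq' : Continuous fun x => ((q x).re : ℂ) :=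
      Complex.continuous_ofReal.comp (Complex.continuous_re.comp hq)
    have h1 := (integrable_cpow_mul_of_definite (μ := -((k + 1 : ℕ) : ℂ)) hq' hc
      (fun x => by simpa using hqc x) (by simp; linarith)
      (by have : (2 * (k + 1) : ℝ) < Fintype.card ι := by exact_mod_cast hk
          simp only [Complex.neg_re, Complex.natCast_re]
          push_cast
          linarith) ψ).norm.const_mul (k.factorial : ℝ)
    refine h1.congr ?_
    filter_upwards [ae_ne_zero] with x hx
    have hx' := re_pos_of_definite hc hqc hx
    have e1 : ∀ s ∈ Ioi (0 : ℝ), ‖(s : ℂ) ^ k * Complex.exp (-(s * q x)) * ψ x‖ =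
        s ^ k * Real.exp (-(s * (q x).re)) * ‖ψ x‖ := fun s hs => by
      rw [norm_mul, norm_pow_mul_cexp k _ (le_of_lt hs)]
    rw [setIntegral_congr_fun measurableSet_Ioi e1, integral_mul_const]
    have e2 : ∫ s : ℝ in Ioi 0, s ^ k * Real.exp (-(s * (q x).re)) =
        k.factorial / (q x).re ^ (k + 1) := by
      have h3 := integral_pow_mul_cexp k (w := ((q x).re : ℂ)) (by simpa using hx')
      rw [← Complex.ofReal_inj]
      rw [← integral_complex_ofReal]
      push_cast
      exact h3
    rw [e2, norm_mul, Complex.cpow_neg, Complex.cpow_natCast, norm_inv, norm_pow, Complex.norm_real,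
      Real.norm_of_nonneg hx'.le]
    ring

/-- Up to a factor, `q ^ (-m)` is a fundamental solution of the dual operator. -/
theorem powInt_boxT_diagonal {m : ℕ} (hm : 1 ≤ m) (hn : Fintype.card ι = 2 * (m + 1)) {a : ι → ℂ}
    (ha : ∀ i, 0 < (a i).re) (φ : Tst ι) :
    powInt (qform (Matrix.diagonal a)) (-(m : ℂ)) (boxT (Matrix.diagonal fun i => (a i)⁻¹) φ) =
      -((m - 1).factorial : ℂ)⁻¹ * ((∏ i, ((Real.pi : ℂ) / a i) ^ (1 / 2 : ℂ)) * φ 0) := by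
  obtain ⟨k, rfl⟩ : ∃ k, m = k + 1 := ⟨m - 1, by omega⟩
  have hne : Nonempty ι := nonempty_of_card hn
  obtain ⟨c, hc, hqc⟩ := exists_coercive_diagonal ha
  set q := qform (Matrix.diagonal a) with hq_def
  have hq : Continuous q := (contDiff_qform _).continuous
  have hre := re_nonneg_of_definite hc hqc
  have ha0 : ∀ i, a i ≠ 0 := fun i h => by have := ha i; rw [h] at this; simp at this
  set ψ := boxT (Matrix.diagonal fun i => (a i)⁻¹) φ with hψ
  have hk0 : (k.factorial : ℂ) ≠ 0 := by exact_mod_cast k.factorial_ne_zero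
  have hprod := integrable_pow_mul_cexp_prod (k := k) (by omega) hq hc hqc ψ
  -- Write `q ^ (-m)` as an integral of `s ^ (m-1) e^{-sq}`. After exchanging the integrals, the
  -- integrand in `s` is the derivative of `-s ^ (m+1) * heatInt q φ s`.
  have h1 : powInt q (-((k + 1 : ℕ) : ℂ)) ψ = (k.factorial : ℂ)⁻¹ *
      ∫ x, ∫ s : ℝ in Ioi 0, (s : ℂ) ^ k * Complex.exp (-(s * q x)) * ψ x := by
    rw [powInt, ← integral_const_mul]
    refine integral_congr_ae ?_
    filter_upwards [ae_ne_zero] with x hx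
    rw [integral_mul_const, integral_pow_mul_cexp k (re_pos_of_definite hc hqc hx),
      Complex.cpow_neg, Complex.cpow_natCast]
    field_simp
  have hval : ∀ s : ℝ, ∫ x, (s : ℂ) ^ k * Complex.exp (-(s * q x)) * ψ x =
      (s : ℂ) ^ (k + 2) * (∫ x, q x * Complex.exp (-(s * q x)) * φ x) -
        (k + 2) * (s : ℂ) ^ (k + 1) * heatInt q φ s := by
    intro s
    have hc : Continuous fun x => Complex.exp (-(s * q x)) := by fun_prop
    have h2 := integral_cexp_mul_boxT ha0 s φ
    rw [← hψ, ← hq_def] at h2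
    simp only [mul_assoc ((s : ℂ) ^ k)]
    rw [integral_const_mul, h2, heatInt, ← integral_const_mul, ← integral_const_mul,
      ← integral_const_mul, ← integral_sub]
    · refine integral_congr_ae (Eventually.of_forall fun x => ?_)
      simp only [hn]
      push_cast
      ring
    · exact (integrable_mul_tst (hq.mul hc) φ).const_mul _
    · exact (integrable_mul_tst hc φ).const_mul _
  have hderiv : ∀ s ∈ Ioi (0 : ℝ), HasDerivAt (fun s : ℝ => (s : ℂ) ^ (k + 2) * heatInt q φ s)
      (-∫ x, (s : ℂ) ^ k * Complex.exp (-(s * q x)) * ψ x) s := by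
    intro s hs
    have h2 : HasDerivAt (fun s : ℝ => (s : ℂ) ^ (k + 2)) (((k + 2 : ℕ) : ℂ) * (s : ℂ) ^ (k + 1) * 1)
      s := (HasDerivAt.ofReal_comp (hasDerivAt_id s)).pow (k + 2)
    refine (h2.fun_mul (hasDerivAt_heatInt hq hre φ hs)).congr_deriv ?_
    rw [hval]
    push_cast
    ring
  have hint : IntegrableOn (fun s : ℝ => -∫ x, (s : ℂ) ^ k * Complex.exp (-(s * q x)) * ψ x)
      (Ioi 0) := hprod.integral_prod_right.neg
  have h3 := integral_Ioi_of_hasDerivAt_of_tendsto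
    (f := fun s : ℝ => (s : ℂ) ^ (k + 2) * heatInt q φ s)
    ((Continuous.mul (by fun_prop) (continuous_heatInt hq φ)).continuousAt.continuousWithinAt)
    hderiv hint (tendsto_pow_mul_heatInt hn ha φ)
  rw [integral_neg] at h3
  rw [h1, integral_integral_swap hprod, Nat.add_sub_cancel]
  simp only [Complex.ofReal_zero, ne_eq, Nat.add_eq_zero_iff, OfNat.ofNat_ne_zero, and_false,
    not_false_eq_true, zero_pow, zero_mul, sub_zero] at h3
  linear_combination -(k.factorial : ℂ)⁻¹ * h3

end fundamental

/-! ### The combination of regularized powers annihilates the image of the wave operator -/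

variable {p q m : ℕ}

/-- The diagonal entries of `c P + η |x|²`. -/
def diagEntries (p q : ℕ) (c : ℂ) (η : ℝ) : Idx p q → ℂ :=
  Sum.elim (fun _ => c + η) (fun _ => -c + η)

theorem smul_signJ_add (c : ℂ) (η : ℝ) :
    c • signJ p q + (η : ℂ) • (1 : Matrix (Idx p q) (Idx p q) ℂ) =
      Matrix.diagonal (diagEntries p q c η) := by
  ext i j
  by_cases h : i = j
  · subst h
    cases i <;> simp [signJ, diagEntries]
  · simp [signJ, h]

theorem prod_diagEntries (c : ℂ) (η : ℝ) (f : ℂ → ℂ) :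
    ∏ i, f (diagEntries p q c η i) = f (c + η) ^ (p - 1) * f (-c + η) ^ (q - 1) := by
  simp [diagEntries]

theorem tendsto_div_cpow {c : ℂ} (hc : c ≠ 0) (hre : c.re = 0) :
    Tendsto (fun η : ℝ => ((Real.pi : ℂ) / (c + η)) ^ (1 / 2 : ℂ)) (𝓝[>] 0)
      (𝓝 (((Real.pi : ℂ) / c) ^ (1 / 2 : ℂ))) := by
  have h1 : Tendsto (fun η : ℝ => (Real.pi : ℂ) / (c + η)) (𝓝 0) (𝓝 ((Real.pi : ℂ) / c)) := by
    have h2 : ContinuousAt (fun η : ℝ => (Real.pi : ℂ) / (c + η)) 0 :=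
      ContinuousAt.div (by fun_prop) (by fun_prop) (by simpa using hc)
    simpa [ContinuousAt] using h2
  refine Tendsto.comp (g := fun w : ℂ => w ^ (1 / 2 : ℂ)) ?_ (h1.mono_left nhdsWithin_le_nhds)
  refine (Complex.continuousAt_cpow_const_of_re_pos (Or.inl ?_) (by norm_num)).tendsto
  rw [Complex.div_re, hre]
  simp

/-- The wave operator applied to a regularized power of `P` is a multiple of the delta distribution;
obtained from the forms `c P + η |x|²` as `η → 0`. -/
theorem regVal_boxT_signJ (hm : (p - 1) + (q - 1) = 2 * (m + 1)) (hm1 : 1 ≤ m) {c : ℂ} (hc : c ≠ 0)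
    (hre : c.re = 0) (φ : CcInfty p q) :
    regP p q m c (boxT (signJ p q) φ) = -(c * ((m - 1).factorial : ℂ)⁻¹ *
      ((((Real.pi : ℂ) / c) ^ (1 / 2 : ℂ)) ^ (p - 1) *
        (((Real.pi : ℂ) / -c) ^ (1 / 2 : ℂ)) ^ (q - 1) * φ 0)) := by
  set B := c • signJ p q with hB
  have hdet : IsUnit B.det := isUnit_det_smul_signJ hc
  have hBs : B.IsSymm := isSymm_smul_signJ c
  have hBre : ∀ x : Flat p q, 0 ≤ (qform B x).re := re_qform_smul_signJ hre
  have hlhs : Tendsto (fun η : ℝ => powInt (qform (B + (η : ℂ) • (1 : Matrix (Idx p q) (Idx p q) ℂ)))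
      (-(m : ℂ)) (boxT (Matrix.diagonal fun i => (diagEntries p q c η i)⁻¹) φ)) (𝓝[>] 0)
      (𝓝 (regVal B B⁻¹ m (boxT (c⁻¹ • signJ p q) φ))) := by
    have e0 : c⁻¹ • signJ p q = Matrix.diagonal fun i => (diagEntries p q c 0 i)⁻¹ := by
      ext i j
      by_cases h : i = j
      · subst h
        cases i <;> simp [signJ, diagEntries]
      · simp [signJ, h]
    have e1 : ∀ η : ℝ, 0 < η → powInt (qform (B + (η : ℂ) • (1 : Matrix (Idx p q) (Idx p q) ℂ)))
      (-(m : ℂ)) (boxT (Matrix.diagonal fun i => (diagEntries p q c η i)⁻¹) φ) =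
        ∑ i, (diagEntries p q c η i)⁻¹ / 4 *
          powInt (qform (B + (η : ℂ) • (1 : Matrix (Idx p q) (Idx p q) ℂ))) (-(m : ℂ))
            (pdT i (pdT i φ)) := by
      intro η hη
      have hne : Nonempty (Idx p q) := nonempty_of_card (card_idx hm)
      unfold powInt
      rw [boxT_diagonal]
      simp only [tst_sum_apply, Finset.mul_sum]
      rw [integral_finsetSum]
      · refine Finset.sum_congr rfl fun i _ => ?_
        rw [← integral_const_mul]
        refine integral_congr_ae (Eventually.of_forall fun x => ?_)
        simp
        ring
      · intro i _
        refine integrable_cpow_mul_of_definite (contDiff_qform _).continuous hη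
          (fun x => definite_add_smul_one hBre x) (by simp) ?_ _
        rw [neg_card_div_two (card_idx hm)]
        simp
    have e2 : regVal B B⁻¹ m (boxT (c⁻¹ • signJ p q) φ) =
        ∑ i, (diagEntries p q c 0 i)⁻¹ / 4 * regVal B B⁻¹ m (pdT i (pdT i φ)) := by
      rw [e0, boxT_diagonal]
      simp only [regVal_eq_integral B⁻¹ hBre, ← integral_const_mul]
      rw [← integral_finsetSum]
      · refine integral_congr_ae (Eventually.of_forall fun x => ?_)
        simp only [← Module.End.pow_apply, map_sum, map_smul, tst_sum_apply, Finset.mul_sum]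
        refine Finset.sum_congr rfl fun i _ => ?_
        simp
        ring
      · intro i _
        exact (integrable_mul_tst (continuous_regKernel hBre m) _).const_mul _
    rw [e2]
    refine (tendsto_finsetSum _ fun i _ => ?_).congr' (f₁ := fun η : ℝ =>
      ∑ i, (diagEntries p q c η i)⁻¹ / 4 *
          powInt (qform (B + (η : ℂ) • (1 : Matrix (Idx p q) (Idx p q) ℂ))) (-(m : ℂ))
            (pdT i (pdT i φ))) ?_
    · refine Tendsto.mul ?_ (tendsto_powInt_regVal (card_idx hm) hBs hdet hBre _)
      have h3 : ContinuousAt (fun η : ℝ => (diagEntries p q c η i)⁻¹ / 4) 0 := by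
        refine ContinuousAt.div_const (ContinuousAt.inv₀ ?_ ?_) _
        · cases i <;> simp only [diagEntries, Sum.elim_inl, Sum.elim_inr] <;> fun_prop
        · cases i <;> simpa [diagEntries] using hc
      exact h3.tendsto.mono_left nhdsWithin_le_nhds
    · filter_upwards [self_mem_nhdsWithin] with η hη
      exact (e1 η hη).symm
  have hrhs : Tendsto (fun η : ℝ => powInt (qform (B + (η : ℂ) • (1 : Matrix (Idx p q) (Idx p q) ℂ)))
      (-(m : ℂ)) (boxT (Matrix.diagonal fun i => (diagEntries p q c η i)⁻¹) φ)) (𝓝[>] 0)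
      (𝓝 (-((m - 1).factorial : ℂ)⁻¹ * ((((Real.pi : ℂ) / c) ^ (1 / 2 : ℂ)) ^ (p - 1) *
        (((Real.pi : ℂ) / -c) ^ (1 / 2 : ℂ)) ^ (q - 1) * φ 0))) := by
    have h1 := (((tendsto_div_cpow hc hre).pow (p - 1)).mul
      ((tendsto_div_cpow (neg_ne_zero.2 hc) (by simp [hre])).pow (q - 1))).mul_const (φ 0)
    refine (h1.const_mul (-((m - 1).factorial : ℂ)⁻¹)).congr' ?_
    filter_upwards [self_mem_nhdsWithin] with η hη
    have hη : 0 < η := hη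
    rw [hB, smul_signJ_add, powInt_boxT_diagonal hm1 (card_idx hm),
      prod_diagEntries c η fun w => ((Real.pi : ℂ) / w) ^ (1 / 2 : ℂ)]
    intro i
    cases i <;> simpa [diagEntries, hre] using hη
  have h := tendsto_nhds_unique hlhs hrhs
  have e3 : boxT (c⁻¹ • signJ p q) φ = c⁻¹ • boxT (signJ p q) φ := by
    simp only [boxT_apply, Finset.smul_sum, Matrix.smul_apply, smul_smul, smul_eq_mul, mul_div_assoc]
  rw [e3, regVal_smul _ hBre] at h
  rw [regP, ← hB]
  rw [inv_mul_eq_iff_eq_mul₀ hc] at h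
  rw [h]
  ring

/-- The delta distributions cancel: with `L₁ = (π / (-i)) ^ (1/2)` and `L₂ = (π / i) ^ (1/2)` they
occur with the factors `i L₁ ^ (p-1) L₂ ^ (q-1)` and `-ε i L₂ ^ (p-1) L₁ ^ (q-1)`, where `L₁ = i L₂`
and `i ^ (p-1) = ε i ^ (q-1)`. -/
theorem regP_boxT_add (hp : 1 ≤ p) (hq : 1 ≤ q) (hm : (p - 1) + (q - 1) = 2 * (m + 1)) (hm1 : 1 ≤ m)
    (φ : CcInfty p q) : regP p q m (-Complex.I) (boxT (signJ p q) φ) +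
      signEps p q * regP p q m Complex.I (boxT (signJ p q) φ) = 0 := by
  rw [regVal_boxT_signJ hm hm1 (by simp) (by simp), regVal_boxT_signJ hm hm1 (by simp) (by simp),
    neg_neg]
  set L₁ := ((Real.pi : ℂ) / -Complex.I) ^ (1 / 2 : ℂ) with hL₁
  set L₂ := ((Real.pi : ℂ) / Complex.I) ^ (1 / 2 : ℂ) with hL₂
  have hL : L₁ = Complex.I * L₂ := by
    have e1 : (Real.pi : ℂ) / -Complex.I = Complex.I * (Real.pi : ℝ) := by
      rw [div_neg, Complex.div_I]; ring
    have e2 : (Real.pi : ℂ) / Complex.I = -Complex.I * (Real.pi : ℝ) := by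
      rw [Complex.div_I]; ring
    have e3 : Complex.exp (Real.pi * (1 / 2 : ℂ) / 2 * Complex.I) =
        Complex.I * Complex.exp (-(Real.pi * (1 / 2 : ℂ) / 2) * Complex.I) := by
      rw [← Complex.exp_pi_div_two_mul_I, ← Complex.exp_add, Complex.exp_pi_div_two_mul_I]
      congr 1
      ring
    have h0 : max (-Real.pi) 0 = 0 := max_eq_right (by linarith [Real.pi_pos])
    rw [hL₁, hL₂, e1, e2, mul_ofReal_cpow Complex.I_ne_zero (by norm_num),
      mul_ofReal_cpow (by simp) (by norm_num), h0, Complex.ofReal_zero,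
      Complex.zero_cpow (by norm_num), mul_zero, mul_zero, add_zero, add_zero, I_cpow, neg_I_cpow]
    rw [e3, mul_assoc]
  have hε : (Complex.I : ℂ) ^ (p - 1) = signEps p q * Complex.I ^ (q - 1) := by
    have h1 := I_pow_eq_signs hp hq hm
    have hI : (Complex.I : ℂ) ^ m ≠ 0 := pow_ne_zero _ Complex.I_ne_zero
    have h2 : (Complex.I ^ (q - 1) * (Complex.I ^ m)⁻¹) ^ 2 = -(signEps p q : ℂ) := by
      have hδ : (signDelta p q : ℂ) ^ 2 = 1 := by
        unfold signDelta
        split_ifs <;> norm_num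
      rw [h1, mul_pow, mul_pow, hδ, Complex.I_sq]
      rcases signEps_eq p q with h | h <;> simp [h]
    have h3 : (Complex.I : ℂ) ^ (p - 1) * Complex.I ^ (q - 1) = -(Complex.I ^ m) ^ 2 := by
      rw [← pow_add, hm]
      ring_nf
      rw [Complex.I_sq]
      ring
    have hq0 : (Complex.I : ℂ) ^ (q - 1) ≠ 0 := pow_ne_zero _ Complex.I_ne_zero
    have hε2 : (signEps p q : ℂ) * signEps p q = 1 := by
      rcases signEps_eq p q with h | h <;> simp [h]
    rw [mul_pow, inv_pow, ← div_eq_mul_inv, div_eq_iff (pow_ne_zero _ hI)] at h2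
    refine mul_right_cancel₀ hq0 ?_
    linear_combination h3 - signEps p q * h2 + (Complex.I ^ m) ^ 2 * hε2
  rw [hL, mul_pow, mul_pow]
  linear_combination (Complex.I * ((m - 1).factorial : ℂ)⁻¹ * L₂ ^ (p - 1) * L₂ ^ (q - 1) * φ 0) * hε

end

section

/-! ### Convolutions with the regularized powers -/

section pderiv

variable {ι : Type*} [Fintype ι] [DecidableEq ι]

theorem pderiv_pderiv {f : EuclideanSpace ℝ ι → ℂ} (hf : ContDiff ℝ ∞ f) (i j : ι)
    (x : EuclideanSpace ℝ ι) : pderiv i (pderiv j f) x =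
      fderiv ℝ (fderiv ℝ f) x (EuclideanSpace.single i 1) (EuclideanSpace.single j 1) := by
  have h1 : DifferentiableAt ℝ (fderiv ℝ f) x :=
    (hf.fderiv_right (m := ∞) (by simp)).differentiable (by simp) x
  have h2 : pderiv j f = fun x => fderiv ℝ f x (EuclideanSpace.single j 1) := rfl
  rw [h2, pderiv, fderiv_clm_apply h1 (differentiableAt_const _)]
  simp

theorem pderiv_comm {f : EuclideanSpace ℝ ι → ℂ} (hf : ContDiff ℝ ∞ f) (i j : ι)
    (x : EuclideanSpace ℝ ι) : pderiv i (pderiv j f) x = pderiv j (pderiv i f) x := by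
  rw [pderiv_pderiv hf, pderiv_pderiv hf]
  exact (hf.contDiffAt.isSymmSndFDerivAt (by
    simpa using WithTop.coe_le_coe.2 (le_top : (2 : ℕ∞) ≤ ⊤))).eq _ _

theorem pdT_comm (i j : ι) (φ : Tst ι) : pdT i (pdT j φ) = pdT j (pdT i φ) := by
  ext x
  have h : ∀ k : ι, (pdT k φ : EuclideanSpace ℝ ι → ℂ) = pderiv k φ := fun k =>
    funext (pdT_apply k φ)
  rw [pdT_apply, pdT_apply, h, h]
  exact pderiv_comm φ.contDiff i j x

theorem boxT_pdT (β : Matrix ι ι ℂ) (i : ι) (φ : Tst ι) :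
    boxT β (pdT i φ) = pdT i (boxT β φ) := by
  rw [boxT_apply, boxT_apply, map_sum]
  refine Finset.sum_congr rfl fun l _ => ?_
  rw [map_smul, pdT_comm l.2 i, pdT_comm l.1 i]

theorem iterate_boxT_pdT (β : Matrix ι ι ℂ) (K : ℕ) (i : ι) (φ : Tst ι) :
    (boxT β)^[K] (pdT i φ) = pdT i ((boxT β)^[K] φ) := by
  induction K generalizing φ with
  | zero => rfl
  | succ K ih => rw [Function.iterate_succ_apply, boxT_pdT, ih, Function.iterate_succ_apply]

end pderiv

variable {p q m : ℕ}

theorem pdT_reflT (i : Idx p q) (φ : CcInfty p q) (y : Flat p q) :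
    pdT i (reflT φ y) = -reflT (pdT i φ) y := by
  ext x
  have e : (reflT φ y : Flat p q → ℂ) = fun x => φ (y - x) := rfl
  have h1 : HasFDerivAt (fun x : Flat p q => φ (y - x))
      ((fderiv ℝ φ (y - x)).comp (-ContinuousLinearMap.id ℝ (Flat p q))) x :=
    ((φ.contDiff.differentiable (by simp) (y - x)).hasFDerivAt).comp x
      ((hasFDerivAt_id x).const_sub y)
  rw [pdT_apply, e, pderiv, h1.fderiv]
  have h2 : (-reflT (pdT i φ) y) x = -(pdT i φ (y - x)) := rfl
  rw [h2, pdT_apply]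
  simp [pderiv]

theorem boxT_reflT (β : Matrix (Idx p q) (Idx p q) ℂ) (φ : CcInfty p q) (y : Flat p q) :
    boxT β (reflT φ y) = reflT (boxT β φ) y := by
  ext x
  rw [boxT_apply, reflT_apply, boxT_apply, tst_sum_apply, tst_sum_apply]
  refine Finset.sum_congr rfl fun l _ => ?_
  rw [pdT_reflT, map_neg, pdT_reflT, neg_neg]
  rfl

theorem iterate_boxT_reflT (β : Matrix (Idx p q) (Idx p q) ℂ) (K : ℕ) (φ : CcInfty p q)
    (y : Flat p q) : (boxT β)^[K] (reflT φ y) = reflT ((boxT β)^[K] φ) y := by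
  induction K generalizing φ with
  | zero => rfl
  | succ K ih => rw [Function.iterate_succ_apply, boxT_reflT, ih, Function.iterate_succ_apply]

/-- The convolution of the kernel of the regularized power with a test function. -/
theorem regP_reflT_eq {c : ℂ} (hc : c.re = 0) (φ : CcInfty p q) (y : Flat p q) :
    regP p q m c (reflT φ y) = convolution (regKernel (c • signJ p q) m)
      ((boxT (c • signJ p q)⁻¹)^[m + 1] φ) (ContinuousLinearMap.mul ℝ ℂ) volume y := by
  rw [regP, regVal_eq_integral _ (re_qform_smul_signJ hc), iterate_boxT_reflT]
  rfl

theorem contDiff_regP_reflT {c : ℂ} (hc : c.re = 0) (φ : CcInfty p q) :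
    ContDiff ℝ ∞ fun y => regP p q m c (reflT φ y) := by
  simp only [regP_reflT_eq hc]
  set ψ := (boxT (c • signJ p q)⁻¹)^[m + 1] φ
  exact ψ.hasCompactSupport.contDiff_convolution_right _
    (continuous_regKernel (re_qform_smul_signJ hc) m).locallyIntegrable ψ.contDiff

theorem pderiv_regP_reflT {c : ℂ} (hc : c.re = 0) (φ : CcInfty p q) (i : Idx p q) :
    pderiv i (fun y => regP p q m c (reflT φ y)) = fun y => regP p q m c (reflT (pdT i φ) y) := by
  funext y
  simp only [regP_reflT_eq hc, iterate_boxT_pdT]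
  set ψ := (boxT (c • signJ p q)⁻¹)^[m + 1] φ
  have hκ := continuous_regKernel (re_qform_smul_signJ (p := p) (q := q) hc) m
  have h1 := ψ.hasCompactSupport.hasFDerivAt_convolution_right (ContinuousLinearMap.mul ℝ ℂ)
    (hκ.locallyIntegrable (μ := volume)) (ψ.contDiff.of_le (by simp)) y
  rw [pderiv, h1.fderiv]
  rw [convolution_precompR_apply _ hκ.locallyIntegrable (ψ.hasCompactSupport.fderiv ℝ)
    (ψ.contDiff.continuous_fderiv (by simp))]
  congr 1

/-- The diagonal entries of `P`. -/
def signs (p q : ℕ) : Idx p q → ℂ := Sum.elim (fun _ => 1) (fun _ => -1)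

theorem contDiff_opS (hp : 1 ≤ p) (hq : 1 ≤ q) (hm : (p - 1) + (q - 1) = 2 * (m + 1))
    (φ : CcInfty p q) : ContDiff ℝ ∞ (opS p q φ) := by
  have h : opS p q φ = _ := funext (opS_eq hp hq hm φ)
  rw [h]
  exact contDiff_const.mul ((contDiff_regP_reflT (by simp) φ).add
    (contDiff_const.mul (contDiff_regP_reflT (by simp) φ)))

theorem pderiv_opS (hp : 1 ≤ p) (hq : 1 ≤ q) (hm : (p - 1) + (q - 1) = 2 * (m + 1))
    (φ : CcInfty p q) (i : Idx p q) : pderiv i (opS p q φ) = opS p q (pdT i φ) := by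
  have h : opS p q φ = _ := funext (opS_eq hp hq hm φ)
  have d : ∀ c : ℂ, c.re = 0 → ∀ y, DifferentiableAt ℝ (fun y => regP p q m c (reflT φ y)) y :=
    fun c hc y => (contDiff_regP_reflT hc φ).differentiable (by simp) y
  funext y
  have d1 := d (-Complex.I) (by simp) y
  have d2 := d Complex.I (by simp) y
  have hadd : pderiv i (fun y => regP p q m (-Complex.I) (reflT φ y) +
      signEps p q * regP p q m Complex.I (reflT φ y)) y =
      regP p q m (-Complex.I) (reflT (pdT i φ) y) +
        signEps p q * regP p q m Complex.I (reflT (pdT i φ) y) := by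
    have h1 := congrFun (pderiv_regP_reflT (m := m) (c := -Complex.I) (by simp) φ i) y
    have h2 := congrFun (pderiv_regP_reflT (m := m) (c := Complex.I) (by simp) φ i) y
    have h3 := pderiv_const_mul d2 (signEps p q : ℂ) i
    rw [h2] at h3
    rw [← h1, ← h3]
    unfold pderiv
    rw [fderiv_fun_add d1 (d2.const_mul _)]
    rfl
  rw [h, pderiv_const_mul (d1.fun_add (d2.const_mul _)), hadd, opS_eq hp hq hm]

/-- The functions `S φ` solve the ultrahyperbolic wave equation. -/
theorem sum_signs_mul_pderiv_opS (hp : 1 ≤ p) (hq : 1 ≤ q)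
    (hm : (p - 1) + (q - 1) = 2 * (m + 1)) (hm1 : 1 ≤ m) (φ : CcInfty p q) (y : Flat p q) :
    ∑ i, signs p q i * pderiv i (pderiv i (opS p q φ)) y = 0 := by
  simp only [pderiv_opS hp hq hm, opS_eq hp hq hm]
  have h := regP_boxT_add hp hq hm hm1 (reflT φ y)
  have e : ∀ c : ℂ, c.re = 0 → regP p q m c (boxT (signJ p q) (reflT φ y)) =
      ∑ i, signs p q i / 4 * regP p q m c (reflT (pdT i (pdT i φ)) y) := by
    intro c hc
    have hre := re_qform_smul_signJ (p := p) (q := q) hc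
    rw [boxT_reflT, signJ, boxT_diagonal]
    have e1 : reflT (∑ i, (signs p q i / 4) • pdT i (pdT i φ)) y =
        ∑ i, (signs p q i / 4) • reflT (pdT i (pdT i φ)) y := by
      ext x
      rw [reflT_apply, tst_sum_apply, tst_sum_apply]
      rfl
    change regP p q m c (reflT (∑ i, (signs p q i / 4) • pdT i (pdT i φ)) y) = _
    rw [e1]
    simp only [regP, regVal_eq_integral _ hre, ← integral_const_mul]
    rw [← integral_finsetSum]
    · refine integral_congr_ae (Eventually.of_forall fun x => ?_)
      simp only [← Module.End.pow_apply, map_sum, map_smul, tst_sum_apply, Finset.mul_sum]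
      refine Finset.sum_congr rfl fun i _ => ?_
      simp
      ring
    · intro i _
      exact (integrable_mul_tst (continuous_regKernel hre m) _).const_mul _
  rw [e _ (by simp), e _ (by simp), Finset.mul_sum, ← Finset.sum_add_distrib] at h
  have h2 : ∑ i, signs p q i * (greenConst q m * (regP p q m (-Complex.I) (reflT (pdT i (pdT i φ)) y) +
      signEps p q * regP p q m Complex.I (reflT (pdT i (pdT i φ)) y))) = 4 * greenConst q m *
      ∑ i, (signs p q i / 4 * regP p q m (-Complex.I) (reflT (pdT i (pdT i φ)) y) +
        signEps p q * (signs p q i / 4 * regP p q m Complex.I (reflT (pdT i (pdT i φ)) y))) := by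
    rw [Finset.mul_sum]
    exact Finset.sum_congr rfl fun i _ => by ring
  rw [h2, h, mul_zero]

end

section

/-! ### Circle averages of complex powers of a real variable -/

section avgPow

variable {m : ℕ} {h : ℂ → ℂ}

/-- The mean of `h(μ) (-i y) ^ (μ + a)` over the circle around `-m`. -/
def avgPow (m : ℕ) (h : ℂ → ℂ) (a : ℕ) (y : ℝ) : ℂ :=
  Real.circleAverage (fun μ => h μ * (-Complex.I * (y : ℂ)) ^ (μ + a)) (-(m : ℂ)) (1 / 2)

theorem continuous_comp_circleMap (hh : ContinuousOn h (Metric.sphere (-(m : ℂ)) (1 / 2))) :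
    Continuous fun t : ℝ => h (circleMap (-(m : ℂ)) (1 / 2) t) :=
  hh.comp_continuous (continuous_circleMap _ _)
    fun t => circleMap_mem_sphere _ (by norm_num) t

theorem re_circleMap_add_natCast_pos {a : ℕ} (ha : m + 1 ≤ a) (t : ℝ) :
    0 < (circleMap (-(m : ℂ)) (1 / 2) t + (a : ℂ)).re := by
  have h1 := re_circleMap_add_pos m t
  have h2 : ((m + 1 : ℕ) : ℝ) ≤ a := by exact_mod_cast ha
  simp only [Complex.add_re, Complex.natCast_re] at h1 ⊢
  linarith

theorem re_neg_I_mul (y : ℝ) : (-Complex.I * (y : ℂ)).re = 0 := by simp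

theorem continuous_avgPow_integrand {E : Type*} [TopologicalSpace E] {y : E → ℝ}
    (hy : Continuous y) (hh : ContinuousOn h (Metric.sphere (-(m : ℂ)) (1 / 2))) {a : ℕ}
    (ha : m + 1 ≤ a) :
    Continuous fun p : ℝ × E => h (circleMap (-(m : ℂ)) (1 / 2) p.1) *
      (-Complex.I * (y p.2 : ℂ)) ^ (circleMap (-(m : ℂ)) (1 / 2) p.1 + a) := by
  refine ((continuous_comp_circleMap hh).comp continuous_fst).mul ?_
  refine continuousOn_cpow_of_re.comp_continuous (f := fun p : ℝ × E =>
    (-Complex.I * (y p.2 : ℂ), circleMap (-(m : ℂ)) (1 / 2) p.1 + (a : ℂ))) ?_ ?_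
  · exact (continuous_const.mul (Complex.continuous_ofReal.comp (hy.comp continuous_snd))).prodMk
      (((continuous_circleMap _ _).comp continuous_fst).add continuous_const)
  · exact fun p => ⟨(re_neg_I_mul _).ge, re_circleMap_add_natCast_pos ha _⟩

theorem continuous_avgPow (hh : ContinuousOn h (Metric.sphere (-(m : ℂ)) (1 / 2))) {a : ℕ}
    (ha : m + 1 ≤ a) : Continuous (avgPow m h a) := by
  unfold avgPow
  simp only [Real.circleAverage_def]
  refine (intervalIntegral.continuous_parametric_intervalIntegral_of_continuous' ?_ _ _).const_smul _
  exact (continuous_avgPow_integrand continuous_id hh ha).comp continuous_swap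

theorem hasDerivAt_avgPow (hh : ContinuousOn h (Metric.sphere (-(m : ℂ)) (1 / 2))) {a : ℕ}
    (ha : m + 1 ≤ a) (y : ℝ) :
    HasDerivAt (avgPow m h (a + 1)) (avgPow m (fun μ => -Complex.I * (h μ * (μ + (a + 1)))) a y) y := by
  set h' : ℂ → ℂ := fun μ => -Complex.I * (h μ * (μ + (a + 1))) with hh'
  have hc' : ContinuousOn h' (Metric.sphere (-(m : ℂ)) (1 / 2)) :=
    continuousOn_const.mul (hh.mul (by fun_prop))
  have hF := continuous_avgPow_integrand (E := ℝ) continuous_id hh (ha.trans (Nat.le_succ a))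
  have hF' := continuous_avgPow_integrand (E := ℝ) continuous_id hc' ha
  obtain ⟨C, hC⟩ := (isCompact_Icc.prod (isCompact_closedBall y 1)).exists_bound_of_continuousOn
    (s := Icc 0 (2 * Real.pi) ×ˢ Metric.closedBall y 1) hF'.continuousOn
  have key := intervalIntegral.hasDerivAt_integral_of_dominated_loc_of_deriv_le (μ := volume)
    (a := 0) (b := 2 * Real.pi) (bound := fun _ => C) (𝕜 := ℝ) (x₀ := y) (s := Metric.closedBall y 1)
    (F := fun y t => h (circleMap (-(m : ℂ)) (1 / 2) t) *
      (-Complex.I * (y : ℂ)) ^ (circleMap (-(m : ℂ)) (1 / 2) t + ((a + 1 : ℕ) : ℂ)))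
    (F' := fun y t => h' (circleMap (-(m : ℂ)) (1 / 2) t) *
      (-Complex.I * (y : ℂ)) ^ (circleMap (-(m : ℂ)) (1 / 2) t + (a : ℂ)))
    (Metric.closedBall_mem_nhds y one_pos)
    (Eventually.of_forall fun x =>
      (hF.comp (Continuous.prodMk_left x)).aestronglyMeasurable)
    ((hF.comp (Continuous.prodMk_left y)).intervalIntegrable _ _)
    (hF'.comp (Continuous.prodMk_left y)).aestronglyMeasurable
    (Eventually.of_forall fun t ht x hx => by
      rw [uIoc_of_le Real.two_pi_pos.le] at ht
      exact hC (t, x) ⟨Ioc_subset_Icc_self ht, hx⟩)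
    intervalIntegrable_const
    (Eventually.of_forall fun t _ x _ => by
      have h1 := hasDerivAt_cpow_add_one (w := -Complex.I * (x : ℂ)) (re_neg_I_mul x).ge
        (re_circleMap_add_natCast_pos ha t)
      have h2 : HasDerivAt (fun x : ℝ => -Complex.I * (x : ℂ)) (-Complex.I * 1) x :=
        (HasDerivAt.ofReal_comp (hasDerivAt_id x)).const_mul _
      have h3 := (h1.comp x h2).const_mul (h (circleMap (-(m : ℂ)) (1 / 2) t))
      have e : circleMap (-(m : ℂ)) (1 / 2) t + ((a + 1 : ℕ) : ℂ) =
          circleMap (-(m : ℂ)) (1 / 2) t + a + 1 := by push_cast; ring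
      simp only [e]
      refine h3.congr_deriv ?_
      simp only [hh']
      ring)
  unfold avgPow
  simp only [Real.circleAverage_def]
  exact key.2.const_smul _

theorem contDiff_avgPow (j : ℕ) : ∀ (h : ℂ → ℂ) (a : ℕ),
    ContinuousOn h (Metric.sphere (-(m : ℂ)) (1 / 2)) → m + 1 + j ≤ a →
      ContDiff ℝ j (avgPow m h a) := by
  induction j with
  | zero =>
    intro h a hh ha
    exact contDiff_zero.2 (continuous_avgPow hh ha)
  | succ j ih =>
    intro h a hh ha
    obtain ⟨b, rfl⟩ : ∃ b, a = b + 1 := ⟨a - 1, by omega⟩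
    have hd := hasDerivAt_avgPow hh (a := b) (by omega)
    push_cast
    rw [contDiff_succ_iff_deriv]
    refine ⟨fun y => (hd y).differentiableAt, fun h => ?_, ?_⟩
    · simp at h
    · rw [funext fun y => (hd y).deriv]
      exact ih _ b (continuousOn_const.mul (hh.mul (by fun_prop))) (by omega)

end avgPow

/-! ### Families of test functions depending on a parameter -/

variable {Θ : Type*} [NormedAddCommGroup Θ] [NormedSpace ℝ Θ] {Ω : Set Θ} {ι : Type*} [Fintype ι]

/-- A smooth family of functions on `ℝ^ι`, parametrized by `Ω`, whose members are supported in a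
common compact set. -/
structure Fam (Ω : Set Θ) (ι : Type*) [Fintype ι] where
  /-- The family as a function of the parameter and the point. -/
  toFun : Θ → EuclideanSpace ℝ ι → ℂ
  contDiffOn : ContDiffOn ℝ ∞ (fun y : Θ × EuclideanSpace ℝ ι => toFun y.1 y.2) (Ω ×ˢ univ)
  /-- A compact set which contains the supports. -/
  supp : Set (EuclideanSpace ℝ ι)
  isCompact_supp : IsCompact supp
  eq_zero : ∀ θ ∈ Ω, ∀ x ∉ supp, toFun θ x = 0

namespace Fam

theorem contDiff_apply (Φ : Fam Ω ι) {θ : Θ} (hθ : θ ∈ Ω) : ContDiff ℝ ∞ (Φ.toFun θ) := by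
  rw [← contDiffOn_univ]
  exact Φ.contDiffOn.comp (f := fun x => (θ, x)) (contDiff_prodMk_right θ).contDiffOn
    fun x _ => ⟨hθ, mem_univ _⟩

/-- The member of a family at the parameter `θ`. -/
def slice (Φ : Fam Ω ι) {θ : Θ} (hθ : θ ∈ Ω) : Tst ι where
  toFun := Φ.toFun θ
  contDiff' := Φ.contDiff_apply hθ
  hasCompactSupport' := HasCompactSupport.intro Φ.isCompact_supp (Φ.eq_zero θ hθ)
  tsupport_subset' := fun _ _ => trivial

@[simp]
theorem slice_apply (Φ : Fam Ω ι) {θ : Θ} (hθ : θ ∈ Ω) (x : EuclideanSpace ℝ ι) :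
    Φ.slice hθ x = Φ.toFun θ x := rfl

/-- The product of a family with a smooth function. -/
def mul (g : Θ → EuclideanSpace ℝ ι → ℂ)
    (hg : ContDiffOn ℝ ∞ (fun y : Θ × EuclideanSpace ℝ ι => g y.1 y.2) (Ω ×ˢ univ))
    (Φ : Fam Ω ι) : Fam Ω ι where
  toFun θ x := g θ x * Φ.toFun θ x
  contDiffOn := hg.mul Φ.contDiffOn
  supp := Φ.supp
  isCompact_supp := Φ.isCompact_supp
  eq_zero θ hθ x hx := by rw [Φ.eq_zero θ hθ x hx, mul_zero]

/-- The constant family. -/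
def const (Ω : Set Θ) (φ : Tst ι) : Fam Ω ι where
  toFun _ x := φ x
  contDiffOn := (φ.contDiff.comp contDiff_snd).contDiffOn
  supp := tsupport φ
  isCompact_supp := φ.hasCompactSupport
  eq_zero _ _ _ hx := image_eq_zero_of_notMem_tsupport hx

variable [DecidableEq ι]

theorem pderiv_eq (hΩ : IsOpen Ω) (Φ : Fam Ω ι) {θ : Θ} (hθ : θ ∈ Ω) (i : ι)
    (x : EuclideanSpace ℝ ι) : pderiv i (Φ.toFun θ) x =
      fderiv ℝ (fun y : Θ × EuclideanSpace ℝ ι => Φ.toFun y.1 y.2) (θ, x)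
        (0, EuclideanSpace.single i 1) := by
  have h1 : DifferentiableAt ℝ (fun y : Θ × EuclideanSpace ℝ ι => Φ.toFun y.1 y.2) (θ, x) :=
    (Φ.contDiffOn.differentiableOn (by simp)).differentiableAt
      ((hΩ.prod isOpen_univ).mem_nhds ⟨hθ, mem_univ _⟩)
  have h2 : HasFDerivAt (Φ.toFun θ) _ x := h1.hasFDerivAt.comp x (hasFDerivAt_prodMk_right θ x)
  rw [pderiv, h2.fderiv]
  simp

/-- The partial derivative of a family with respect to the point. -/
def pd (hΩ : IsOpen Ω) (i : ι) (Φ : Fam Ω ι) : Fam Ω ι where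
  toFun θ := pderiv i (Φ.toFun θ)
  contDiffOn := by
    have h1 : ContDiffOn ℝ ∞ (fun y : Θ × EuclideanSpace ℝ ι =>
        fderiv ℝ (fun y : Θ × EuclideanSpace ℝ ι => Φ.toFun y.1 y.2) y
          (0, EuclideanSpace.single i 1)) (Ω ×ˢ univ) :=
      (Φ.contDiffOn.fderiv_of_isOpen (hΩ.prod isOpen_univ) (by simp)).clm_apply contDiffOn_const
    exact h1.congr fun y hy => Φ.pderiv_eq hΩ hy.1 i y.2
  supp := Φ.supp
  isCompact_supp := Φ.isCompact_supp
  eq_zero θ hθ x hx := by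
    have h1 : Φ.toFun θ =ᶠ[𝓝 x] fun _ => 0 := by
      filter_upwards [Φ.isCompact_supp.isClosed.isOpen_compl.mem_nhds hx] with y hy
      exact Φ.eq_zero θ hθ y hy
    rw [pderiv, h1.fderiv_eq]
    simp

theorem slice_pd (hΩ : IsOpen Ω) (i : ι) (Φ : Fam Ω ι) {θ : Θ} (hθ : θ ∈ Ω) :
    (Φ.pd hΩ i).slice hθ = pdT i (Φ.slice hθ) := by
  ext x
  rw [pdT_apply]
  rfl

end Fam

/-- The integral of `(-i k) ^ μ` against the member of a family at `θ`. -/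
def famInt (k : Θ → EuclideanSpace ℝ ι → ℝ) (θ : Θ) (μ : ℂ) (Φ : Fam Ω ι) : ℂ :=
  ∫ x, (-Complex.I * (k θ x : ℂ)) ^ μ * Φ.toFun θ x

section regularity

variable {k : Θ → EuclideanSpace ℝ ι → ℝ}
  (hk : ContDiff ℝ ∞ fun y : Θ × EuclideanSpace ℝ ι => k y.1 y.2)
  {m : ℕ}

include hk

theorem continuous_slice_kernel (θ : Θ) : Continuous (k θ) :=
  hk.continuous.comp (Continuous.prodMk_right θ)

theorem continuous_famInt_base (θ : Θ) : Continuous fun x => -Complex.I * (k θ x : ℂ) :=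
  continuous_const.mul (Complex.continuous_ofReal.comp (continuous_slice_kernel hk θ))

theorem differentiableOn_famInt {θ : Θ} (hθ : θ ∈ Ω) (Φ : Fam Ω ι) :
    DifferentiableOn ℂ (fun μ => famInt k θ μ Φ) {μ | 0 < μ.re} :=
  differentiableOn_powInt (continuous_famInt_base hk θ) (fun _ => (re_neg_I_mul _).ge) (Φ.slice hθ)

theorem circleAverage_famInt {h : ℂ → ℂ} (hh : ContinuousOn h (Metric.sphere (-(m : ℂ)) (1 / 2)))
    {a : ℕ} (ha : m + 1 ≤ a) {θ : Θ} (hθ : θ ∈ Ω) (Φ : Fam Ω ι) :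
    Real.circleAverage (fun μ => h μ * famInt k θ (μ + a) Φ) (-(m : ℂ)) (1 / 2) =
      ∫ x, avgPow m h a (k θ x) * Φ.toFun θ x := by
  have e1 : (fun μ => h μ * famInt k θ (μ + a) Φ) = fun μ => ∫ x,
      h μ * (-Complex.I * (k θ x : ℂ)) ^ (μ + a) * Φ.slice hθ x := by
    funext μ
    rw [famInt, ← integral_const_mul]
    refine integral_congr_ae (Eventually.of_forall fun x => ?_)
    simp only [Fam.slice_apply]
    ring
  rw [e1, circleAverage_integral Φ.isCompact_supp]
  · refine integral_congr_ae (Eventually.of_forall fun x => ?_)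
    simp only [avgPow, Real.circleAverage_def, Fam.slice_apply]
    rw [intervalIntegral.integral_mul_const, smul_mul_assoc]
  · exact (continuous_avgPow_integrand (continuous_slice_kernel hk θ) hh ha).mul
      ((Φ.slice hθ).continuous.comp continuous_snd)
  · intro μ x hx
    rw [Fam.slice_apply, Φ.eq_zero θ hθ x hx, mul_zero]

theorem contDiffOn_integral_avgPow (hΩ : IsOpen Ω) {h : ℂ → ℂ}
    (hh : ContinuousOn h (Metric.sphere (-(m : ℂ)) (1 / 2))) {a j : ℕ} (ha : m + 1 + j ≤ a)
    (Φ : Fam Ω ι) : ContDiffOn ℝ j (fun θ => ∫ x, avgPow m h a (k θ x) * Φ.toFun θ x) Ω := by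
  have h1 : ContDiffOn ℝ j (fun y : Θ × EuclideanSpace ℝ ι =>
      avgPow m h a (k y.1 y.2) * Φ.toFun y.1 y.2) (Ω ×ˢ univ) :=
    ((contDiff_avgPow j h a hh ha).comp (hk.of_le (by exact_mod_cast le_top))).contDiffOn.mul
      (Φ.contDiffOn.of_le (by exact_mod_cast le_top))
  -- The integral is the value at `0` of the convolution of the integrand with the constant `1`.
  have h2 := contDiffOn_convolution_right_with_param (𝕜 := ℝ) (n := (j : ℕ∞))
    (μ := (volume : Measure (EuclideanSpace ℝ ι))) (f := fun _ => (1 : ℂ))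
    (ContinuousLinearMap.mul ℝ ℂ)
    (g := fun θ x => avgPow m h a (k θ x) * Φ.toFun θ x) hΩ Φ.isCompact_supp
    (fun θ x hθ hx => by rw [Φ.eq_zero θ hθ x hx, mul_zero]) (locallyIntegrable_const _) h1
  have h3 := h2.comp (f := fun θ : Θ => (θ, (0 : EuclideanSpace ℝ ι)))
    (contDiff_prodMk_left _).contDiffOn (fun θ hθ => ⟨hθ, mem_univ _⟩)
  refine h3.congr fun θ _ => ?_
  simp only [Function.comp_apply, convolution_def, ContinuousLinearMap.mul_apply', one_mul, zero_sub]
  exact (integral_neg_eq_self (fun x => avgPow m h a (k θ x) * Φ.toFun θ x) volume).symm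

/-- Each application of the functional equation raises the exponent, so that after sufficiently many
of them the integrand is as often differentiable as desired. -/
theorem contDiffOn_circleAverage_raise (hΩ : IsOpen Ω) {Λ : Type*} [Fintype Λ] {w : Λ → ℂ → ℂ}
    (hw : ∀ l, Differentiable ℂ (w l)) {O : Λ → Fam Ω ι → Fam Ω ι} {j : ℕ} (K : ℕ) :
    ∀ (h : ℂ → ℂ) (a : ℕ) (Φ : Fam Ω ι), ContinuousOn h (Metric.sphere (-(m : ℂ)) (1 / 2)) →
      m + 1 + j ≤ a + K →
      ContDiffOn ℝ j (fun θ => Real.circleAverage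
        (fun μ => h μ * raise (famInt k θ) w O K (μ + a) Φ) (-(m : ℂ)) (1 / 2)) Ω := by
  induction K with
  | zero =>
    intro h a Φ hh ha
    simp only [raise]
    exact (contDiffOn_integral_avgPow hk hΩ hh ha Φ).congr fun θ hθ =>
      circleAverage_famInt hk hh (by omega) hθ Φ
  | succ K ih =>
    intro h a Φ hh ha
    have hh' : ∀ l, ContinuousOn (fun μ => h μ * w l (μ + a)) (Metric.sphere (-(m : ℂ)) (1 / 2)) :=
      fun l => hh.mul ((hw l).continuous.comp (by fun_prop)).continuousOn
    refine (ContDiffOn.sum (s := Finset.univ) fun l _ =>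
      ih (fun μ => h μ * w l (μ + a)) (a + 1) (O l Φ) (hh' l) (by omega)).congr fun θ hθ => ?_
    rw [← Real.circleAverage_fun_sum]
    · refine congrArg (fun f => Real.circleAverage f (-(m : ℂ)) (1 / 2)) (funext fun μ => ?_)
      simp only [raise, Finset.mul_sum]
      refine Finset.sum_congr rfl fun l _ => ?_
      push_cast
      rw [← add_assoc]
      ring
    · intro l _
      refine ContinuousOn.circleIntegrable (by norm_num) ((hh' l).mul ?_)
      have h1 := (differentiableOn_raise (w := w) (O := O)
        (fun Φ => differentiableOn_famInt hk hθ Φ) hw K (O l Φ)).continuousOn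
      refine h1.comp (f := fun μ : ℂ => μ + ((a + 1 : ℕ) : ℂ)) (by fun_prop) ?_
      intro μ hμ
      rw [mem_sphere_iff_norm, sub_neg_eq_add] at hμ
      have h2 := re_gt_of_norm hμ.le
      have h3 : ((m + 1 + j : ℕ) : ℝ) ≤ ((a + (K + 1) : ℕ) : ℝ) := by exact_mod_cast ha
      push_cast at h3
      have hj : (0 : ℝ) ≤ j := j.cast_nonneg
      simp only [mem_ofPred_eq, Complex.add_re, Complex.natCast_re]
      push_cast
      linarith

end regularity

end

section

/-! ### Powers of quadratic polynomials with principal part `c P` -/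

variable {p q m : ℕ}

/-- The coefficients `(a, b, c)` of a polynomial `a + ∑ bᵢ xᵢ + c P(x)` on `ℝⁿ`. -/
abbrev PolyCoeff (p q : ℕ) : Type := ℝ × EuclideanSpace ℝ (Idx p q) × ℝ

/-- The diagonal entries of `P`, as real numbers. -/
def realSigns (p q : ℕ) : Idx p q → ℝ := Sum.elim (fun _ => 1) (fun _ => -1)

theorem realSigns_mul_self (i : Idx p q) : realSigns p q i * realSigns p q i = 1 := by
  cases i <;> simp [realSigns]

theorem quadP_eq_sum (x : Flat p q) : quadP x = ∑ i, realSigns p q i * x i ^ 2 := by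
  rw [quadP, Fintype.sum_sum_type]
  simp [realSigns, sub_eq_add_neg]

/-- The polynomial `a + ∑ bᵢ xᵢ + c P(x)`. -/
def quadPoly (θ : PolyCoeff p q) (x : Flat p q) : ℝ := θ.1 + ∑ i, θ.2.1 i * x i + θ.2.2 * quadP x

/-- The partial derivatives of `quadPoly θ`. -/
def quadPolyDeriv (θ : PolyCoeff p q) (i : Idx p q) (x : Flat p q) : ℝ :=
  θ.2.1 i + 2 * θ.2.2 * realSigns p q i * x i

theorem contDiff_apply_coord {ι : Type*} [Fintype ι] (i : ι) :
    ContDiff ℝ ∞ fun x : EuclideanSpace ℝ ι => x i :=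
  (EuclideanSpace.proj i : EuclideanSpace ℝ ι →L[ℝ] ℝ).contDiff

theorem contDiff_quadP : ContDiff ℝ ∞ (quadP : Flat p q → ℝ) := by
  have h : (quadP : Flat p q → ℝ) = _ := funext quadP_eq_sum
  rw [h]
  exact ContDiff.sum fun i _ => contDiff_const.mul ((contDiff_apply_coord i).pow 2)

theorem contDiff_fst_coord (i : Idx p q) :
    ContDiff ℝ ∞ fun y : PolyCoeff p q × Flat p q => y.1.2.1 i :=
  (contDiff_apply_coord i).comp (by fun_prop)

theorem contDiff_snd_coord (i : Idx p q) :
    ContDiff ℝ ∞ fun y : PolyCoeff p q × Flat p q => y.2 i :=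
  (contDiff_apply_coord i).comp contDiff_snd

theorem contDiff_quadPoly :
    ContDiff ℝ ∞ fun y : PolyCoeff p q × Flat p q => quadPoly y.1 y.2 := by
  unfold quadPoly
  have h1 : ContDiff ℝ ∞ fun y : PolyCoeff p q × Flat p q => quadP y.2 :=
    contDiff_quadP.comp contDiff_snd
  have h2 : ContDiff ℝ ∞ fun y : PolyCoeff p q × Flat p q => y.1.1 := by fun_prop
  have h3 : ContDiff ℝ ∞ fun y : PolyCoeff p q × Flat p q => y.1.2.2 := by fun_prop
  exact (h2.add (ContDiff.sum fun i _ => (contDiff_fst_coord i).mul (contDiff_snd_coord i))).add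
    (h3.mul h1)

theorem contDiff_quadPolyDeriv (i : Idx p q) :
    ContDiff ℝ ∞ fun y : PolyCoeff p q × Flat p q => quadPolyDeriv y.1 i y.2 := by
  unfold quadPolyDeriv
  have h3 : ContDiff ℝ ∞ fun y : PolyCoeff p q × Flat p q => y.1.2.2 := by fun_prop
  exact (contDiff_fst_coord i).add
    (((contDiff_const.mul h3).mul contDiff_const).mul (contDiff_snd_coord i))

/-- The sum of the squares of the leading coefficient, of the partial derivatives and of the value
of `quadPoly θ`. It has no zero if `θ ≠ 0`. -/
def quadPolyNorm (θ : PolyCoeff p q) (x : Flat p q) : ℝ :=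
  θ.2.2 ^ 2 + ∑ i, quadPolyDeriv θ i x ^ 2 + quadPoly θ x ^ 2

theorem quadPolyNorm_ne_zero {θ : PolyCoeff p q} (hθ : θ ≠ 0) (x : Flat p q) :
    quadPolyNorm θ x ≠ 0 := by
  intro h
  have h1 : 0 ≤ ∑ i, quadPolyDeriv θ i x ^ 2 := Finset.sum_nonneg fun i _ => sq_nonneg _
  unfold quadPolyNorm at h
  have hc : θ.2.2 = 0 := by
    refine pow_eq_zero_iff (two_ne_zero) |>.1 ?_
    nlinarith [sq_nonneg θ.2.2, sq_nonneg (quadPoly θ x)]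
  have hk : quadPoly θ x = 0 := by
    refine pow_eq_zero_iff (two_ne_zero) |>.1 ?_
    nlinarith [sq_nonneg θ.2.2, sq_nonneg (quadPoly θ x)]
  have hs : ∑ i, quadPolyDeriv θ i x ^ 2 = 0 := by
    nlinarith [sq_nonneg θ.2.2, sq_nonneg (quadPoly θ x)]
  have hb : ∀ i, θ.2.1 i = 0 := by
    intro i
    have := (Finset.sum_eq_zero_iff_of_nonneg fun i _ => sq_nonneg _).1 hs i (Finset.mem_univ i)
    have := (pow_eq_zero_iff (two_ne_zero)).1 this
    simpa [quadPolyDeriv, hc] using this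
  have ha : θ.1 = 0 := by simpa [quadPoly, hc, hb] using hk
  exact hθ (Prod.ext ha (Prod.ext (by ext i; exact hb i) hc))

theorem contDiff_quadPolyNorm :
    ContDiff ℝ ∞ fun y : PolyCoeff p q × Flat p q => quadPolyNorm y.1 y.2 := by
  unfold quadPolyNorm
  have h3 : ContDiff ℝ ∞ fun y : PolyCoeff p q × Flat p q => y.1.2.2 := by fun_prop
  exact ((h3.pow 2).add (ContDiff.sum fun i _ => (contDiff_quadPolyDeriv i).pow 2)).add
    (contDiff_quadPoly.pow 2)

theorem contDiffOn_div_quadPolyNorm {g : PolyCoeff p q → Flat p q → ℝ}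
    (hg : ContDiff ℝ ∞ fun y : PolyCoeff p q × Flat p q => g y.1 y.2) :
    ContDiffOn ℝ ∞ (fun y : PolyCoeff p q × Flat p q => ((g y.1 y.2 / quadPolyNorm y.1 y.2 : ℝ) : ℂ))
      ({0}ᶜ ×ˢ univ) :=
  Complex.ofRealCLM.contDiff.comp_contDiffOn (hg.contDiffOn.div contDiff_quadPolyNorm.contDiffOn
    fun y hy => quadPolyNorm_ne_zero hy.1 y.2)

/-- The families which are indexed by nonzero coefficients. -/
abbrev PolyFam (p q : ℕ) : Type := Fam ({0}ᶜ : Set (PolyCoeff p q)) (Idx p q)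

/-- The operators in the functional equation of the powers of `quadPoly θ`. -/
def polyOp (l : Idx p q ⊕ Idx p q ⊕ Unit) (Φ : PolyFam p q) : PolyFam p q :=
  match l with
  | Sum.inl i => ((Φ.mul (fun θ x => ((realSigns p q i * θ.2.2 / quadPolyNorm θ x : ℝ) : ℂ))
      (contDiffOn_div_quadPolyNorm (g := fun θ _ => realSigns p q i * θ.2.2)
      (by fun_prop))).pd isOpen_compl_singleton i).pd isOpen_compl_singleton i
  | Sum.inr (Sum.inl i) => (Φ.mul (fun θ x => ((quadPolyDeriv θ i x / quadPolyNorm θ x : ℝ) : ℂ))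
      (contDiffOn_div_quadPolyNorm
      (g := fun θ x => quadPolyDeriv θ i x) (contDiff_quadPolyDeriv i))).pd isOpen_compl_singleton i
  | Sum.inr (Sum.inr _) => Φ.mul (fun θ x => ((quadPoly θ x / quadPolyNorm θ x : ℝ) : ℂ))
      (contDiffOn_div_quadPolyNorm (g := quadPoly) contDiff_quadPoly)

/-- The weights in the functional equation of the powers of `quadPoly θ`. -/
def polyWeight (m : ℕ) (l : Idx p q ⊕ Idx p q ⊕ Unit) (μ : ℂ) : ℂ :=
  match l with
  | Sum.inl _ => Complex.I / 4
  | Sum.inr (Sum.inl _) => -Complex.I * (μ + (m + 1))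
  | Sum.inr (Sum.inr _) => Complex.I * ((μ + 1) * (μ + (m + 1)))

theorem differentiable_polyWeight (m : ℕ) (l : Idx p q ⊕ Idx p q ⊕ Unit) :
    Differentiable ℂ (polyWeight m l) := by
  rcases l with i | i | i <;> unfold polyWeight <;> fun_prop

/-- The polynomial as a complex function, rotated to the imaginary axis. -/
def imPoly (θ : PolyCoeff p q) (x : Flat p q) : ℂ := -Complex.I * (quadPoly θ x : ℂ)

theorem contDiff_imPoly (θ : PolyCoeff p q) : ContDiff ℝ ∞ (imPoly θ) :=
  contDiff_const.mul (Complex.ofRealCLM.contDiff.comp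
    (contDiff_quadPoly.comp (contDiff_prodMk_right θ)))

theorem re_imPoly (θ : PolyCoeff p q) (x : Flat p q) : 0 ≤ (imPoly θ x).re := (re_neg_I_mul _).ge

theorem pderiv_imPoly (θ : PolyCoeff p q) (i : Idx p q) :
    pderiv i (imPoly θ) = fun x => -Complex.I * (quadPolyDeriv θ i x : ℂ) := by
  have hd : ∀ (j : Idx p q) (x : Flat p q), DifferentiableAt ℝ (fun x : Flat p q => (x j : ℂ)) x :=
    fun j x => (contDiff_coord j).differentiable (by simp) x
  funext x
  have e : imPoly θ = fun x => (-Complex.I) * ∑ j, (((θ.2.1 j : ℝ) : ℂ) * (x j : ℂ) +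
      ((θ.2.2 * realSigns p q j : ℝ) : ℂ) * ((x j : ℂ) * (x j : ℂ))) + (-Complex.I) * ((θ.1 : ℝ) : ℂ) := by
    funext x
    rw [imPoly, quadPoly, quadP_eq_sum, Finset.sum_add_distrib]
    push_cast
    rw [Finset.mul_sum]
    simp only [pow_two, mul_assoc]
    ring
  have d1 : ∀ j, DifferentiableAt ℝ (fun x : Flat p q => ((θ.2.1 j : ℝ) : ℂ) * (x j : ℂ)) x :=
    fun j => (hd j x).const_mul _
  have d2 : ∀ j, DifferentiableAt ℝ (fun x : Flat p q => (x j : ℂ) * (x j : ℂ)) x :=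
    fun j => (hd j x).fun_mul (hd j x)
  have d3 : ∀ j, DifferentiableAt ℝ (fun x : Flat p q =>
      ((θ.2.2 * realSigns p q j : ℝ) : ℂ) * ((x j : ℂ) * (x j : ℂ))) x :=
    fun j => (d2 j).const_mul _
  have s1 : pderiv i (imPoly θ) x = pderiv i (fun x => (-Complex.I) * ∑ j, (((θ.2.1 j : ℝ) : ℂ) *
      (x j : ℂ) + ((θ.2.2 * realSigns p q j : ℝ) : ℂ) * ((x j : ℂ) * (x j : ℂ)))) x := by
    rw [e]
    unfold pderiv
    rw [fderiv_add_const]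
  rw [s1, pderiv_const_mul (DifferentiableAt.fun_sum fun j _ => (d1 j).fun_add (d3 j)),
    pderiv_sum _ fun j _ => (d1 j).fun_add (d3 j)]
  have s2 : ∀ j, pderiv i (fun x : Flat p q => ((θ.2.1 j : ℝ) : ℂ) *
      (x j : ℂ) + ((θ.2.2 * realSigns p q j : ℝ) : ℂ) * ((x j : ℂ) * (x j : ℂ))) x =
      if i = j then ((quadPolyDeriv θ j x : ℝ) : ℂ) else 0 := by
    intro j
    have : pderiv i (fun x : Flat p q => ((θ.2.1 j : ℝ) : ℂ) *
      (x j : ℂ) + ((θ.2.2 * realSigns p q j : ℝ) : ℂ) * ((x j : ℂ) * (x j : ℂ))) x =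
      pderiv i (fun x : Flat p q => ((θ.2.1 j : ℝ) : ℂ) * (x j : ℂ)) x +
      pderiv i (fun x : Flat p q =>
        ((θ.2.2 * realSigns p q j : ℝ) : ℂ) * ((x j : ℂ) * (x j : ℂ))) x := by
      unfold pderiv
      rw [fderiv_fun_add (d1 j) (d3 j)]
      rfl
    rw [this, pderiv_const_mul (hd j x), pderiv_const_mul (d2 j), pderiv_mul (hd j x) (hd j x),
      pderiv_coord]
    split_ifs
    · rw [quadPolyDeriv]
      push_cast
      ring
    · simp
  simp only [s2, Finset.sum_ite_eq, Finset.mem_univ, if_true]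

theorem pderiv_pderiv_imPoly (θ : PolyCoeff p q) (i : Idx p q) (x : Flat p q) :
    pderiv i (pderiv i (imPoly θ)) x = -Complex.I * (2 * θ.2.2 * realSigns p q i : ℝ) := by
  have hd : DifferentiableAt ℝ (fun x : Flat p q => (x i : ℂ)) x :=
    (contDiff_coord i).differentiable (by simp) x
  rw [pderiv_imPoly]
  have e : (fun x : Flat p q => -Complex.I * (quadPolyDeriv θ i x : ℂ)) = fun x =>
      (-Complex.I * (2 * θ.2.2 * realSigns p q i : ℝ)) * (x i : ℂ) + -Complex.I * (θ.2.1 i : ℝ) := by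
    funext x
    rw [quadPolyDeriv]
    push_cast
    ring
  have s1 : pderiv i (fun x : Flat p q => (-Complex.I * (2 * θ.2.2 * realSigns p q i : ℝ)) * (x i : ℂ)
      + -Complex.I * (θ.2.1 i : ℝ)) x = pderiv i (fun x : Flat p q =>
        (-Complex.I * (2 * θ.2.2 * realSigns p q i : ℝ)) * (x i : ℂ)) x := by
    unfold pderiv
    rw [fderiv_add_const]
  rw [e, s1, pderiv_const_mul hd, pderiv_coord, if_pos rfl, mul_one]

/-- The coefficients of the polynomials whose gradient `b + 2 c J x` satisfies
`⟨J ∇k, ∇k⟩ = 4 c k`. -/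
def IsConePoly (θ : PolyCoeff p q) : Prop := ∑ i, realSigns p q i * θ.2.1 i ^ 2 = 4 * θ.1 * θ.2.2

theorem IsConePoly.sum_quadPolyDeriv_sq {θ : PolyCoeff p q} (h : IsConePoly θ) (x : Flat p q) :
    ∑ i, realSigns p q i * quadPolyDeriv θ i x ^ 2 = 4 * θ.2.2 * quadPoly θ x := by
  have e : ∀ i, realSigns p q i * quadPolyDeriv θ i x ^ 2 = realSigns p q i * θ.2.1 i ^ 2 +
      4 * θ.2.2 * (θ.2.1 i * x i) + 4 * θ.2.2 ^ 2 * (realSigns p q i * x i ^ 2) := by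
    intro i
    have := realSigns_mul_self i
    rw [quadPolyDeriv]
    linear_combination (4 * θ.2.2 * θ.2.1 i * x i + 4 * θ.2.2 ^ 2 * realSigns p q i * x i ^ 2) * this
  simp only [e, Finset.sum_add_distrib, ← Finset.mul_sum]
  rw [h, quadPoly, quadP_eq_sum]
  ring

theorem famInt_quadPoly (θ : PolyCoeff p q) (hθ : θ ∈ ({0}ᶜ : Set (PolyCoeff p q))) (μ : ℂ)
    (Φ : PolyFam p q) : famInt quadPoly θ μ Φ = powInt (imPoly θ) μ (Φ.slice hθ) := rfl

theorem cpow_sub_one_mul {w μ : ℂ} (hμ : μ ≠ 0) : w ^ (μ - 1) * w = w ^ μ := by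
  by_cases h0 : w = 0
  · rw [h0, Complex.zero_cpow hμ, mul_zero]
  · conv_rhs => rw [← sub_add_cancel μ 1, Complex.cpow_add _ _ h0, Complex.cpow_one]

/-- The functional equation of the powers of a nonzero cone polynomial. -/
theorem famInt_functional_equation (hm : (p - 1) + (q - 1) = 2 * (m + 1)) {θ : PolyCoeff p q}
    (hθ : θ ≠ 0) (hc : IsConePoly θ) {μ : ℂ} (hμ : 1 < μ.re) (Φ : PolyFam p q) :
    (μ + 1) * (μ + (m + 1)) * famInt quadPoly θ μ Φ =
      ∑ l, polyWeight m l μ * famInt quadPoly θ (μ + 1) (polyOp l Φ) := by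
  have hθ' : θ ∈ ({0}ᶜ : Set (PolyCoeff p q)) := hθ
  have hμ1 : 0 < (μ - 1).re := by simp; linarith
  have hμ0 : 0 < μ.re := by linarith
  have hμne : μ ≠ 0 := by rintro rfl; simp at hμ0
  have hμne1 : μ + 1 ≠ 0 := by
    intro h
    have := congrArg Complex.re h
    simp at this
    linarith
  have hk := contDiff_imPoly θ
  have hre := re_imPoly θ
  have hc1 := continuous_cpow_comp hk.continuous hre hμ1
  have hc0 := continuous_cpow_comp hk.continuous hre hμ0
  have hΦc : Continuous (Φ.toFun θ) := (Φ.slice hθ').continuous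
  have hNc : Continuous (quadPolyNorm θ) :=
    contDiff_quadPolyNorm.continuous.comp (Continuous.prodMk_right θ)
  have hkc : Continuous (quadPoly θ) :=
    contDiff_quadPoly.continuous.comp (Continuous.prodMk_right θ)
  have hdc : ∀ i, Continuous (quadPolyDeriv θ i) := fun i =>
    (contDiff_quadPolyDeriv i).continuous.comp (Continuous.prodMk_right θ)
  have hN := quadPolyNorm_ne_zero hθ
  have hint : ∀ g : Flat p q → ℂ, Continuous g → Integrable fun x => g x * Φ.toFun θ x :=
    fun g hg => integrable_mul_tst hg (Φ.slice hθ')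
  have hdiv : ∀ g : Flat p q → ℝ, Continuous g →
      Continuous fun x => ((g x / quadPolyNorm θ x : ℝ) : ℂ) :=
    fun g hg => Complex.continuous_ofReal.comp (hg.div hNc hN)
  -- The integrands of the three groups of terms add up to `(μ+1) (μ+m+1) (-i k) ^ μ` times
  -- `c²`, `∑ (∂ᵢ k)²` and `k²`, respectively, divided by `quadPolyNorm`, the sum of these squares.
  -- In the first group this uses that the gradient of `k` has the square length `4 c k`.
  have t1 : ∀ i, polyWeight m (Sum.inl i : Idx p q ⊕ Idx p q ⊕ Unit) μ *
      famInt quadPoly θ (μ + 1) (polyOp (Sum.inl i) Φ) = ∫ x, (Complex.I / 4 * (μ + 1) *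
        (μ * imPoly θ x ^ (μ - 1) * (-(quadPolyDeriv θ i x : ℂ) ^ 2) +
          imPoly θ x ^ μ * (-Complex.I * (2 * θ.2.2 * realSigns p q i : ℝ))) *
        ((realSigns p q i * θ.2.2 / quadPolyNorm θ x : ℝ) : ℂ)) * Φ.toFun θ x := by
    intro i
    rw [famInt_quadPoly θ hθ', polyOp, Fam.slice_pd _ _ _ hθ', Fam.slice_pd _ _ _ hθ',
      powInt_add_one_pdT_pdT hk hre hμ, polyWeight, ← mul_assoc, ← integral_const_mul]
    refine integral_congr_ae (Eventually.of_forall fun x => ?_)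
    simp only [pderiv_pderiv_imPoly, Fam.slice_apply, Fam.mul]
    rw [pderiv_imPoly]
    have := Complex.I_mul_I
    linear_combination (Complex.I / 4 * (μ + 1) * (μ * imPoly θ x ^ (μ - 1) *
      ((quadPolyDeriv θ i x : ℂ) ^ 2)) * ((realSigns p q i * θ.2.2 / quadPolyNorm θ x : ℝ) : ℂ) *
      Φ.toFun θ x) * this
  have t2 : ∀ i, polyWeight m (Sum.inr (Sum.inl i) : Idx p q ⊕ Idx p q ⊕ Unit) μ *
      famInt quadPoly θ (μ + 1) (polyOp (Sum.inr (Sum.inl i)) Φ) = ∫ x, ((μ + 1) * (μ + (m + 1)) *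
        (imPoly θ x ^ μ * (quadPolyDeriv θ i x : ℂ) *
        ((quadPolyDeriv θ i x / quadPolyNorm θ x : ℝ) : ℂ))) * Φ.toFun θ x := by
    intro i
    rw [famInt_quadPoly θ hθ', polyOp, Fam.slice_pd _ _ _ hθ', powInt_add_one_pdT hk hre hμ0,
      polyWeight, ← mul_assoc, powInt, ← integral_const_mul]
    refine integral_congr_ae (Eventually.of_forall fun x => ?_)
    simp only [Fam.slice_apply, Fam.mul, mulTst_apply]
    rw [pderiv_imPoly]
    have := Complex.I_mul_I
    linear_combination (-(μ + 1) * (μ + (m + 1)) *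
        (imPoly θ x ^ μ * (quadPolyDeriv θ i x : ℂ) *
        ((quadPolyDeriv θ i x / quadPolyNorm θ x : ℝ) : ℂ)) * Φ.toFun θ x) * this
  have t3 : polyWeight m (Sum.inr (Sum.inr ()) : Idx p q ⊕ Idx p q ⊕ Unit) μ *
      famInt quadPoly θ (μ + 1) (polyOp (Sum.inr (Sum.inr ())) Φ) = ∫ x, ((μ + 1) * (μ + (m + 1)) *
        (imPoly θ x ^ μ * (quadPoly θ x : ℂ) *
        ((quadPoly θ x / quadPolyNorm θ x : ℝ) : ℂ))) * Φ.toFun θ x := by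
    rw [famInt_quadPoly θ hθ', polyOp, polyWeight, powInt, ← integral_const_mul]
    refine integral_congr_ae (Eventually.of_forall fun x => ?_)
    simp only [Fam.slice_apply, Fam.mul]
    have h1 := cpow_sub_one_mul (w := imPoly θ x) hμne1
    rw [add_sub_cancel_right] at h1
    rw [← h1]
    have := Complex.I_mul_I
    have h2 : imPoly θ x = -Complex.I * (quadPoly θ x : ℂ) := rfl
    generalize imPoly θ x ^ μ = A
    rw [h2]
    linear_combination (-(μ + 1) * (μ + (m + 1)) *
        (A * (quadPoly θ x : ℂ) *
        ((quadPoly θ x / quadPolyNorm θ x : ℝ) : ℂ)) * Φ.toFun θ x) * this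
  have hsplit : ∀ f : Idx p q ⊕ Idx p q ⊕ Unit → ℂ, ∑ l, f l =
      ∑ i, f (Sum.inl i) + (∑ i, f (Sum.inr (Sum.inl i)) + f (Sum.inr (Sum.inr ()))) := by
    intro f
    rw [Fintype.sum_sum_type f, Fintype.sum_sum_type (fun i => f (Sum.inr i))]
    simp only [Finset.univ_unique, Finset.sum_singleton]
  rw [hsplit, t3]
  simp only [t1, t2]
  have i1 : ∀ i, Integrable fun x => (Complex.I / 4 * (μ + 1) *
        (μ * imPoly θ x ^ (μ - 1) * (-(quadPolyDeriv θ i x : ℂ) ^ 2) +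
          imPoly θ x ^ μ * (-Complex.I * (2 * θ.2.2 * realSigns p q i : ℝ))) *
        ((realSigns p q i * θ.2.2 / quadPolyNorm θ x : ℝ) : ℂ)) * Φ.toFun θ x := fun i =>
    hint _ ((continuous_const.mul (((continuous_const.mul hc1).mul
      ((Complex.continuous_ofReal.comp (hdc i)).pow 2).neg).add (hc0.mul continuous_const))).mul
        (hdiv (fun _ => realSigns p q i * θ.2.2) continuous_const))
  have i2 : ∀ i, Integrable fun x => ((μ + 1) * (μ + (m + 1)) *
        (imPoly θ x ^ μ * (quadPolyDeriv θ i x : ℂ) *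
        ((quadPolyDeriv θ i x / quadPolyNorm θ x : ℝ) : ℂ))) * Φ.toFun θ x := fun i =>
    hint _ (continuous_const.mul ((hc0.mul (Complex.continuous_ofReal.comp (hdc i))).mul
      (hdiv _ (hdc i))))
  have i3 : Integrable fun x => ((μ + 1) * (μ + (m + 1)) *
        (imPoly θ x ^ μ * (quadPoly θ x : ℂ) *
        ((quadPoly θ x / quadPolyNorm θ x : ℝ) : ℂ))) * Φ.toFun θ x :=
    hint _ (continuous_const.mul ((hc0.mul (Complex.continuous_ofReal.comp hkc)).mul
      (hdiv _ hkc)))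
  rw [← integral_finsetSum _ fun i _ => i1 i, ← integral_finsetSum _ fun i _ => i2 i,
    ← integral_add (integrable_finsetSum _ fun i _ => i2 i) i3,
    ← integral_add (integrable_finsetSum _ fun i _ => i1 i)
      ((integrable_finsetSum _ fun i _ => i2 i).fun_add i3)]
  rw [famInt, ← integral_const_mul]
  refine integral_congr_ae (Eventually.of_forall fun x => ?_)
  simp only
  have hq1 := cpow_sub_one_mul (w := imPoly θ x) hμne
  have h2 : imPoly θ x = -Complex.I * (quadPoly θ x : ℂ) := rfl
  have hcone : ∑ i, (realSigns p q i : ℂ) * (quadPolyDeriv θ i x : ℂ) ^ 2 =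
      4 * (θ.2.2 : ℂ) * (quadPoly θ x : ℂ) := by
    exact_mod_cast congrArg (fun r : ℝ => (r : ℂ)) (hc.sum_quadPolyDeriv_sq x)
  have hcard : (Fintype.card (Idx p q) : ℂ) = 2 * (m + 1) := by
    rw [card_idx hm]
    push_cast
    ring
  have s1 : ∑ i, (Complex.I / 4 * (μ + 1) *
        (μ * imPoly θ x ^ (μ - 1) * (-(quadPolyDeriv θ i x : ℂ) ^ 2) +
          imPoly θ x ^ μ * (-Complex.I * (2 * θ.2.2 * realSigns p q i : ℝ))) *
        ((realSigns p q i * θ.2.2 / quadPolyNorm θ x : ℝ) : ℂ)) * Φ.toFun θ x =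
      (μ + 1) * (μ + (m + 1)) * (imPoly θ x ^ μ * ((θ.2.2 ^ 2 / quadPolyNorm θ x : ℝ) : ℂ)) *
        Φ.toFun θ x := by
    have e : ∀ i, (Complex.I / 4 * (μ + 1) *
        (μ * imPoly θ x ^ (μ - 1) * (-(quadPolyDeriv θ i x : ℂ) ^ 2) +
          imPoly θ x ^ μ * (-Complex.I * (2 * θ.2.2 * realSigns p q i : ℝ))) *
        ((realSigns p q i * θ.2.2 / quadPolyNorm θ x : ℝ) : ℂ)) * Φ.toFun θ x =
        (-Complex.I / 4 * (μ + 1) * μ * imPoly θ x ^ (μ - 1) * (θ.2.2 / quadPolyNorm θ x : ℝ) *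
          Φ.toFun θ x) * ((realSigns p q i : ℂ) * (quadPolyDeriv θ i x : ℂ) ^ 2) +
        (μ + 1) / 2 * imPoly θ x ^ μ * (θ.2.2 ^ 2 / quadPolyNorm θ x : ℝ) * Φ.toFun θ x := by
      intro i
      have hs : (realSigns p q i : ℂ) * (realSigns p q i : ℂ) = 1 := by
        exact_mod_cast congrArg (fun r : ℝ => (r : ℂ)) (realSigns_mul_self i)
      have hI := Complex.I_mul_I
      push_cast
      linear_combination (-(Complex.I * Complex.I) / 2 * (μ + 1) * imPoly θ x ^ μ *
        ((θ.2.2 : ℂ) ^ 2 / (quadPolyNorm θ x : ℂ)) * Φ.toFun θ x) * hs -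
        ((μ + 1) / 2 * imPoly θ x ^ μ * ((θ.2.2 : ℂ) ^ 2 / (quadPolyNorm θ x : ℂ)) *
          Φ.toFun θ x) * hI
    simp only [e, Finset.sum_add_distrib, ← Finset.mul_sum, hcone, Finset.sum_const,
      Finset.card_univ, nsmul_eq_mul, hcard]
    rw [← hq1, h2]
    push_cast
    ring
  have s2 : ∀ A : ℂ, ∑ i, A * (imPoly θ x ^ μ * (quadPolyDeriv θ i x : ℂ) *
        ((quadPolyDeriv θ i x / quadPolyNorm θ x : ℝ) : ℂ)) * Φ.toFun θ x =
      A * (imPoly θ x ^ μ * (((∑ i, quadPolyDeriv θ i x ^ 2) / quadPolyNorm θ x : ℝ) : ℂ)) *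
        Φ.toFun θ x := by
    intro A
    push_cast
    rw [Finset.sum_div, Finset.mul_sum, Finset.mul_sum, Finset.sum_mul]
    exact Finset.sum_congr rfl fun i _ => by ring
  rw [s1, s2]
  have hone : ((θ.2.2 ^ 2 / quadPolyNorm θ x : ℝ) : ℂ) +
      (((∑ i, quadPolyDeriv θ i x ^ 2) / quadPolyNorm θ x : ℝ) : ℂ) +
      (quadPoly θ x : ℂ) * ((quadPoly θ x / quadPolyNorm θ x : ℝ) : ℂ) = 1 := by
    norm_cast
    rw [← mul_div_assoc, ← add_div, ← add_div, ← pow_two]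
    exact div_self (hN x)
  rw [← h2]
  linear_combination (-(μ + 1) * (μ + (m + 1)) * imPoly θ x ^ μ * Φ.toFun θ x) * hone

end

section

/-! ### Smoothness in the coefficients of the polynomial -/

variable {p q m : ℕ}

/-- `K`-fold application of the functional equation to `∫ (-i k) ^ μ φ`, `k = quadPoly θ`. -/
def polyRaise (m K : ℕ) (θ : PolyCoeff p q) (φ : CcInfty p q) (μ : ℂ) : ℂ :=
  raise (famInt quadPoly θ) (polyWeight m) polyOp K μ (Fam.const ({0}ᶜ : Set (PolyCoeff p q)) φ)

/-- For a cone polynomial `k = quadPoly θ`, the value at `μ = -m` of the analytic continuation of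
`∫ (-i k) ^ μ φ`, as the mean over a circle which avoids the zeros of the polynomial `bern`. -/
def polyVal (m : ℕ) (φ : CcInfty p q) (θ : PolyCoeff p q) : ℂ :=
  Real.circleAverage (fun μ => polyRaise m (m + 1) θ φ μ / bern (m + 1) (m + 1) μ)
    (-(m : ℂ)) (1 / 2)

theorem differentiableOn_polyRaise (K : ℕ) {θ : PolyCoeff p q} (hθ : θ ≠ 0) (φ : CcInfty p q) :
    DifferentiableOn ℂ (polyRaise m K θ φ) {μ | -(K : ℝ) < μ.re} :=
  differentiableOn_raise (fun Φ => differentiableOn_famInt contDiff_quadPoly hθ Φ)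
    (differentiable_polyWeight m) K _

theorem polyRaise_eq_bern_mul (hm : (p - 1) + (q - 1) = 2 * (m + 1)) {θ : PolyCoeff p q}
    (hθ : θ ≠ 0) (hc : IsConePoly θ) (K : ℕ) {μ : ℂ} (hμ : 1 < μ.re) (φ : CcInfty p q) :
    polyRaise m K θ φ μ = bern (m + 1) K μ * ∫ x, (-Complex.I * (quadPoly θ x : ℂ)) ^ μ * φ x :=
  raise_eq_bern_mul (fun _ h Φ => famInt_functional_equation hm hθ hc h Φ) K μ hμ _

theorem polyVal_eq (hm : (p - 1) + (q - 1) = 2 * (m + 1)) {θ : PolyCoeff p q}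
    (hθ : θ ≠ 0) (hc : IsConePoly θ) (j : ℕ) (φ : CcInfty p q) :
    polyVal m φ θ = Real.circleAverage (fun μ => (bern (m + 1) (m + 1 + j) μ)⁻¹ *
      polyRaise m (m + 1 + j) θ φ (μ + (0 : ℕ))) (-(m : ℂ)) (1 / 2) := by
  refine circleAverage_congr_norm fun μ hμ => ?_
  have h1 := re_gt_of_norm hμ.le
  have hd1 := differentiableOn_polyRaise (m := m) (m + 1) hθ φ
  have hd2 := (differentiableOn_polyRaise (m := m) (m + 1 + j) hθ φ).mono
    (s := {μ : ℂ | -((m + 1 : ℕ) : ℝ) < μ.re}) fun μ hμ => by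
      have hμ : -((m + 1 : ℕ) : ℝ) < μ.re := hμ
      have hj : (0 : ℝ) ≤ j := j.cast_nonneg
      simp only [mem_ofPred_eq]
      push_cast at hμ ⊢
      linarith
  have h2 := eqOn_re_gt_of_eqOn (b := 1)
    (hd1.mul (differentiable_bern (m + 1) (m + 1 + j)).differentiableOn)
    (hd2.mul (differentiable_bern (m + 1) (m + 1)).differentiableOn)
    (fun μ hμ => by
      simp only [Pi.mul_apply]
      rw [polyRaise_eq_bern_mul hm hθ hc _ hμ, polyRaise_eq_bern_mul hm hθ hc _ hμ]
      ring) μ (by push_cast; linarith)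
  simp only [Pi.mul_apply] at h2
  have hb1 := bern_ne_zero_of_norm hμ (m + 1)
  have hb2 := bern_ne_zero_of_norm hμ (m + 1 + j)
  rw [Nat.cast_zero, add_zero, div_eq_iff hb1, mul_assoc, ← h2]
  rw [mul_comm (polyRaise m (m + 1) θ φ μ), inv_mul_cancel_left₀ hb2]

/-- Along the cone polynomials the regularized integral is a smooth function of the
coefficients: raising the exponent further does not change it, and makes the integrand as many times
differentiable as desired. -/
theorem contDiffOn_polyVal_comp (hm : (p - 1) + (q - 1) = 2 * (m + 1)) {E : Type*}
    [NormedAddCommGroup E] [NormedSpace ℝ E] {S : Set E} {f : E → PolyCoeff p q}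
    (hf : ContDiffOn ℝ ∞ f S) (h0 : ∀ y ∈ S, f y ≠ 0) (hcone : ∀ y ∈ S, IsConePoly (f y))
    (φ : CcInfty p q) : ContDiffOn ℝ ∞ (fun y => polyVal m φ (f y)) S := by
  rw [contDiffOn_infty]
  intro j
  have hb : ContinuousOn (fun μ => (bern (m + 1) (m + 1 + j) μ)⁻¹)
      (Metric.sphere (-(m : ℂ)) (1 / 2)) := by
    refine (differentiable_bern _ _).continuous.continuousOn.inv₀ fun μ hμ => ?_
    rw [mem_sphere_iff_norm, sub_neg_eq_add] at hμ
    exact bern_ne_zero_of_norm hμ _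
  have h1 := contDiffOn_circleAverage_raise (k := quadPoly (p := p) (q := q)) (m := m) (j := j)
    contDiff_quadPoly isOpen_compl_singleton (differentiable_polyWeight m) (O := polyOp)
    (m + 1 + j) _ 0 (Fam.const _ φ) hb (by omega)
  refine (h1.comp (hf.of_le (by exact_mod_cast le_top)) fun y hy => h0 y hy).congr fun y hy => ?_
  exact polyVal_eq hm (h0 y hy) (hcone y hy) j φ

theorem mul_ofReal_pos_cpow {t : ℝ} (ht : 0 < t) (w μ : ℂ) :
    ((t : ℂ) * w) ^ μ = (t : ℂ) ^ μ * w ^ μ := by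
  have ht0 : (t : ℂ) ≠ 0 := by exact_mod_cast ht.ne'
  by_cases hw : w = 0
  · by_cases hμ : μ = 0 <;> simp [hw, hμ]
  · rw [Complex.cpow_def_of_ne_zero (mul_ne_zero ht0 hw), Complex.cpow_def_of_ne_zero ht0,
      Complex.cpow_def_of_ne_zero hw, Complex.log_ofReal_mul ht hw, ← Complex.exp_add,
      Complex.ofReal_log ht.le]
    ring_nf

/-- The regularized integral for a positive multiple of the polynomial `P(z - x)`. -/
theorem polyVal_eq_regP (hm : (p - 1) + (q - 1) = 2 * (m + 1)) {θ : PolyCoeff p q}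
    (hθ : θ ≠ 0) (hc : IsConePoly θ) {t : ℝ} (ht : 0 < t) {s : ℂ} (hs : s.re = 0) (hs0 : s ≠ 0)
    {z : Flat p q} (h : ∀ x, -Complex.I * (quadPoly θ x : ℂ) = t * (s * (quadP (z - x) : ℂ)))
    (φ : CcInfty p q) : polyVal m φ θ = (t : ℂ) ^ (-(m : ℂ)) * regP p q m s (reflT φ z) := by
  have ht0 : (t : ℂ) ≠ 0 := by exact_mod_cast ht.ne'
  obtain ⟨V, hV, hV1, hV2, -⟩ := exists_continuation (card_idx hm) (isSymm_smul_signJ s)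
    (isUnit_det_smul_signJ hs0) (re_qform_smul_signJ (p := p) (q := q) hs) (reflT φ z)
  have hint : ∀ μ : ℂ, 1 < μ.re → ∫ x, (-Complex.I * (quadPoly θ x : ℂ)) ^ μ * φ x =
      (t : ℂ) ^ μ * V μ := by
    intro μ hμ
    rw [hV1 μ (by linarith), powInt, ← integral_const_mul, ← integral_sub_left_eq_self _ volume z]
    refine integral_congr_ae (Eventually.of_forall fun x => ?_)
    simp only [h, sub_sub_cancel, reflT_apply, qform_smul_signJ, mul_ofReal_pos_cpow ht]
    ring
  have hpow : Differentiable ℂ fun μ : ℂ => (t : ℂ) ^ μ := fun μ =>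
    (differentiableAt_id).const_cpow (Or.inl ht0)
  have hV' : DifferentiableOn ℂ V {μ | -((m + 1 : ℕ) : ℝ) < μ.re} := by
    convert hV using 4
    push_cast
    ring
  have h2 := eqOn_re_gt_of_eqOn (b := 1) (differentiableOn_polyRaise (m := m) (m + 1) hθ φ)
    ((differentiable_bern (m + 1) (m + 1)).differentiableOn.mul
      (hpow.differentiableOn.mul hV'))
    (fun μ hμ => by
      simp only [Pi.mul_apply]
      rw [polyRaise_eq_bern_mul hm hθ hc _ hμ, hint μ hμ])
  rw [polyVal, regP, ← hV2, ← circleAverage_eq_of_differentiableOn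
    (f := fun μ => (t : ℂ) ^ μ * V μ) (hpow.differentiableOn.mul hV)]
  refine circleAverage_congr_norm fun μ hμ => ?_
  have h1 := re_gt_of_norm hμ.le
  rw [h2 μ (by push_cast; linarith)]
  simp only [Pi.mul_apply]
  rw [mul_div_cancel_left₀ _ (bern_ne_zero_of_norm hμ _)]

/-! ### The polynomials attached to the points of the light cone -/

/-- `ℝ^p` and `ℝ^q`, as the ambient spaces of the spheres. -/
abbrev Amb (p : ℕ) : Type := EuclideanSpace ℝ (Fin (p - 1 + 1))

/-- The coefficients of the polynomial `x ↦ -2 (⟪u, ι'(x)⟫ - ⟪v, ι''(x)⟫)`. -/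
def coneCoeff (W : Amb p × Amb q) : PolyCoeff p q :=
  (-2 * (W.1 0 - W.2 (Fin.last _)), WithLp.toLp 2 (Sum.elim (fun i => -2 * W.1 i.succ)
    (fun j => 2 * W.2 j.castSucc)), (W.1 0 + W.2 (Fin.last _)) / 2)

theorem contDiff_coneCoeff : ContDiff ℝ ∞ (coneCoeff : Amb p × Amb q → PolyCoeff p q) := by
  unfold coneCoeff
  have h1 : ∀ i, ContDiff ℝ ∞ fun W : Amb p × Amb q => W.1 i := fun i =>
    (contDiff_apply_coord i).comp contDiff_fst
  have h2 : ∀ i, ContDiff ℝ ∞ fun W : Amb p × Amb q => W.2 i := fun i =>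
    (contDiff_apply_coord i).comp contDiff_snd
  refine (contDiff_const.mul ((h1 _).sub (h2 _))).prodMk (ContDiff.prodMk ?_ ?_)
  · rw [contDiff_euclidean]
    rintro (i | i)
    · exact contDiff_const.mul (h1 _)
    · exact contDiff_const.mul (h2 _)
  · exact ((h1 _).add (h2 _)).div_const _

theorem coneCoeff_smul (t : ℝ) (W : Amb p × Amb q) : coneCoeff (t • W) = t • coneCoeff W := by
  unfold coneCoeff
  refine Prod.ext ?_ (Prod.ext ?_ ?_)
  · simp
    ring
  · ext (i | i)
    · simp
      ring
    · simp
      ring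
  · simp
    ring

theorem isConePoly_coneCoeff {W : Amb p × Amb q} (h : ‖W.1‖ = ‖W.2‖) :
    IsConePoly (coneCoeff W) := by
  have h1 : ‖W.1‖ ^ 2 = ‖W.2‖ ^ 2 := by rw [h]
  rw [EuclideanSpace.norm_sq_eq, EuclideanSpace.norm_sq_eq, Fin.sum_univ_succ,
    Fin.sum_univ_castSucc] at h1
  simp only [Real.norm_eq_abs, sq_abs] at h1
  rw [IsConePoly, Fintype.sum_sum_type]
  simp only [coneCoeff, realSigns, Sum.elim_inl, Sum.elim_inr, mul_pow, one_mul, neg_mul, one_mul,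
    Finset.sum_neg_distrib, ← Finset.mul_sum, neg_sq]
  linear_combination 4 * h1

theorem coneCoeff_ne_zero {W : Amb p × Amb q} (h : W.1 ≠ 0) : coneCoeff W ≠ 0 := by
  intro h0
  apply h
  have ha : -2 * (W.1 0 - W.2 (Fin.last _)) = 0 := congrArg Prod.fst h0
  have hc : (W.1 0 + W.2 (Fin.last _)) / 2 = 0 := congrArg (fun θ => θ.2.2) h0
  have hb : ∀ i : Fin (p - 1), -2 * W.1 i.succ = 0 := fun i =>
    congrArg (fun θ : PolyCoeff p q => θ.2.1 (Sum.inl i)) h0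
  ext i
  refine Fin.cases ?_ (fun i => ?_) i
  · simp only [PiLp.zero_apply]
    linarith
  · have := hb i
    simp only [PiLp.zero_apply]
    linarith

/-- The point `ι(z)` of the light cone. -/
def iota (z : Flat p q) : Amb p × Amb q := (iotaFst z, iotaSnd z)

theorem quadPoly_smul (t : ℝ) (θ : PolyCoeff p q) (x : Flat p q) :
    quadPoly (t • θ) x = t * quadPoly θ x := by
  simp only [quadPoly, Prod.smul_fst, Prod.smul_snd, PiLp.smul_apply, smul_eq_mul, mul_add,
    Finset.mul_sum, mul_assoc]

theorem quadPoly_coneCoeff_iota (z x : Flat p q) : quadPoly (coneCoeff (iota z)) x = quadP (z - x) := by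
  have h1 : (iotaFst z) 0 = 1 - quadP z / 4 := by simp [iotaFst]
  have h2 : (iotaSnd z) (Fin.last _) = 1 + quadP z / 4 := by simp [iotaSnd]
  have h3 : ∀ i : Fin (p - 1), (iotaFst z) i.succ = z (Sum.inl i) := by simp [iotaFst]
  have h4 : ∀ i : Fin (q - 1), (iotaSnd z) i.castSucc = z (Sum.inr i) := by simp [iotaSnd]
  rw [quadPoly, Fintype.sum_sum_type]
  simp only [coneCoeff, iota, h1, h2, h3, h4, Sum.elim_inl, Sum.elim_inr]
  simp only [quadP, PiLp.sub_apply, sub_sq, Finset.sum_add_distrib, Finset.sum_sub_distrib,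
    mul_assoc, ← Finset.mul_sum]
  ring

end

section

/-! ### The Laplace operator of the sphere -/

section curves

variable {E : Type*} [NormedAddCommGroup E] [NormedSpace ℝ E]

/-- The second derivative of a function along a curve. -/
theorem deriv_deriv_comp_curve {g : E → ℂ} {γ γ' : ℝ → E} {a : E} (hg : ContDiffAt ℝ 2 g (γ 0))
    (hγ : ∀ᶠ t in 𝓝 0, HasDerivAt γ (γ' t) t) (hγ' : HasDerivAt γ' a 0) :
    deriv (deriv fun t => g (γ t)) 0 =
      fderiv ℝ (fderiv ℝ g) (γ 0) (γ' 0) (γ' 0) + fderiv ℝ g (γ 0) a := by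
  have h0 : HasDerivAt γ (γ' 0) 0 := hγ.self_of_nhds
  have hd : ∀ᶠ x in 𝓝 (γ 0), DifferentiableAt ℝ g x := by
    filter_upwards [hg.eventually (by simp)] with x hx using hx.differentiableAt (by simp)
  have h1 : deriv (fun t => g (γ t)) =ᶠ[𝓝 0] fun t => fderiv ℝ g (γ t) (γ' t) := by
    filter_upwards [hγ, h0.continuousAt.eventually hd] with t ht hgt
    exact (hgt.hasFDerivAt.comp_hasDerivAt t ht).deriv
  rw [h1.deriv_eq]
  have h2 : HasFDerivAt (fderiv ℝ g) (fderiv ℝ (fderiv ℝ g) (γ 0)) (γ 0) :=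
    ((hg.fderiv_right (m := 1) (by norm_num)).differentiableAt (by simp)).hasFDerivAt
  exact ((h2.comp_hasDerivAt (0 : ℝ) h0).clm_apply hγ').deriv

theorem deriv_deriv_comp_line {g : E → ℂ} {x : E} (hg : ContDiffAt ℝ 2 g x) (e : E) :
    deriv (deriv fun t : ℝ => g (x + t • e)) 0 = fderiv ℝ (fderiv ℝ g) x e e := by
  have h := deriv_deriv_comp_curve (g := g) (γ := fun t : ℝ => x + t • e) (γ' := fun _ => e) (a := 0)
    (by simpa using hg)
    (Eventually.of_forall fun t => by
      simpa using ((hasDerivAt_id t).smul_const e).const_add x) (hasDerivAt_const _ _)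
  simpa using h

theorem deriv_deriv_congr {f g : ℝ → ℂ} (h : f =ᶠ[𝓝 0] g) :
    deriv (deriv f) 0 = deriv (deriv g) 0 := h.deriv.deriv_eq

end curves

theorem laplacian_eq_sum_fderiv {ι : Type*} [Fintype ι] [DecidableEq ι] {f : EuclideanSpace ℝ ι → ℂ}
    (x : EuclideanSpace ℝ ι) : Laplacian.laplacian f x =
      ∑ i, fderiv ℝ (fderiv ℝ f) x (EuclideanSpace.single i 1) (EuclideanSpace.single i 1) := by
  rw [InnerProductSpace.laplacian_eq_iteratedFDeriv_orthonormalBasis f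
    (EuclideanSpace.basisFun ι ℝ)]
  simp [iteratedFDeriv_two_apply]

theorem contDiffAt_normalize {E : Type*} [NormedAddCommGroup E] [InnerProductSpace ℝ E] {x : E}
    (hx : x ≠ 0) : ContDiffAt ℝ ∞ (fun x : E => ‖x‖⁻¹ • x) x :=
  ((contDiffAt_norm ℝ hx).inv (norm_ne_zero_iff.2 hx)).smul contDiffAt_id

section normalizedLine

variable {ι : Type*} [Fintype ι] [DecidableEq ι]

theorem norm_sq_add_single (u : EuclideanSpace ℝ ι) (i : ι) (t : ℝ) :
    ‖u + t • EuclideanSpace.single i (1 : ℝ)‖ ^ 2 = ‖u‖ ^ 2 + 2 * t * u i + t ^ 2 := by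
  rw [norm_add_sq_real, norm_smul, inner_smul_right, EuclideanSpace.inner_single_right]
  simp
  ring

theorem hasDerivAt_inv_norm_line {u : EuclideanSpace ℝ ι} {i : ι} {t : ℝ}
    (h : u + t • EuclideanSpace.single i (1 : ℝ) ≠ 0) :
    HasDerivAt (fun t : ℝ => ‖u + t • EuclideanSpace.single i (1 : ℝ)‖⁻¹)
      (-(u i + t) * ‖u + t • EuclideanSpace.single i (1 : ℝ)‖⁻¹ ^ 3) t := by
  have hn := norm_ne_zero_iff.2 h
  have hQ : HasDerivAt (fun t : ℝ => ‖u‖ ^ 2 + 2 * t * u i + t ^ 2) (2 * u i + 2 * t) t := by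
    have := ((((hasDerivAt_id t).const_mul 2).mul_const (u i)).const_add (‖u‖ ^ 2)).fun_add
      ((hasDerivAt_id t).fun_pow 2)
    refine this.congr_deriv ?_
    simp
  have e : (fun t : ℝ => ‖u + t • EuclideanSpace.single i (1 : ℝ)‖⁻¹) =
      fun t => (√(‖u‖ ^ 2 + 2 * t * u i + t ^ 2))⁻¹ := by
    funext t
    rw [← norm_sq_add_single, Real.sqrt_sq (norm_nonneg _)]
  have hs : √(‖u‖ ^ 2 + 2 * t * u i + t ^ 2) = ‖u + t • EuclideanSpace.single i (1 : ℝ)‖ := by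
    rw [← norm_sq_add_single, Real.sqrt_sq (norm_nonneg _)]
  rw [e]
  have h1 := (hQ.sqrt (by rw [← norm_sq_add_single]; exact pow_ne_zero 2 hn)).fun_inv
    (by rw [hs]; exact hn)
  refine h1.congr_deriv ?_
  rw [hs]
  field_simp

/-- The second derivative of a function along a normalized line through a point of the sphere. -/
theorem deriv_deriv_normalize_line {g : EuclideanSpace ℝ ι → ℂ} {u : EuclideanSpace ℝ ι}
    (hu : ‖u‖ = 1) (hg : ContDiffAt ℝ 2 g u) (i : ι) :
    deriv (deriv fun t : ℝ => g (‖u + t • EuclideanSpace.single i (1 : ℝ)‖⁻¹ •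
      (u + t • EuclideanSpace.single i (1 : ℝ)))) 0 =
      fderiv ℝ (fderiv ℝ g) u (EuclideanSpace.single i 1 - u i • u)
        (EuclideanSpace.single i 1 - u i • u) +
      fderiv ℝ g u ((3 * u i ^ 2 - 1) • u - (2 * u i) • EuclideanSpace.single i 1) := by
  set e : EuclideanSpace ℝ ι := EuclideanSpace.single i 1 with he
  set ρ : ℝ → ℝ := fun t => ‖u + t • e‖⁻¹ with hρ
  have hρ0 : ρ 0 = 1 := by simp [hρ, hu]
  have hline : ∀ t, HasDerivAt (fun t : ℝ => u + t • e) e t := fun t => by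
    simpa using ((hasDerivAt_id t).smul_const e).const_add u
  have hne : ∀ᶠ t in 𝓝 (0 : ℝ), u + t • e ≠ 0 := by
    refine (hline 0).continuousAt.eventually_ne ?_
    rw [zero_smul, add_zero, ← norm_ne_zero_iff, hu]
    exact one_ne_zero
  have hρ' : ∀ᶠ t in 𝓝 (0 : ℝ), HasDerivAt ρ (-(u i + t) * ρ t ^ 3) t := by
    filter_upwards [hne] with t ht using hasDerivAt_inv_norm_line ht
  have h1 : ∀ᶠ t in 𝓝 (0 : ℝ), HasDerivAt (fun t => ρ t • (u + t • e))
      (ρ t • e + (-(u i + t) * ρ t ^ 3) • (u + t • e)) t := by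
    filter_upwards [hρ'] with t ht using ht.fun_smul (hline t)
  have hρ0' : HasDerivAt ρ (-(u i)) 0 := by
    refine hρ'.self_of_nhds.congr_deriv ?_
    rw [hρ0]
    ring
  have h2 : HasDerivAt (fun t => -(u i + t) * ρ t ^ 3) (3 * u i ^ 2 - 1) 0 := by
    refine (((hasDerivAt_id (0 : ℝ)).const_add (u i)).fun_neg.fun_mul
      (hρ0'.fun_pow 3)).congr_deriv ?_
    rw [hρ0]
    simp
    ring
  have h3 : HasDerivAt (fun t => ρ t • e + (-(u i + t) * ρ t ^ 3) • (u + t • e))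
      ((3 * u i ^ 2 - 1) • u - (2 * u i) • e) 0 := by
    refine ((hρ0'.smul_const e).fun_add (h2.fun_smul (hline 0))).congr_deriv ?_
    rw [hρ0, zero_smul, add_zero]
    module
  have h := deriv_deriv_comp_curve (g := g) (by simpa [hρ0] using hg) h1 h3
  simp only [hρ0, zero_smul, add_zero, one_smul, one_pow, mul_one, neg_smul] at h
  rw [h, ← sub_eq_add_neg]

end normalizedLine

theorem radialExt_eq {k : ℕ} (f : Sph k → ℂ) {g : EuclideanSpace ℝ (Fin (k + 1)) → ℂ}
    {x : EuclideanSpace ℝ (Fin (k + 1))} (hx : x ≠ 0)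
    (h : ∀ w : Sph k, w.1 = ‖x‖⁻¹ • x → f w = g w.1) : radialExt f x = g (‖x‖⁻¹ • x) := by
  rw [radialExt, dif_pos hx]
  exact h _ rfl

/-- The Laplace operator of the sphere, in terms of the derivatives of an extension of the function
to a neighbourhood of a point in the ambient space. -/
theorem sphereLaplacian_eq {k : ℕ} {f : Sph k → ℂ} {u : Sph k}
    {g : EuclideanSpace ℝ (Fin (k + 1)) → ℂ} (hg : ContDiffAt ℝ 2 g u.1)
    (h : ∀ᶠ x in 𝓝 u.1, radialExt f x = g (‖x‖⁻¹ • x)) :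
    sphereLaplacian f u = ∑ i, fderiv ℝ (fderiv ℝ g) u.1 (EuclideanSpace.single i 1)
      (EuclideanSpace.single i 1) - fderiv ℝ (fderiv ℝ g) u.1 u.1 u.1 - k * fderiv ℝ g u.1 u.1 := by
  have hu : ‖u.1‖ = 1 := norm_eq_of_mem_sphere u
  have hu0 : u.1 ≠ 0 := by
    rw [← norm_ne_zero_iff, hu]
    exact one_ne_zero
  have hN : ‖u.1‖⁻¹ • u.1 = u.1 := by rw [hu, inv_one, one_smul]
  have hc : ContDiffAt ℝ 2 (fun x : EuclideanSpace ℝ (Fin (k + 1)) => g (‖x‖⁻¹ • x)) u.1 :=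
    ContDiffAt.comp (g := g) (f := fun x : EuclideanSpace ℝ (Fin (k + 1)) => ‖x‖⁻¹ • x) _
      (by rw [hN]; exact hg) ((contDiffAt_normalize hu0).of_le
        (by simpa using WithTop.coe_le_coe.2 (le_top : (2 : ℕ∞) ≤ ⊤)))
  have h' : radialExt f =ᶠ[𝓝 u.1] fun x => g (‖x‖⁻¹ • x) := h
  rw [sphereLaplacian, (InnerProductSpace.laplacian_congr_nhds h').self_of_nhds,
    laplacian_eq_sum_fderiv]
  simp only [← deriv_deriv_comp_line hc, deriv_deriv_normalize_line hu hg]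
  set B := fderiv ℝ (fderiv ℝ g) u.1
  set D := fderiv ℝ g u.1
  have hsum : ∑ i, u.1 i • EuclideanSpace.single i (1 : ℝ) = u.1 := by
    have := (EuclideanSpace.basisFun (Fin (k + 1)) ℝ).sum_repr u.1
    simpa using this
  have hsq : ∑ i, u.1 i ^ 2 = 1 := by
    have := EuclideanSpace.norm_sq_eq u.1
    rw [hu] at this
    simpa using this.symm
  have e1 : ∑ i, (u.1 i : ℂ) * B (EuclideanSpace.single i 1) u.1 = B u.1 u.1 := by
    have h1 : (∑ i, u.1 i • B (EuclideanSpace.single i 1)) u.1 = B u.1 u.1 := by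
      simp only [← map_smul, ← map_sum]
      rw [hsum]
    rw [← h1, sum_apply]
    simp
  have e2 : ∑ i, (u.1 i : ℂ) * B u.1 (EuclideanSpace.single i 1) = B u.1 u.1 := by
    have h1 : ∑ i, u.1 i • B u.1 (EuclideanSpace.single i 1) = B u.1 u.1 := by
      simp only [← map_smul, ← map_sum]
      rw [hsum]
    rw [← h1]
    simp
  have e3 : ∑ i, (u.1 i : ℂ) * D (EuclideanSpace.single i 1) = D u.1 := by
    conv_rhs => rw [← hsum, map_sum]
    simp
  have hsqc : ∑ i, (u.1 i : ℂ) ^ 2 = 1 := by exact_mod_cast congrArg (fun r : ℝ => (r : ℂ)) hsq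
  -- The summands are the second derivatives of `g` along the normalized coordinate lines.
  have e4 : ∀ i, B (EuclideanSpace.single i 1 - u.1 i • u.1)
        (EuclideanSpace.single i 1 - u.1 i • u.1) +
      D ((3 * u.1 i ^ 2 - 1) • u.1 - (2 * u.1 i) • EuclideanSpace.single i 1) =
      B (EuclideanSpace.single i 1) (EuclideanSpace.single i 1) -
        (u.1 i : ℂ) * B (EuclideanSpace.single i 1) u.1 -
        (u.1 i : ℂ) * B u.1 (EuclideanSpace.single i 1) + (u.1 i : ℂ) ^ 2 * B u.1 u.1 +
        3 * ((u.1 i : ℂ) ^ 2 * D u.1) - D u.1 -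
        2 * ((u.1 i : ℂ) * D (EuclideanSpace.single i 1)) := by
    intro i
    simp only [map_sub, map_smul, sub_apply, smul_apply,
      Complex.real_smul]
    push_cast
    ring
  simp only [e4, Finset.sum_add_distrib, Finset.sum_sub_distrib, ← Finset.mul_sum, e1, e2, e3,
    ← Finset.sum_mul, hsqc]
  simp
  ring

end

section

/-! ### Homogeneous extension and the Yamabe operator -/

section slices

variable {E F : Type*} [NormedAddCommGroup E] [NormedSpace ℝ E] [NormedAddCommGroup F]
  [NormedSpace ℝ F] {g : E × F → ℂ} {W : E × F}

theorem two_le_infty : (2 : WithTop ℕ∞) ≤ ∞ := by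
  simpa using WithTop.coe_le_coe.2 (le_top : (2 : ℕ∞) ≤ ⊤)

theorem contDiffAt_slice_left (hg : ContDiffAt ℝ 2 g W) :
    ContDiffAt ℝ 2 (fun x => g (x, W.2)) W.1 :=
  ContDiffAt.comp (g := g) (f := fun x => (x, W.2)) _ hg (contDiffAt_id.prodMk contDiffAt_const)

theorem contDiffAt_slice_right (hg : ContDiffAt ℝ 2 g W) :
    ContDiffAt ℝ 2 (fun y => g (W.1, y)) W.2 :=
  ContDiffAt.comp (g := g) (f := fun y => (W.1, y)) _ hg (contDiffAt_const.prodMk contDiffAt_id)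

theorem fderiv_slice_left (hg : ContDiffAt ℝ 2 g W) (e : E) :
    fderiv ℝ (fun x => g (x, W.2)) W.1 e = fderiv ℝ g W (e, 0) := by
  have h1 : HasFDerivAt g (fderiv ℝ g W) (W.1, W.2) :=
    (hg.differentiableAt (by simp)).hasFDerivAt
  have h2 : HasFDerivAt (fun x => g (x, W.2)) _ W.1 := h1.comp W.1 (hasFDerivAt_prodMk_left W.1 W.2)
  rw [h2.fderiv]
  simp

theorem fderiv_slice_right (hg : ContDiffAt ℝ 2 g W) (e : F) :
    fderiv ℝ (fun y => g (W.1, y)) W.2 e = fderiv ℝ g W (0, e) := by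
  have h1 : HasFDerivAt g (fderiv ℝ g W) (W.1, W.2) :=
    (hg.differentiableAt (by simp)).hasFDerivAt
  have h2 : HasFDerivAt (fun y => g (W.1, y)) _ W.2 :=
    h1.comp W.2 (hasFDerivAt_prodMk_right W.1 W.2)
  rw [h2.fderiv]
  simp

theorem fderiv_fderiv_slice_left (hg : ContDiffAt ℝ 2 g W) (e : E) :
    fderiv ℝ (fderiv ℝ fun x => g (x, W.2)) W.1 e e =
      fderiv ℝ (fderiv ℝ g) W (e, 0) (e, 0) := by
  rw [← deriv_deriv_comp_line (contDiffAt_slice_left hg), ← deriv_deriv_comp_line hg]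
  refine deriv_deriv_congr (Eventually.of_forall fun t => ?_)
  simp only
  congr 1
  ext <;> simp

theorem fderiv_fderiv_slice_right (hg : ContDiffAt ℝ 2 g W) (e : F) :
    fderiv ℝ (fderiv ℝ fun y => g (W.1, y)) W.2 e e =
      fderiv ℝ (fderiv ℝ g) W (0, e) (0, e) := by
  rw [← deriv_deriv_comp_line (contDiffAt_slice_right hg), ← deriv_deriv_comp_line hg]
  refine deriv_deriv_congr (Eventually.of_forall fun t => ?_)
  simp only
  congr 1
  ext <;> simp

/-- Euler's relations for the second derivatives of a homogeneous function. -/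
theorem fderiv_fderiv_of_homogeneous {d : ℂ} (hg : ContDiffAt ℝ 2 g W)
    (h : ∀ᶠ X in 𝓝 W, fderiv ℝ g X X = d * g X) :
    fderiv ℝ (fderiv ℝ g) W (W.1, 0) (W.1, 0) - fderiv ℝ (fderiv ℝ g) W (0, W.2) (0, W.2) =
      (d - 1) * (fderiv ℝ g W (W.1, 0) - fderiv ℝ g W (0, W.2)) := by
  have h2 : HasFDerivAt (fderiv ℝ g) (fderiv ℝ (fderiv ℝ g) W) W :=
    ((hg.fderiv_right (m := 1) (by norm_num)).differentiableAt (by simp)).hasFDerivAt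
  have h3 := h2.clm_apply (hasFDerivAt_id W)
  have h4 := ((hg.differentiableAt (by simp)).hasFDerivAt.const_mul d)
  have h5 := (h3.congr_of_eventuallyEq (f := fun X => fderiv ℝ g X (id X)) (f₁ := fun X => d * g X)
    (by filter_upwards [h] with X hX using hX.symm)).unique h4
  have key : ∀ X, fderiv ℝ (fderiv ℝ g) W X W + fderiv ℝ g W X = d * fderiv ℝ g W X := by
    intro X
    have := congrArg (fun L : (E × F) →L[ℝ] ℂ => L X) h5
    simp at this
    rw [← this, add_comm]
  have hW : W = (W.1, 0) + (0, W.2) := by ext <;> simp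
  have hs := (hg.isSymmSndFDerivAt (by simp)).eq (W.1, 0) (0, W.2)
  have k1 := key (W.1, 0)
  have k2 := key (0, W.2)
  have e1 : ∀ X, fderiv ℝ (fderiv ℝ g) W X W = fderiv ℝ (fderiv ℝ g) W X (W.1, 0) +
      fderiv ℝ (fderiv ℝ g) W X (0, W.2) := fun X => by rw [← map_add, ← hW]
  rw [e1] at k1 k2
  linear_combination k1 - k2 - hs

end slices

variable {p q m : ℕ}

/-- The linear form `(u₀ + v_{q-1}) / 2`, which takes the value `1` at `ι(z)`. -/
def cval (W : Amb p × Amb q) : ℝ := (W.1 0 + W.2 (Fin.last _)) / 2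

/-- The projection to `ℝⁿ` which maps `ι(z)` to `z`. -/
def flatPart (W : Amb p × Amb q) : Flat p q :=
  WithLp.toLp 2 (Sum.elim (fun i => W.1 i.succ) (fun j => W.2 j.castSucc))

/-- The homogeneous function of degree `-m` which extends the function `f(z)` of the point
`ι(z)`. -/
def homExt (m : ℕ) (f : Flat p q → ℂ) (W : Amb p × Amb q) : ℂ :=
  ((cval W : ℂ) ^ m)⁻¹ * f ((cval W)⁻¹ • flatPart W)

theorem contDiff_cval : ContDiff ℝ ∞ (cval : Amb p × Amb q → ℝ) :=
  (((contDiff_apply_coord _).comp contDiff_fst).add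
    ((contDiff_apply_coord _).comp contDiff_snd)).div_const _

theorem contDiff_flatPart : ContDiff ℝ ∞ (flatPart : Amb p × Amb q → Flat p q) := by
  rw [contDiff_euclidean]
  rintro (i | i)
  · have h : ContDiff ℝ ∞ fun W : Amb p × Amb q => W.1 i.succ :=
      (contDiff_apply_coord _).comp contDiff_fst
    exact h
  · have h : ContDiff ℝ ∞ fun W : Amb p × Amb q => W.2 i.castSucc :=
      (contDiff_apply_coord _).comp contDiff_snd
    exact h

theorem contDiffAt_homExt {f : Flat p q → ℂ} (hf : ContDiff ℝ ∞ f) {W : Amb p × Amb q}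
    (hc : cval W ≠ 0) : ContDiffAt ℝ ∞ (homExt m f) W := by
  have h1 : ContDiffAt ℝ ∞ (fun W : Amb p × Amb q => ((cval W : ℂ) ^ m)⁻¹) W :=
    ((Complex.ofRealCLM.contDiff.comp contDiff_cval).contDiffAt.pow m).inv
      (pow_ne_zero m (by simpa using hc))
  exact h1.mul (hf.contDiffAt.comp W ((contDiff_cval.contDiffAt.inv hc).smul
    contDiff_flatPart.contDiffAt))

theorem cval_smul (t : ℝ) (W : Amb p × Amb q) : cval (t • W) = t * cval W := by
  simp [cval]
  ring

theorem flatPart_smul (t : ℝ) (W : Amb p × Amb q) : flatPart (t • W) = t • flatPart W := by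
  ext (i | i) <;> simp [flatPart]

theorem homExt_smul (f : Flat p q → ℂ) {t : ℝ} (ht : t ≠ 0) (W : Amb p × Amb q) :
    homExt m f (t • W) = ((t : ℂ) ^ m)⁻¹ * homExt m f W := by
  rw [homExt, homExt, cval_smul, flatPart_smul, smul_smul, mul_inv_rev, mul_assoc,
    inv_mul_cancel₀ ht, mul_one]
  push_cast
  rw [mul_pow, mul_inv, mul_assoc]

theorem fderiv_homExt_self {f : Flat p q → ℂ} (hf : ContDiff ℝ ∞ f) {W : Amb p × Amb q}
    (hc : cval W ≠ 0) : fderiv ℝ (homExt m f) W W = -(m : ℂ) * homExt m f W := by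
  have h1 : HasFDerivAt (homExt m f) (fderiv ℝ (homExt m f) W) ((1 : ℝ) • W) := by
    rw [one_smul]
    exact ((contDiffAt_homExt hf hc).differentiableAt (by simp)).hasFDerivAt
  have h2 : HasDerivAt (fun t : ℝ => t • W) W 1 := by
    simpa using (hasDerivAt_id (1 : ℝ)).smul_const W
  have h3 := h1.comp_hasDerivAt (1 : ℝ) h2
  have h4 : HasDerivAt (fun t : ℝ => ((t : ℂ) ^ m)⁻¹ * homExt m f W)
      (-(m : ℂ) * homExt m f W) 1 := by
    have := (((Complex.ofRealCLM.hasDerivAt (x := (1 : ℝ))).fun_pow m).fun_inv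
      (by simp)).mul_const (homExt m f W)
    refine this.congr_deriv ?_
    simp
  refine h3.unique (h4.congr_of_eventuallyEq ?_)
  filter_upwards [isOpen_ne.mem_nhds (one_ne_zero : (1 : ℝ) ≠ 0)] with t ht
  exact homExt_smul f ht W

theorem deriv_deriv_homExt {f : Flat p q → ℂ} (hf : ContDiff ℝ ∞ f) {W X : Amb p × Amb q}
    {i : Idx p q} (hX : cval X = 0) (hX' : flatPart X = EuclideanSpace.single i 1) :
    deriv (deriv fun t : ℝ => homExt m f (W + t • X)) 0 =
      ((cval W : ℂ) ^ m)⁻¹ * ((cval W : ℂ)⁻¹ ^ 2 *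
        pderiv i (pderiv i f) ((cval W)⁻¹ • flatPart W)) := by
  have h1 : ∀ t : ℝ, cval (W + t • X) = cval W := by
    intro t
    have := hX
    simp only [cval] at this ⊢
    simp
    linear_combination 2 * t * this
  have h2 : ∀ t : ℝ, flatPart (W + t • X) = flatPart W + t • flatPart X := by
    intro t
    ext (i | i) <;> simp [flatPart]
  have h3 : (fun t : ℝ => homExt m f (W + t • X)) = fun t => ((cval W : ℂ) ^ m)⁻¹ *
      f ((cval W)⁻¹ • flatPart W + t • (cval W)⁻¹ • EuclideanSpace.single i (1 : ℝ)) := by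
    funext t
    rw [homExt, h1, h2, hX', smul_add, smul_comm t]
  have h4 : ∀ (a : ℂ) (h : ℝ → ℂ), deriv (deriv fun t => a * h t) 0 = a * deriv (deriv h) 0 := by
    intro a h
    have : deriv (fun t => a * h t) = fun t => a * deriv h t :=
      funext fun t => deriv_const_mul_field a
    rw [this, deriv_const_mul_field]
  rw [h3, h4 _ fun t => f ((cval W)⁻¹ • flatPart W + t • (cval W)⁻¹ • EuclideanSpace.single i (1 : ℝ)),
    deriv_deriv_comp_line (hf.contDiffAt.of_le two_le_infty), pderiv_pderiv hf]
  simp only [map_smul, smul_apply, Complex.real_smul, Complex.ofReal_inv]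
  ring

/-- The homogeneous extension of a solution of the ultrahyperbolic wave equation on `ℝⁿ` solves the
ultrahyperbolic wave equation on `ℝ^p × ℝ^q`. -/
theorem sum_fderiv_fderiv_homExt {f : Flat p q → ℂ} (hf : ContDiff ℝ ∞ f)
    (hbox : ∀ y, ∑ i, signs p q i * pderiv i (pderiv i f) y = 0) {W : Amb p × Amb q}
    (hc : cval W ≠ 0) :
    ∑ i, fderiv ℝ (fderiv ℝ (homExt m f)) W (EuclideanSpace.single i 1, 0)
      (EuclideanSpace.single i 1, 0) =
    ∑ j, fderiv ℝ (fderiv ℝ (homExt m f)) W (0, EuclideanSpace.single j 1)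
      (0, EuclideanSpace.single j 1) := by
  simp only [← deriv_deriv_comp_line ((contDiffAt_homExt hf hc).of_le two_le_infty)]
  rw [Fin.sum_univ_succ, Fin.sum_univ_castSucc]
  -- The first coordinate of `ℝ^p` and the last one of `ℝ^q` enter only through `cval`, and in the
  -- same way; so the second derivatives in their directions cancel.
  have h0 : (fun t : ℝ => homExt m f (W + t • ((EuclideanSpace.single 0 1, 0) : Amb p × Amb q))) =
      fun t : ℝ => homExt m f (W + t • ((0, EuclideanSpace.single (Fin.last _) 1) : Amb p × Amb q)) := by
    funext t
    have h1 : cval (W + t • ((EuclideanSpace.single 0 1, 0) : Amb p × Amb q)) =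
        cval (W + t • ((0, EuclideanSpace.single (Fin.last _) 1) : Amb p × Amb q)) := by
      simp [cval]
      ring
    have h2 : flatPart (W + t • ((EuclideanSpace.single 0 1, 0) : Amb p × Amb q)) =
        flatPart (W + t • ((0, EuclideanSpace.single (Fin.last _) 1) : Amb p × Amb q)) := by
      ext (i | i) <;> simp [flatPart]
    rw [homExt, homExt, h1, h2]
  have hl : ∀ i : Fin (p - 1), deriv (deriv fun t : ℝ => homExt m f
      (W + t • ((EuclideanSpace.single i.succ 1, 0) : Amb p × Amb q))) 0 = _ := fun i =>
    deriv_deriv_homExt (i := Sum.inl i) hf (by simp [cval, (Fin.succ_ne_zero i).symm]) (by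
      ext (j | j)
      · simp [flatPart]
      · simp [flatPart])
  have hr : ∀ i : Fin (q - 1), deriv (deriv fun t : ℝ => homExt m f
      (W + t • ((0, EuclideanSpace.single i.castSucc 1) : Amb p × Amb q))) 0 = _ := fun i =>
    deriv_deriv_homExt (i := Sum.inr i) hf (by simp [cval, (Fin.castSucc_ne_last i).symm]) (by
      ext (j | j)
      · simp [flatPart]
      · simp [flatPart])
  rw [h0]
  simp only [hl, hr, ← Finset.mul_sum]
  have hb := hbox ((cval W)⁻¹ • flatPart W)
  rw [Fintype.sum_sum_type] at hb
  simp only [signs, Sum.elim_inl, Sum.elim_inr, one_mul, neg_mul, Finset.sum_neg_distrib] at hb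
  linear_combination ((cval W : ℂ) ^ m)⁻¹ * ((cval W : ℂ)⁻¹ ^ 2) * hb

/-- The pair of points of `ℝ^p × ℝ^q` underlying a point of `M`. -/
def ambPt (w : CompactM p q) : Amb p × Amb q := (w.1.1, w.2.1)

theorem eventually_radialExt {k : ℕ} {Z : Type*} [TopologicalSpace Z] {f : Sph k → ℂ} {u : Sph k}
    {g : EuclideanSpace ℝ (Fin (k + 1)) → ℂ} {j : EuclideanSpace ℝ (Fin (k + 1)) → Z}
    (hj : Continuous j) {Q : Z → Prop} (hQ : ∀ᶠ z in 𝓝 (j u.1), Q z)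
    (h : ∀ u' : Sph k, Q (j u'.1) → f u' = g u'.1) :
    ∀ᶠ x in 𝓝 u.1, radialExt f x = g (‖x‖⁻¹ • x) := by
  have hu : ‖u.1‖ = 1 := norm_eq_of_mem_sphere u
  have hu0 : u.1 ≠ 0 := by
    rw [← norm_ne_zero_iff, hu]
    exact one_ne_zero
  have h1 : Tendsto (fun x : EuclideanSpace ℝ (Fin (k + 1)) => j (‖x‖⁻¹ • x)) (𝓝 u.1)
      (𝓝 (j u.1)) := by
    have h2 := hj.continuousAt.comp (contDiffAt_normalize hu0).continuousAt
    have h3 : ‖u.1‖⁻¹ • u.1 = u.1 := by rw [hu, inv_one, one_smul]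
    simpa only [ContinuousAt, Function.comp_def, h3] using h2
  filter_upwards [h1.eventually hQ, isOpen_ne.mem_nhds hu0] with x hx hx0
  exact radialExt_eq f hx0 fun w hw => h w (by rw [hw]; exact hx)

/-- A function on `M` which agrees, near a point outside the zero set of `cval`, with the
homogeneous extension of a solution of the ultrahyperbolic wave equation satisfies the Yamabe
equation at this point. -/
theorem yamabeM_eq_zero_of_homExt (hp : 1 ≤ p) (hq : 1 ≤ q) (hm : (p - 1) + (q - 1) = 2 * (m + 1))
    {f : Flat p q → ℂ} (hf : ContDiff ℝ ∞ f)
    (hbox : ∀ y, ∑ i, signs p q i * pderiv i (pderiv i f) y = 0) {F : CompactM p q → ℂ}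
    {w : CompactM p q} (hc : cval (ambPt w) ≠ 0) {Q : Amb p × Amb q → Prop}
    (hQ : ∀ᶠ W in 𝓝 (ambPt w), Q W)
    (hF : ∀ w', Q (ambPt w') → F w' = homExt m f (ambPt w')) : yamabeM F w = 0 := by
  set W := ambPt w with hW
  have hg := (contDiffAt_homExt (m := m) hf hc).of_le two_le_infty
  have hl := sphereLaplacian_eq (f := fun u => F (u, w.2)) (u := w.1)
    (g := fun x => homExt m f (x, W.2)) (contDiffAt_slice_left hg)
    (eventually_radialExt (g := fun x => homExt m f (x, W.2))
      (f := fun u => F (u, w.2)) (j := fun x => (x, W.2)) (by fun_prop) hQ fun u' h => hF (u', w.2) h)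
  have hr := sphereLaplacian_eq (f := fun v => F (w.1, v)) (u := w.2)
    (g := fun y => homExt m f (W.1, y)) (contDiffAt_slice_right hg)
    (eventually_radialExt (g := fun y => homExt m f (W.1, y))
      (f := fun v => F (w.1, v)) (j := fun y => (W.1, y)) (by fun_prop) hQ fun v' h => hF (w.1, v') h)
  have e1 : w.1.1 = W.1 := rfl
  have e2 : w.2.1 = W.2 := rfl
  rw [e1, fderiv_slice_left hg, fderiv_fderiv_slice_left hg] at hl
  rw [e2, fderiv_slice_right hg, fderiv_fderiv_slice_right hg] at hr
  simp only [fderiv_fderiv_slice_left hg] at hl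
  simp only [fderiv_fderiv_slice_right hg] at hr
  have hEv : ∀ᶠ X in 𝓝 W, fderiv ℝ (homExt m f) X X = -(m : ℂ) * homExt m f X := by
    filter_upwards [contDiff_cval.continuous.continuousAt.eventually_ne hc] with X hX
    exact fderiv_homExt_self hf hX
  have h2 := fderiv_fderiv_of_homogeneous hg hEv
  have h1 := hEv.self_of_nhds
  have hsum : fderiv ℝ (homExt m f) W W = fderiv ℝ (homExt m f) W (W.1, 0) +
      fderiv ℝ (homExt m f) W (0, W.2) := by
    rw [← map_add]
    simp
  rw [hsum] at h1
  have hbx := sum_fderiv_fderiv_homExt (m := m) hf hbox hc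
  have hFw : F w = homExt m f W := hF w hQ.self_of_nhds
  have hp' : ((p - 1 : ℕ) : ℂ) = p - 1 := by push_cast [hp]; ring
  have hq' : ((q - 1 : ℕ) : ℂ) = q - 1 := by push_cast [hq]; ring
  have hmC : (p : ℂ) - 1 + (q - 1) = 2 * (m + 1) := by
    rw [← hp', ← hq']
    exact_mod_cast hm
  have hmC' : (p : ℂ) = 2 * m + 4 - q := by linear_combination hmC
  rw [yamabeM, hl, hr, hFw, hbx, hp', hq']
  rw [hmC']
  -- Euler's relations for the first and second derivatives, with `m = (p + q) / 2 - 2`.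
  linear_combination (-1 : ℂ) * h2 + ((q : ℂ) - m - 2) * h1

end

section

/-! ### The solution of the Yamabe equation which is attached to `S φ` -/

variable {p q m : ℕ}

/-- The value of the regularized kernel of `S` against `φ` at a point of the light cone. -/
def greenAmb (m : ℕ) (φ : CcInfty p q) (W : Amb p × Amb q) : ℂ :=
  greenConst q m * (polyVal m φ (coneCoeff W) + signEps p q * polyVal m φ (coneCoeff (-W)))

/-- The function on `M` whose twisted pull-back is `S φ`. -/
def greenM (m : ℕ) (φ : CcInfty p q) (w : CompactM p q) : ℂ := greenAmb m φ (ambPt w)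

/-- The normalization of both components of a pair of vectors. -/
def normPair (W : Amb p × Amb q) : Amb p × Amb q := (‖W.1‖⁻¹ • W.1, ‖W.2‖⁻¹ • W.2)

/-- The pairs of nonzero vectors. -/
def nonzeroPairs (p q : ℕ) : Set (Amb p × Amb q) := {W | W.1 ≠ 0 ∧ W.2 ≠ 0}

theorem isOpen_nonzeroPairs : IsOpen (nonzeroPairs p q) :=
  (isOpen_ne.preimage continuous_fst).inter (isOpen_ne.preimage continuous_snd)

theorem contDiffOn_normPair : ContDiffOn ℝ ∞ normPair (nonzeroPairs p q) := fun W hW =>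
  (((contDiffAt_normalize hW.1).comp W contDiffAt_fst).prodMk
    ((contDiffAt_normalize hW.2).comp W contDiffAt_snd)).contDiffWithinAt

theorem norm_normPair {W : Amb p × Amb q} (hW : W ∈ nonzeroPairs p q) :
    ‖(normPair W).1‖ = 1 ∧ ‖(normPair W).2‖ = 1 := by
  obtain ⟨h1, h2⟩ := hW
  constructor <;> simp [normPair, norm_smul, h1, h2]

theorem contDiffOn_greenAmb_normPair (hm : (p - 1) + (q - 1) = 2 * (m + 1)) (φ : CcInfty p q) :
    ContDiffOn ℝ ∞ (fun W => greenAmb m φ (normPair W)) (nonzeroPairs p q) := by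
  have h1 := contDiffOn_polyVal_comp hm (contDiff_coneCoeff.comp_contDiffOn contDiffOn_normPair)
    (fun W hW => coneCoeff_ne_zero (by
      rw [← norm_ne_zero_iff, (norm_normPair hW).1]; exact one_ne_zero))
    (fun W hW => isConePoly_coneCoeff (by rw [(norm_normPair hW).1, (norm_normPair hW).2])) φ
  have h2 := contDiffOn_polyVal_comp hm
    (contDiff_coneCoeff.comp_contDiffOn contDiffOn_normPair.neg)
    (fun W hW => coneCoeff_ne_zero (by
      change (-normPair W).1 ≠ 0
      rw [← norm_ne_zero_iff, Prod.fst_neg, norm_neg, (norm_normPair hW).1]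
      exact one_ne_zero))
    (fun W hW => isConePoly_coneCoeff (by
      change ‖(-normPair W).1‖ = ‖(-normPair W).2‖
      rw [Prod.fst_neg, Prod.snd_neg, norm_neg, norm_neg, (norm_normPair hW).1,
        (norm_normPair hW).2])) φ
  exact contDiffOn_const.mul (h1.add (contDiffOn_const.mul h2))

theorem norm_ambPt (w : CompactM p q) : ‖(ambPt w).1‖ = 1 ∧ ‖(ambPt w).2‖ = 1 :=
  ⟨norm_eq_of_mem_sphere w.1, norm_eq_of_mem_sphere w.2⟩

theorem ambPt_mem (w : CompactM p q) : ambPt w ∈ nonzeroPairs p q := by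
  constructor
  · rw [← norm_ne_zero_iff, (norm_ambPt w).1]; exact one_ne_zero
  · rw [← norm_ne_zero_iff, (norm_ambPt w).2]; exact one_ne_zero

theorem normPair_ambPt (w : CompactM p q) : normPair (ambPt w) = ambPt w := by
  rw [normPair, (norm_ambPt w).1, (norm_ambPt w).2]
  simp

theorem contDiffAt_greenAmb_normPair (hm : (p - 1) + (q - 1) = 2 * (m + 1)) (φ : CcInfty p q)
    (w : CompactM p q) : ContDiffAt ℝ ∞ (fun W => greenAmb m φ (normPair W)) (ambPt w) :=
  (contDiffOn_greenAmb_normPair hm φ).contDiffAt (isOpen_nonzeroPairs.mem_nhds (ambPt_mem w))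

theorem isSmoothM_greenM (hm : (p - 1) + (q - 1) = 2 * (m + 1)) (φ : CcInfty p q) :
    IsSmoothM (greenM m φ) := by
  have h1 : ContMDiff ((𝓡 (p - 1)).prod (𝓡 (q - 1))) 𝓘(ℝ, Amb p × Amb q) ∞
      (ambPt : CompactM p q → Amb p × Amb q) :=
    (contMDiff_coe_sphere.comp contMDiff_fst).prodMk_space
      (contMDiff_coe_sphere.comp contMDiff_snd)
  have h2 : greenM m φ = (fun W => greenAmb m φ (normPair W)) ∘ ambPt := by
    funext w
    rw [Function.comp_apply, normPair_ambPt, greenM]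
  intro w
  rw [h2]
  exact (contDiffAt_greenAmb_normPair hm φ w).contMDiffAt.comp w (h1 w)

theorem quadP_flatPart {W : Amb p × Amb q} (h : ‖W.1‖ = ‖W.2‖) :
    quadP (flatPart W) = 2 * cval W * (W.2 (Fin.last _) - W.1 0) := by
  have h1 : ‖W.1‖ ^ 2 = ‖W.2‖ ^ 2 := by rw [h]
  rw [EuclideanSpace.norm_sq_eq, EuclideanSpace.norm_sq_eq, Fin.sum_univ_succ,
    Fin.sum_univ_castSucc] at h1
  simp only [Real.norm_eq_abs, sq_abs] at h1
  simp only [quadP, flatPart, cval, Sum.elim_inl, Sum.elim_inr]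
  linear_combination h1

theorem quadP_smul (t : ℝ) (z : Flat p q) : quadP (t • z) = t ^ 2 * quadP z := by
  simp only [quadP, PiLp.smul_apply, smul_eq_mul, mul_pow, ← Finset.mul_sum, mul_sub]

theorem eq_smul_iota {W : Amb p × Amb q} (h : ‖W.1‖ = ‖W.2‖) (hc : cval W ≠ 0) :
    W = cval W • iota ((cval W)⁻¹ • flatPart W) := by
  have hP : cval W * (quadP ((cval W)⁻¹ • flatPart W) / 4) = (W.2 (Fin.last _) - W.1 0) / 2 := by
    rw [quadP_smul, quadP_flatPart h]
    field_simp
    ring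
  have hc' : cval W = (W.1 0 + W.2 (Fin.last _)) / 2 := rfl
  refine Prod.ext ?_ ?_
  · ext i
    refine Fin.cases ?_ (fun i => ?_) i
    · simp only [iota, iotaFst, Prod.smul_fst, PiLp.smul_apply, smul_eq_mul, Fin.cons_zero, mul_sub,
        mul_one]
      rw [hP, hc']
      ring
    · simp [iota, iotaFst, flatPart, hc]
  · ext i
    refine Fin.lastCases ?_ (fun i => ?_) i
    · simp only [iota, iotaSnd, Prod.smul_snd, PiLp.smul_apply, smul_eq_mul, Fin.snoc_last, mul_add,
        mul_one]
      rw [hP, hc']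
      ring
    · simp [iota, iotaSnd, flatPart, hc]

theorem quadPoly_coneCoeff {W : Amb p × Amb q} (h : ‖W.1‖ = ‖W.2‖) (hc : cval W ≠ 0)
    (x : Flat p q) :
    quadPoly (coneCoeff W) x = cval W * quadP ((cval W)⁻¹ • flatPart W - x) := by
  conv_lhs => rw [eq_smul_iota h hc, coneCoeff_smul, quadPoly_smul, quadPoly_coneCoeff_iota]

theorem fst_ne_zero_of_cval {W : Amb p × Amb q} (h : ‖W.1‖ = ‖W.2‖) (hc : cval W ≠ 0) :
    W.1 ≠ 0 := by
  intro h1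
  have h2 : W.2 = 0 := by rw [← norm_eq_zero, ← h, h1, norm_zero]
  exact hc (by simp [cval, h1, h2])

/-- The value at a point of the light cone outside the zero set of `cval`, with `σ` the sign of
`cval W`: completing the square turns it into a regularized power of `P`, and the two regularized
powers are exchanged if `cval W` is negative. -/
theorem polyVal_coneCoeff (hm : (p - 1) + (q - 1) = 2 * (m + 1)) (φ : CcInfty p q)
    {W : Amb p × Amb q} (h : ‖W.1‖ = ‖W.2‖) {σ : ℝ} (hσ : σ * σ = 1) (hc : 0 < σ * cval W) :
    polyVal m φ (coneCoeff W) = (((σ * cval W : ℝ) : ℂ) ^ m)⁻¹ *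
      regP p q m (-(σ : ℂ) * Complex.I) (reflT φ ((cval W)⁻¹ • flatPart W)) := by
  have hc0 : cval W ≠ 0 := right_ne_zero_of_mul hc.ne'
  have hσ0 : (σ : ℂ) ≠ 0 := by exact_mod_cast left_ne_zero_of_mul hc.ne'
  have hσC : (σ : ℂ) * σ = 1 := by exact_mod_cast congrArg (fun r : ℝ => (r : ℂ)) hσ
  rw [polyVal_eq_regP hm (coneCoeff_ne_zero (fst_ne_zero_of_cval h hc0)) (isConePoly_coneCoeff h) hc
    (s := -(σ : ℂ) * Complex.I) (by simp) (mul_ne_zero (neg_ne_zero.2 hσ0) Complex.I_ne_zero)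
    (z := (cval W)⁻¹ • flatPart W) ?_ φ, Complex.cpow_neg, Complex.cpow_natCast]
  intro x
  rw [quadPoly_coneCoeff h hc0]
  push_cast
  linear_combination (Complex.I * cval W * quadP ((cval W)⁻¹ • flatPart W - x)) * hσC

theorem cval_neg (W : Amb p × Amb q) : cval (-W) = -cval W := by
  have := cval_smul (-1) W
  simpa using this

theorem inv_cval_smul_flatPart_neg (W : Amb p × Amb q) :
    (cval (-W))⁻¹ • flatPart (-W) = (cval W)⁻¹ • flatPart W := by
  have := flatPart_smul (-1) W
  rw [neg_one_smul, neg_one_smul] at this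
  rw [cval_neg, this, inv_neg, smul_neg, neg_smul, neg_neg]

theorem signEps_mul_self : (signEps p q : ℂ) * signEps p q = 1 := by
  rcases signEps_eq p q with h | h <;> simp [h]

/-- Outside the zero set of `cval`, the function on the light cone is, up to a constant on each
half, the homogeneous extension of `S φ`. -/
theorem greenAmb_eq_homExt (hp : 1 ≤ p) (hq : 1 ≤ q) (hm : (p - 1) + (q - 1) = 2 * (m + 1))
    (φ : CcInfty p q) {W : Amb p × Amb q} (h : ‖W.1‖ = ‖W.2‖) :
    (0 < cval W → greenAmb m φ W = homExt m (opS p q φ) W) ∧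
    (cval W < 0 → greenAmb m φ W =
      homExt m (fun z => signEps p q * (-1) ^ m * opS p q φ z) W) := by
  have hn : ‖(-W).1‖ = ‖(-W).2‖ := by
    rw [Prod.fst_neg, Prod.snd_neg, norm_neg, norm_neg, h]
  constructor
  · intro hc
    have h1 := polyVal_coneCoeff hm φ h (σ := 1) (by norm_num) (by linarith)
    have h2 := polyVal_coneCoeff hm φ hn (σ := -1) (by norm_num) (by rw [cval_neg]; linarith)
    rw [inv_cval_smul_flatPart_neg, cval_neg] at h2
    simp only [Complex.ofReal_neg, Complex.ofReal_one, neg_neg, one_mul, neg_mul] at h1 h2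
    rw [greenAmb, h1, h2, homExt, opS_eq hp hq hm]
    ring
  · intro hc
    have h1 := polyVal_coneCoeff hm φ h (σ := -1) (by norm_num) (by linarith)
    have h2 := polyVal_coneCoeff hm φ hn (σ := 1) (by norm_num) (by rw [cval_neg]; linarith)
    rw [inv_cval_smul_flatPart_neg, cval_neg] at h2
    simp only [Complex.ofReal_neg, Complex.ofReal_one, neg_neg, one_mul, neg_mul] at h1 h2
    have hpow : ((-(cval W : ℂ)) ^ m)⁻¹ = ((cval W : ℂ) ^ m)⁻¹ * (-1) ^ m := by
      rw [neg_pow, mul_inv, mul_comm]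
      congr 1
      rw [← inv_pow]
      norm_num
    rw [greenAmb, h1, h2, homExt, opS_eq hp hq hm, hpow]
    linear_combination (-((cval W : ℂ) ^ m)⁻¹ * (-1) ^ m * greenConst q m *
      regP p q m Complex.I (reflT φ ((cval W)⁻¹ • flatPart W))) * signEps_mul_self (p := p) (q := q)

theorem yamabeM_greenM_of_ne (hp : 1 ≤ p) (hq : 1 ≤ q) (hm : (p - 1) + (q - 1) = 2 * (m + 1))
    (hm1 : 1 ≤ m) (φ : CcInfty p q) {w : CompactM p q} (hc : cval (ambPt w) ≠ 0) :
    yamabeM (greenM m φ) w = 0 := by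
  have hn : ∀ w : CompactM p q, ‖(ambPt w).1‖ = ‖(ambPt w).2‖ := fun w => by
    rw [(norm_ambPt w).1, (norm_ambPt w).2]
  have hcont : Continuous (cval : Amb p × Amb q → ℝ) := contDiff_cval.continuous
  have hS := contDiff_opS hp hq hm φ
  have hb := sum_signs_mul_pderiv_opS hp hq hm hm1 φ
  rcases hc.lt_or_gt with h | h
  · refine yamabeM_eq_zero_of_homExt hp hq hm (contDiff_const.mul hS) (fun y => ?_) hc
      (hcont.continuousAt.eventually_lt continuousAt_const h)
      fun w' hw' => (greenAmb_eq_homExt hp hq hm φ (hn w')).2 hw'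
    have e : ∀ i, pderiv i (pderiv i fun z => signEps p q * (-1) ^ m * opS p q φ z) y =
        signEps p q * (-1) ^ m * pderiv i (pderiv i (opS p q φ)) y := by
      intro i
      have h1 : pderiv i (fun z => signEps p q * (-1) ^ m * opS p q φ z) =
          fun z => signEps p q * (-1) ^ m * pderiv i (opS p q φ) z :=
        funext fun z => pderiv_const_mul (hS.differentiable (by simp) z) _ i
      rw [h1]
      exact pderiv_const_mul ((contDiff_pderiv hS i).differentiable (by simp) y) _ i
    simp only [e, mul_left_comm _ (_ * _) _, ← Finset.mul_sum, hb, mul_zero]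
  · exact yamabeM_eq_zero_of_homExt hp hq hm hS hb hc
      (continuousAt_const.eventually_lt hcont.continuousAt h)
      fun w' hw' => (greenAmb_eq_homExt hp hq hm φ (hn w')).1 hw'

theorem continuous_yamabeM_greenM (hm : (p - 1) + (q - 1) = 2 * (m + 1)) (φ : CcInfty p q) :
    Continuous (yamabeM (greenM m φ)) := by
  set G : Amb p × Amb q → ℂ := fun W => greenAmb m φ (normPair W) with hG
  have hGc : ∀ w : CompactM p q, ContDiffAt ℝ ∞ G (ambPt w) := contDiffAt_greenAmb_normPair hm φ
  have hGF : ∀ w : CompactM p q, greenM m φ w = G (ambPt w) := fun w => by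
    rw [hG, greenM]
    simp only
    rw [normPair_ambPt]
  have hl : ∀ w : CompactM p q, sphereLaplacian (fun u => greenM m φ (u, w.2)) w.1 =
      ∑ i, fderiv ℝ (fderiv ℝ G) (ambPt w) (EuclideanSpace.single i 1, 0)
        (EuclideanSpace.single i 1, 0) := by
    intro w
    have h1 : radialExt (fun u => greenM m φ (u, w.2)) =ᶠ[𝓝 w.1.1] fun x => G (x, (ambPt w).2) := by
      filter_upwards [isOpen_ne.mem_nhds (ambPt_mem w).1] with x hx
      rw [radialExt, dif_pos hx]
      simp only [hG, greenM, normPair, ambPt, norm_eq_of_mem_sphere, inv_one, one_smul]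
    rw [sphereLaplacian, (InnerProductSpace.laplacian_congr_nhds h1).self_of_nhds,
      laplacian_eq_sum_fderiv]
    exact Finset.sum_congr rfl fun i _ =>
      fderiv_fderiv_slice_left ((hGc w).of_le two_le_infty) _
  have hr : ∀ w : CompactM p q, sphereLaplacian (fun v => greenM m φ (w.1, v)) w.2 =
      ∑ i, fderiv ℝ (fderiv ℝ G) (ambPt w) (0, EuclideanSpace.single i 1)
        (0, EuclideanSpace.single i 1) := by
    intro w
    have h1 : radialExt (fun v => greenM m φ (w.1, v)) =ᶠ[𝓝 w.2.1] fun y => G ((ambPt w).1, y) := by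
      filter_upwards [isOpen_ne.mem_nhds (ambPt_mem w).2] with y hy
      rw [radialExt, dif_pos hy]
      simp only [hG, greenM, normPair, ambPt, norm_eq_of_mem_sphere, inv_one, one_smul]
    rw [sphereLaplacian, (InnerProductSpace.laplacian_congr_nhds h1).self_of_nhds,
      laplacian_eq_sum_fderiv]
    exact Finset.sum_congr rfl fun i _ =>
      fderiv_fderiv_slice_right ((hGc w).of_le two_le_infty) _
  have hamb : Continuous (ambPt : CompactM p q → Amb p × Amb q) := by
    unfold ambPt
    fun_prop
  have hGcont : Continuous fun w : CompactM p q => G (ambPt w) :=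
    continuous_iff_continuousAt.2 fun w =>
      ContinuousAt.comp (g := G) (f := ambPt) (hGc w).continuousAt hamb.continuousAt
  have hD : Continuous fun w : CompactM p q => fderiv ℝ (fderiv ℝ G) (ambPt w) :=
    continuous_iff_continuousAt.2 fun w => by
      have h1 : ContDiffAt ℝ 0 (fderiv ℝ (fderiv ℝ G)) (ambPt w) :=
        (((hGc w).of_le two_le_infty).fderiv_right (m := 1) (by norm_num)).fderiv_right (m := 0)
          (by norm_num)
      exact ContinuousAt.comp (g := fderiv ℝ (fderiv ℝ G)) (f := ambPt) h1.continuousAt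
        hamb.continuousAt
  have hE : ∀ X : Amb p × Amb q, Continuous fun w : CompactM p q =>
      fderiv ℝ (fderiv ℝ G) (ambPt w) X X := fun X =>
    (hD.clm_apply continuous_const).clm_apply continuous_const
  have e : yamabeM (greenM m φ) = fun w => _ := funext fun w => by
    rw [yamabeM, hl, hr, hGF]
  rw [e]
  exact (((continuous_finsetSum _ fun i _ => hE _).sub (continuous_finsetSum _ fun i _ => hE _)).sub
    (continuous_const.mul hGcont)).add (continuous_const.mul hGcont)

/-- A coordinate of a sphere of positive dimension is not locally constant. -/
theorem not_eventually_coord_eq {k : ℕ} (hk : 1 ≤ k) (u : Sph k) (c : ℝ) :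
    ¬ ∀ᶠ u' in 𝓝 u, u'.1 0 = c := by
  intro h
  have hc : u.1 0 = c := h.self_of_nhds
  have hu : ‖u.1‖ = 1 := norm_eq_of_mem_sphere u
  have hu0 : u.1 ≠ 0 := by
    rw [← norm_ne_zero_iff, hu]
    exact one_ne_zero
  rw [nhds_subtype_eq_comap, eventually_comap] at h
  have key : ∀ i, ∀ᶠ t in 𝓝 (0 : ℝ),
      (u.1 0 + t * (EuclideanSpace.single i (1 : ℝ) : EuclideanSpace ℝ (Fin (k + 1))) 0) ^ 2 =
        c ^ 2 * (1 + 2 * t * u.1 i + t ^ 2) := by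
    intro i
    have hx : ContinuousAt (fun t : ℝ => u.1 + t • EuclideanSpace.single i (1 : ℝ)) 0 := by
      fun_prop
    have hx0 : u.1 + (0 : ℝ) • EuclideanSpace.single i (1 : ℝ) = u.1 := by simp
    have hN : Tendsto (fun t : ℝ => ‖u.1 + t • EuclideanSpace.single i (1 : ℝ)‖⁻¹ •
        (u.1 + t • EuclideanSpace.single i (1 : ℝ))) (𝓝 0) (𝓝 u.1) := by
      have h1 := ContinuousAt.comp (g := fun x : EuclideanSpace ℝ (Fin (k + 1)) => ‖x‖⁻¹ • x)
        (x := (0 : ℝ)) (f := fun t : ℝ => u.1 + t • EuclideanSpace.single i (1 : ℝ))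
        (by rw [hx0]; exact (contDiffAt_normalize hu0).continuousAt) hx
      simpa [ContinuousAt, Function.comp_def, hu] using h1
    filter_upwards [hN.eventually h, hx.eventually_ne (by rw [hx0]; exact hu0)] with t ht ht0
    have hn := norm_ne_zero_iff.2 ht0
    have h1 := ht ⟨_, by
      rw [mem_sphere_zero_iff_norm, norm_smul, norm_inv, norm_norm, inv_mul_cancel₀ hn]⟩ rfl
    simp only [PiLp.smul_apply, PiLp.add_apply, smul_eq_mul] at h1
    rw [inv_mul_eq_iff_eq_mul₀ hn] at h1
    rw [h1, mul_pow, norm_sq_add_single, hu]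
    ring
  -- Perturbations along the first and the last coordinate contradict each other: the last one
  -- forces `c = 0`, and then the first one forces `t² = 0`.
  have h1 := key 0
  have h2 := key (Fin.last k)
  have hlast : (0 : Fin (k + 1)) ≠ Fin.last k := by
    intro h
    have := congrArg Fin.val h
    simp at this
    omega
  obtain ⟨ε, hε, hball⟩ := Metric.eventually_nhds_iff.1 (h1.and h2)
  have t1 := hball (y := ε / 2) (by
    simp only [dist_zero_right, Real.norm_eq_abs]
    rw [abs_of_pos (by positivity)]
    linarith)
  have t2 := hball (y := ε / 4) (by
    simp only [dist_zero_right, Real.norm_eq_abs]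
    rw [abs_of_pos (by positivity)]
    linarith)
  simp only [PiLp.single_apply, if_true, hlast, if_false, mul_one, mul_zero, add_zero,
    hc] at t1 t2
  obtain ⟨a1, b1⟩ := t1
  obtain ⟨a2, b2⟩ := t2
  have hc0 : c ^ 2 * ε ^ 2 = 0 := by linear_combination -8 * b1 + 16 * b2
  have hc1 : c = 0 := by
    rcases mul_eq_zero.1 hc0 with h | h
    · exact pow_eq_zero_iff two_ne_zero |>.1 h
    · exact absurd (pow_eq_zero_iff two_ne_zero |>.1 h) hε.ne'
  rw [hc1] at a1
  nlinarith

/-- The Yamabe equation holds outside the zero set of `cval`, which has dense complement in `M`, and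
the left-hand side is continuous. -/
theorem yamabeM_greenM (hp : 2 ≤ p) (hq : 1 ≤ q) (hm : (p - 1) + (q - 1) = 2 * (m + 1))
    (hm1 : 1 ≤ m) (φ : CcInfty p q) (w : CompactM p q) : yamabeM (greenM m φ) w = 0 := by
  by_contra hw
  have h1 := (continuous_yamabeM_greenM hm φ).continuousAt.eventually_ne hw
  have h2 : Tendsto (fun u => (u, w.2)) (𝓝 w.1) (𝓝 w) :=
    (Continuous.prodMk_left w.2).tendsto w.1
  refine not_eventually_coord_eq (by omega) w.1 (-w.2.1 (Fin.last _)) ?_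
  filter_upwards [h2.eventually h1] with u hu
  by_contra hne
  refine hu (yamabeM_greenM_of_ne (by omega) hq hm hm1 φ fun hc => hne ?_)
  have hc : (u.1 0 + w.2.1 (Fin.last _)) / 2 = 0 := hc
  linarith

theorem ambPt_PsiEmb (z : Flat p q) : ambPt (PsiEmb z) = (tau z)⁻¹ • iota z := rfl

theorem cval_iota (z : Flat p q) : cval (iota z) = 1 := by
  simp [cval, iota, iotaFst, iotaSnd]

theorem flatPart_iota (z : Flat p q) : flatPart (iota z) = z := by
  ext (i | i) <;> simp [flatPart, iota, iotaFst, iotaSnd]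

/-- `S φ` is the twisted pull-back of a solution of the Yamabe equation. -/
theorem twistedPullback_greenM (hp : 1 ≤ p) (hq : 1 ≤ q) (hm : (p - 1) + (q - 1) = 2 * (m + 1))
    (φ : CcInfty p q) : twistedPullback (m : ℂ) (greenM m φ) = opS p q φ := by
  funext z
  have ht : 0 < tau z := lt_of_le_of_ne (norm_nonneg _) (tau_ne_zero z).symm
  have htC : (tau z : ℂ) ≠ 0 := by exact_mod_cast ht.ne'
  have hc : cval (ambPt (PsiEmb z)) = (tau z)⁻¹ := by
    rw [ambPt_PsiEmb, cval_smul, cval_iota, mul_one]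
  have hf : flatPart (ambPt (PsiEmb z)) = (tau z)⁻¹ • z := by
    rw [ambPt_PsiEmb, flatPart_smul, flatPart_iota]
  rw [twistedPullback, greenM, (greenAmb_eq_homExt hp hq hm φ (by
    rw [(norm_ambPt _).1, (norm_ambPt _).2])).1 (by rw [hc]; positivity), homExt, hc, hf, inv_inv,
    smul_smul, mul_inv_cancel₀ ht.ne', one_smul, Complex.cpow_neg, Complex.cpow_natCast]
  push_cast
  rw [inv_pow, inv_inv, inv_mul_cancel_left₀ (pow_ne_zero m htC)]

end

end UltraHyperbolic

end

theorem proposition4p6 (p q : ℕ) (hp : 2 ≤ p) (hq : 2 ≤ q) (hpar : p ≡ q [MOD 2])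
    (hne : (p, q) ≠ (2, 2)) :
    -- the two distributions exist
    UltraHyperbolic.IsQuadPAddIZeroPow (1 - (UltraHyperbolic.dimN p q : ℂ) / 2)
      (UltraHyperbolic.quadPAddIZeroPow p q (1 - (UltraHyperbolic.dimN p q : ℂ) / 2)) ∧
    UltraHyperbolic.IsKnappSteinKernel (1 - (UltraHyperbolic.dimN p q : ℂ) / 2)
      (UltraHyperbolic.signEps p q)
      (UltraHyperbolic.knappSteinKernel p q (1 - (UltraHyperbolic.dimN p q : ℂ) / 2)
        (UltraHyperbolic.signEps p q)) ∧
    -- the Knapp–Stein kernel is a multiple of the Green function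
    UltraHyperbolic.knappSteinKernel p q (1 - (UltraHyperbolic.dimN p q : ℂ) / 2)
        (UltraHyperbolic.signEps p q) =
      UltraHyperbolic.cmul (UltraHyperbolic.constC₂ p q : ℂ) (UltraHyperbolic.greenE₀ p q) ∧
    -- the Knapp–Stein operator is a multiple of `S`
    (∀ φ : UltraHyperbolic.CcInfty p q, ∀ y : UltraHyperbolic.Flat p q,
      UltraHyperbolic.knappSteinFlat p q 1 (UltraHyperbolic.signEps p q) φ y =
        2 * (UltraHyperbolic.constC₂ p q : ℂ) * UltraHyperbolic.opS p q φ y) ∧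
    -- the image of `S` lies in the twisted pull-back of the kernel of the Yamabe operator
    Set.range (UltraHyperbolic.opS p q) ⊆
      UltraHyperbolic.twistedPullback (((UltraHyperbolic.dimN p q : ℂ) - 2) / 2) ''
        UltraHyperbolic.kerYamabe p q := by
  -- The exponent `1 - n / 2` is `-m`, and `(p, q) ≠ (2, 2)` means that `m` is positive.
  obtain ⟨m, hm, hm1⟩ : ∃ m : ℕ, (p - 1) + (q - 1) = 2 * (m + 1) ∧ 1 ≤ m := by
    have h1 : p % 2 = q % 2 := hpar
    have h2 : ¬ (p = 2 ∧ q = 2) := fun h => hne (Prod.ext h.1 h.2)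
    exact ⟨(p + q) / 2 - 2, by omega, by omega⟩
  have hp1 : 1 ≤ p := by omega
  have hq1 : 1 ≤ q := by omega
  have hP := UltraHyperbolic.isQuadPAddIZeroPow_regDistr (p := p) (q := q) hm
  have hK := UltraHyperbolic.isKnappSteinKernel_regPDistr (p := p) (q := q) hp1 hq1 hm hm1
    (UltraHyperbolic.signEps_eq p q)
  have hker : UltraHyperbolic.knappSteinKernel p q (1 - (UltraHyperbolic.dimN p q : ℂ) / 2)
      (UltraHyperbolic.signEps p q) =
      UltraHyperbolic.cmul (UltraHyperbolic.constC₂ p q : ℂ) (UltraHyperbolic.greenE₀ p q) := by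
    rw [UltraHyperbolic.one_sub_dimN_div_two hp1 hq1 hm, hK.knappSteinKernel_eq,
      UltraHyperbolic.greenE₀_eq hp1 hq1 hm,
      ← UltraHyperbolic.constC₂_mul_greenConst hp1 hq1 hm hm1]
    ext φ
    simp only [UltraHyperbolic.cmul_apply, mul_assoc]
    rfl
  refine ⟨?_, ?_, hker, fun φ y => ?_, ?_⟩
  · rw [UltraHyperbolic.one_sub_dimN_div_two hp1 hq1 hm, hP.quadPAddIZeroPow_eq]
    exact hP
  · rw [UltraHyperbolic.one_sub_dimN_div_two hp1 hq1 hm, hK.knappSteinKernel_eq]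
    exact hK
  · rw [UltraHyperbolic.knappSteinFlat, hker, UltraHyperbolic.conv_cmul, UltraHyperbolic.opS,
      mul_assoc]
  · rintro _ ⟨φ, rfl⟩
    have hl : ((UltraHyperbolic.dimN p q : ℂ) - 2) / 2 = m := by
      linear_combination -UltraHyperbolic.one_sub_dimN_div_two hp1 hq1 hm
    exact ⟨UltraHyperbolic.greenM m φ, ⟨UltraHyperbolic.isSmoothM_greenM hm φ,
      UltraHyperbolic.yamabeM_greenM hp hq1 hm hm1 φ⟩, by
        rw [hl, UltraHyperbolic.twistedPullback_greenM hp1 hq1 hm]⟩
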